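/- **Setting.** Let $\lambda\in\mathbb R$, $\sigma_v^2>0$, $\sigma_n^2>0$. The Gauss–Markov source is $x_t=\lambda x_{t-1}+v_t$ ($t\ge 1$, $x_0=0$) with $v_t$ i.i.d. $\mathcal N(0,\sigma_v^2)$, and the side information is $y_t=x_t+n_t$ with $n_t$ i.i.d. $\mathcal N(0,\sigma_n^2)$ independent of $(v_t)$. Write $a^t=(a_1,\dots,a_t)$, $I(x^T\to w^T)=\sum_{t=1}^T I(x^t;w_t\mid w^{t-1})$ and $I(x^T\to w^T\,\|\,y^T)=\sum_{t=1}^T I(x^t;w_t\mid w^{t-1},y^t)$. For $D\ge 0$ define $$R_c^{\mathrm{dec}}(D)=\limsup_{T\to\infty}\ \inf\ \tfrac1T I(x^T\to w^T),\qquad R_c^{\mathrm{KH}}(D)=\limsup_{T\to\infty}\ \inf\ \tfrac1T I(x^T\to w^T\,\|\,y^T),$$ where both infima are over all causal kernels $\prod_{t\le T}P(w_t\mid w^{t-1},x^t)$ (so that, given $(x^t,w^{t-1})$, $w_t$ is independent of the side information and of the future of the source) and all measurable reconstructions $\hat x_t(w^t,y^t)$ with $\frac1T\sum_{t\le T}\mathbb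 E(x_t-\hat x_t)^2\le D$; and $$R_c^{\mathrm{both}}(D)=\limsup_{T\to\infty}\ \inf\ \tfrac1T I(x^T\to \hat x^T\,\|\,y^T),$$ where the infimum is over all causal kernels $\prod_{t\le T}P(\hat x_t\mid \hat x^{t-1},x^t,y^t)$ with $\frac1T\sum_{t\le T}\mathbb E(x_t-\hat x_t)^2\le D$. For each of these nonincreasing functions let $R^{-1}(C)=\inf\{D: R(D)\le C\}$. Consider a memoryless channel $P(b\mid a)$ with standard Borel alphabets, possibly with an average input-cost constraint $\Gamma$ for a measurable cost $c\ge 0$ ($c=0$ meaning no constraint), and let $C=\sup\{I(a;b):\mathbb E\,c(a)\le\Gamma\}$ be its capacity (in the same units as the rates above). A tracking scheme of horizon $T$ consists of measurable causal encoders $a_t=F_t(x^t)$ with $\frac1T\sum_{t\le T}\mathbb E\,c(a_t)\le\Gamma$, one channel use per source sample with output $b_t$, and measurable causal decoders $\hat x_t=G_t(b^t,y^t)$. Let $D_{c,op}^{\mathrm{dec}}$ be the minimum distortion over the channel: the limit superior, as $T\to\infty$, of the infimum over schemes of horizon $T$ of $\frac1T\sum_{t\le T}\mathbb E(x_t-\hat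 x_t)^2$. **Corollary.** One has $$D_{c,op}^{\mathrm{dec}}\ \ge\ (R_c^{\mathrm{dec}})^{-1}(C),\qquad (R_c^{\mathrm{KH}})^{-1}(C)=(R_c^{\mathrm{both}})^{-1}(C),$$ and, whenever $0<C<\infty$, $$(R_c^{\mathrm{dec}})^{-1}(C)\ >\ (R_c^{\mathrm{KH}})^{-1}(C).$$ -/

import Mathlib

open MeasureTheory ProbabilityTheory Filter
open scoped ENNReal NNReal

namespace CausalTracking

noncomputable section

/-! Time is indexed from `0`: the sample at index `k` is the sample at time `k + 1` of a horizon
`1, …, T`.  All information quantities are in nats and take values in `[0, ∞]`. -/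

/-- The first `k` samples of a sequence. -/
def hist {S : Type*} (s : ℕ → S) (k : ℕ) : Fin k → S := fun i => s i

theorem measurable_hist {S : Type*} [MeasurableSpace S] (k : ℕ) :
    Measurable (fun s : ℕ → S => hist s k) :=
  measurable_pi_lambda _ fun i => measurable_pi_apply (i : ℕ)

/-- The first `k` samples of a sequence of length `T`. -/
def histFin {T : ℕ} {W : Type*} (w : Fin T → W) {k : ℕ} (hk : k ≤ T) : Fin k → W :=
  fun i => w (Fin.castLE hk i)

/-! ### Source and side information -/

/-- The Gauss–Markov recursion `x_t = lam * x_{t-1} + v_t` with zero initial condition. -/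
def gaussMarkov (lam : ℝ) (v : ℕ → ℝ) : ℕ → ℝ
  | 0 => v 0
  | k + 1 => lam * gaussMarkov lam v k + v (k + 1)

/-- The law of the i.i.d. sequence of pairs `(v_t, n_t)` of independent centred Gaussians of
variances `varV` (system disturbance) and `varN` (side-information noise). -/
def noiseLaw (varV varN : ℝ≥0) : Measure (ℕ → ℝ × ℝ) :=
  Measure.infinitePi fun _ => (gaussianReal 0 varV).prod (gaussianReal 0 varN)

/-- The sequence of pairs `(x_t, y_t)`, `y_t = x_t + n_t`, as a function of the noises. -/
def sourceMap (lam : ℝ) (e : ℕ → ℝ × ℝ) : ℕ → ℝ × ℝ := fun k =>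
  (gaussMarkov lam (fun i => (e i).1) k, gaussMarkov lam (fun i => (e i).1) k + (e k).2)

/-- The joint law of the source and of the side information, `(x_t, y_t)_t`. -/
def sourceLaw (lam : ℝ) (varV varN : ℝ≥0) : Measure (ℕ → ℝ × ℝ) :=
  (noiseLaw varV varN).map (sourceMap lam)

theorem measurable_gaussMarkov (lam : ℝ) (k : ℕ) :
    Measurable (fun e : ℕ → ℝ × ℝ => gaussMarkov lam (fun i => (e i).1) k) := by
  induction k with
  | zero => exact measurable_fst.comp (measurable_pi_apply 0)
  | succ k ih =>
    exact (ih.const_mul lam).add (measurable_fst.comp (measurable_pi_apply (k + 1)))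

theorem measurable_sourceMap (lam : ℝ) : Measurable (sourceMap lam) :=
  measurable_pi_lambda _ fun k => (measurable_gaussMarkov lam k).prodMk
    ((measurable_gaussMarkov lam k).add (measurable_snd.comp (measurable_pi_apply k)))

instance (lam : ℝ) (varV varN : ℝ≥0) : IsProbabilityMeasure (sourceLaw lam varV varN) := by
  unfold sourceLaw noiseLaw
  exact Measure.isProbabilityMeasure_map (measurable_sourceMap lam).aemeasurable

/-- The source part `x` of a sequence of pairs `(x_t, y_t)`. -/
def srcX (s : ℕ → ℝ × ℝ) : ℕ → ℝ := fun k => (s k).1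

/-- The side-information part `y` of a sequence of pairs `(x_t, y_t)`. -/
def srcY (s : ℕ → ℝ × ℝ) : ℕ → ℝ := fun k => (s k).2

theorem measurable_srcX : Measurable srcX :=
  measurable_pi_lambda _ fun k => measurable_fst.comp (measurable_pi_apply k)

/-! ### Causally conditioned kernels -/

/-- The factors `P(w_t | s^t, w^{t-1})` of a causally conditioned kernel
`P(w^T ‖ s^T) = ∏_t P(w_t | s^t, w^{t-1})`. -/
structure CausalKernel (S W : Type*) [MeasurableSpace S] [MeasurableSpace W] where
  step : ∀ k : ℕ, Kernel ((Fin (k + 1) → S) × (Fin k → W)) W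
  markov : ∀ k, IsMarkovKernel (step k)

/-- The product kernel `P(w^T ‖ s^T)`: given the whole sequence `s`, the samples `w_1, …, w_T` are
drawn successively, `w_t` from `P(· | s^t, w^{t-1})`. -/
def CausalKernel.law {S W : Type*} [MeasurableSpace S] [MeasurableSpace W]
    (κ : CausalKernel S W) : ∀ T : ℕ, Kernel (ℕ → S) (Fin T → W)
  | 0 => Kernel.const _ (Measure.dirac fun i => i.elim0)
  | T + 1 =>
    ((κ.law T) ⊗ₖ ((κ.step T).comap
        (fun p : (ℕ → S) × (Fin T → W) => (hist p.1 (T + 1), p.2))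
        (((measurable_hist (T + 1)).comp measurable_fst).prodMk measurable_snd))).map
      fun q : (Fin T → W) × W => (Fin.snoc q.1 q.2 : Fin (T + 1) → W)

theorem measurable_snoc {W : Type*} [MeasurableSpace W] (T : ℕ) :
    Measurable fun q : (Fin T → W) × W => (Fin.snoc q.1 q.2 : Fin (T + 1) → W) := by
  refine measurable_pi_lambda _ fun i => ?_
  refine Fin.lastCases ?_ (fun j => ?_) i
  · simpa using measurable_snd
  · simpa [Function.comp_def] using (measurable_pi_apply j).comp measurable_fst

instance {S W : Type*} [MeasurableSpace S] [MeasurableSpace W] (κ : CausalKernel S W) (T : ℕ) :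
    IsMarkovKernel (κ.law T) := by
  induction T with
  | zero => unfold CausalKernel.law; infer_instance
  | succ T ih =>
    have := κ.markov T
    unfold CausalKernel.law
    exact Kernel.IsMarkovKernel.map _ (measurable_snoc T)

/-- The joint law of `((x_t, y_t)_t, w^T)` when `w^T` is produced from the source alone by
`P(w^T ‖ x^T)`.  Given `(x^t, w^{t-1})`, the sample `w_t` is independent of `y` (and of the future
of `x`), so the Markov chain `(y^t, x^{t-1}) - (x^t, w^{t-1}) - w_t` holds by construction. -/
def jointDec {W : Type*} [MeasurableSpace W] (lam : ℝ) (varV varN : ℝ≥0)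
    (κ : CausalKernel ℝ W) (T : ℕ) : Measure ((ℕ → ℝ × ℝ) × (Fin T → W)) :=
  sourceLaw lam varV varN ⊗ₘ (κ.law T).comap srcX measurable_srcX

/-- The joint law of `((x_t, y_t)_t, w^T)` when `w^T` is produced from the source and the side
information by `P(w^T ‖ x^T, y^T)`. -/
def jointBoth {W : Type*} [MeasurableSpace W] (lam : ℝ) (varV varN : ℝ≥0)
    (κ : CausalKernel (ℝ × ℝ) W) (T : ℕ) : Measure ((ℕ → ℝ × ℝ) × (Fin T → W)) :=
  sourceLaw lam varV varN ⊗ₘ κ.law T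

instance {W : Type*} [MeasurableSpace W] (lam : ℝ) (varV varN : ℝ≥0)
    (κ : CausalKernel ℝ W) (T : ℕ) : IsProbabilityMeasure (jointDec lam varV varN κ T) := by
  unfold jointDec; infer_instance

instance {W : Type*} [MeasurableSpace W] (lam : ℝ) (varV varN : ℝ≥0)
    (κ : CausalKernel (ℝ × ℝ) W) (T : ℕ) :
    IsProbabilityMeasure (jointBoth lam varV varN κ T) := by
  unfold jointBoth; infer_instance

/-! ### Directed information -/

/-- The conditional mutual information `I(X; Y | Z)`: the divergence of the law of `(Z, X, Y)` from
`P_Z ⊗ P_{X|Z} ⊗ P_{Y|Z}`. -/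
def condMutualInfo {Ω A B E : Type*} [MeasurableSpace Ω]
    [MeasurableSpace A] [StandardBorelSpace A] [Nonempty A]
    [MeasurableSpace B] [StandardBorelSpace B] [Nonempty B] [MeasurableSpace E]
    (μ : Measure Ω) [IsFiniteMeasure μ] (X : Ω → A) (Y : Ω → B) (Z : Ω → E) : ℝ≥0∞ :=
  InformationTheory.klDiv (μ.map fun ω => (Z ω, X ω, Y ω))
    ((μ.map Z) ⊗ₘ (condDistrib X Z μ ×ₖ condDistrib Y Z μ))

/-- The directed information `I(x^T → w^T) = ∑_t I(x^t; w_t | w^{t-1})`. -/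
def directedInfo {T : ℕ} (μ : Measure ((ℕ → ℝ × ℝ) × (Fin T → ℝ))) [IsFiniteMeasure μ] : ℝ≥0∞ :=
  ∑ t : Fin T, condMutualInfo μ
    (fun ω => hist (srcX ω.1) (t + 1)) (fun ω => ω.2 t) (fun ω => histFin ω.2 t.isLt.le)

/-- The causally conditional directed information
`I(x^T → w^T ‖ y^T) = ∑_t I(x^t; w_t | w^{t-1}, y^t)`. -/
def condDirectedInfo {T : ℕ} (μ : Measure ((ℕ → ℝ × ℝ) × (Fin T → ℝ))) [IsFiniteMeasure μ] :
    ℝ≥0∞ :=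
  ∑ t : Fin T, condMutualInfo μ
    (fun ω => hist (srcX ω.1) (t + 1)) (fun ω => ω.2 t)
    (fun ω => (histFin ω.2 t.isLt.le, hist (srcY ω.1) (t + 1)))

/-! ### Reconstruction and distortion -/

/-- A causal reconstruction rule `x̂_t = x̂_t(w^t, y^t)`. -/
structure Reconstruction (W : Type*) [MeasurableSpace W] where
  est : ∀ k : ℕ, (Fin (k + 1) → W) × (Fin (k + 1) → ℝ) → ℝ
  measurable_est : ∀ k, Measurable (est k)

/-- The average-stage quadratic distortion `(1/T) ∑_t E[(x_t - x̂_t(w^t, y^t))²]`. -/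
def distortion {W : Type*} [MeasurableSpace W] {T : ℕ}
    (μ : Measure ((ℕ → ℝ × ℝ) × (Fin T → W))) (g : Reconstruction W) : ℝ≥0∞ :=
  (∑ t : Fin T, ∫⁻ ω, ENNReal.ofReal
    ((srcX ω.1 t - g.est t (histFin ω.2 (Nat.succ_le_of_lt t.isLt),
      hist (srcY ω.1) (t + 1))) ^ 2) ∂μ) / T

/-- The average-stage quadratic distortion `(1/T) ∑_t E[(x_t - w_t)²]` when `w` itself is the
reconstruction. -/
def distortionSelf {T : ℕ} (μ : Measure ((ℕ → ℝ × ℝ) × (Fin T → ℝ))) : ℝ≥0∞ :=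
  (∑ t : Fin T, ∫⁻ ω, ENNReal.ofReal ((srcX ω.1 t - ω.2 t) ^ 2) ∂μ) / T

/-! ### Information causal rate–distortion functions -/

/-- The information causal rate–distortion function with decoder side information.  (Auxiliary
samples are real; any standard Borel alphabet is isomorphic to a Borel subset of `ℝ`.) -/
def Rdec (lam : ℝ) (varV varN : ℝ≥0) (D : ℝ≥0∞) : ℝ≥0∞ :=
  limsup (fun T : ℕ => ⨅ (κ : CausalKernel ℝ ℝ) (g : Reconstruction ℝ)
    (_ : distortion (jointDec lam varV varN κ T) g ≤ D),
    directedInfo (jointDec lam varV varN κ T) / T) atTop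

/-- The Kostina–Hassibi information causal rate–distortion function with decoder side
information. -/
def RKH (lam : ℝ) (varV varN : ℝ≥0) (D : ℝ≥0∞) : ℝ≥0∞ :=
  limsup (fun T : ℕ => ⨅ (κ : CausalKernel ℝ ℝ) (g : Reconstruction ℝ)
    (_ : distortion (jointDec lam varV varN κ T) g ≤ D),
    condDirectedInfo (jointDec lam varV varN κ T) / T) atTop

/-- The information causal rate–distortion function with two-sided side information. -/
def Rboth (lam : ℝ) (varV varN : ℝ≥0) (D : ℝ≥0∞) : ℝ≥0∞ :=
  limsup (fun T : ℕ => ⨅ (κ : CausalKernel (ℝ × ℝ) ℝ)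
    (_ : distortionSelf (jointBoth lam varV varN κ T) ≤ D),
    condDirectedInfo (jointBoth lam varV varN κ T) / T) atTop

/-- The inverse of a nonincreasing rate–distortion function `R`: the least distortion at which the
rate does not exceed `C`. -/
def rateInv (R : ℝ≥0∞ → ℝ≥0∞) (C : ℝ≥0∞) : ℝ≥0∞ := sInf {D | R D ≤ C}

/-! ### Tracking over a memoryless channel -/

/-- The capacity of the memoryless channel `K` under the input constraint `E[cost(a)] ≤ Γ`: the
supremum of `I(a; b)` over admissible input laws (`cost = 0`: no constraint). -/
def capacity {A B : Type*} [MeasurableSpace A] [MeasurableSpace B] (K : Kernel A B)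
    (cost : A → ℝ≥0∞) (Γ : ℝ≥0∞) : ℝ≥0∞ :=
  ⨆ (P : Measure A) (_ : IsProbabilityMeasure P) (_ : ∫⁻ a, cost a ∂P ≤ Γ),
    InformationTheory.klDiv (P ⊗ₘ K) (P.prod (K ∘ₘ P))

/-- A causal encoder `a_t = F_t(x^t)`; it does not see the side information. -/
structure Encoder (A : Type*) [MeasurableSpace A] where
  enc : ∀ k : ℕ, (Fin (k + 1) → ℝ) → A
  measurable_enc : ∀ k, Measurable (enc k)

/-- The channel outputs when the encoder is used with the memoryless channel `K`:
`b_t` is drawn from `K(· | a_t)` with `a_t = F_t(x^t)`. -/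
def Encoder.output {A B : Type*} [MeasurableSpace A] [MeasurableSpace B] (F : Encoder A)
    (K : Kernel A B) [IsMarkovKernel K] : CausalKernel ℝ B where
  step k := K.comap (fun p => F.enc k p.1) ((F.measurable_enc k).comp measurable_fst)
  markov _ := inferInstance

/-- The average input cost `(1/T) ∑_t E[cost(a_t)]`. -/
def Encoder.avgCost {A : Type*} [MeasurableSpace A] (F : Encoder A) (cost : A → ℝ≥0∞)
    (lam : ℝ) (varV varN : ℝ≥0) (T : ℕ) : ℝ≥0∞ :=
  (∑ t : Fin T, ∫⁻ s, cost (F.enc t (hist (srcX s) (t + 1))) ∂(sourceLaw lam varV varN)) / T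

/-- The minimum (infimal) distortion of causal tracking over `K`, with one channel use per source
sample, a causal encoder that sees `x^t` and a causal decoder `x̂_t = G_t(b^t, y^t)`:
the limit superior, as the horizon `T` grows, of the optimal average distortion over horizon `T`. -/
def Dop {A B : Type*} [MeasurableSpace A] [MeasurableSpace B] (lam : ℝ) (varV varN : ℝ≥0)
    (K : Kernel A B) [IsMarkovKernel K] (cost : A → ℝ≥0∞) (Γ : ℝ≥0∞) : ℝ≥0∞ :=
  limsup (fun T : ℕ => ⨅ (F : Encoder A) (G : Reconstruction B)
    (_ : F.avgCost cost lam varV varN T ≤ Γ),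
    distortion (jointDec lam varV varN (F.output K) T) G) atTop

end

end CausalTracking

/-!
The proof reduces all rates to deterministic sequences of error variances. Let `filtVar d = p n /
(p + n)`, `p = lam ^ 2 d + v`, be the error variance of the Kalman filter after the next side
information, when the last source sample has error variance `d`. A sequence is feasible
(`IsFeasible`) if `d 0 = 0` and `0 < d (t + 1) ≤ filtVar (d t)`; its rate is `∑ 1/2 log (filtVar
(d t) / d (t + 1))`.

*Rates conditional on the side information.* Whether or not the encoder sees the side information,
a feasible sequence is achieved by Gaussian test channels (`exists_scheme_jointDec`,
`exists_scheme_jointBoth`). Conversely every scheme has a feasible sequence of almost its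
distortion whose rate is at most its conditional directed information
(`exists_variances_jointBoth`). No Gaussianity of the scheme is assumed: one follows the
divergence of the posterior law of the source from a Gaussian law with the same error variance.
The Kalman step does not increase this divergence (`klDiv_kalman_le`), and a transmission that
lowers the error variance increases it by at most the information conveyed minus the logarithmic
rate (`klDiv_update_le`). Hence the Kostina–Hassibi function and the two-sided one have the same
inverse.

*The strict gap.* Without conditioning, a transmitted sample also pays for the information that it
carries about the present side information. The balance of divergences therefore has a surplus `K
t`: the divergence of the side information, given the past and the transmitted sample, from its
Gaussian prediction made before the transmission. If `K t` is small, the side information is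
almost Gaussian around a prediction that ignores the transmission, and by a Donsker–Varadhan
argument no estimator then improves noticeably on `filtVar (d t)` (`exists_forall_filtVar_le`). So
either the total surplus is substantial, and the rate spent on it can be used to scale the
variances down, or the variances are hardly below the filtered ones, and the whole rate `C` is
available for reducing them (`exists_contraction`). In both cases the distortion shrinks by a
factor `θ < 1` that does not depend on the scheme; since the distortion at a finite rate is
bounded away from zero (`mul_exp_le_sum`), the inequality is strict.

*The operational converse.* The outputs of a memoryless channel, embedded in the reals, form a
scheme with decoder side information. Its directed information is at most the sum of the
divergences of the channel from any fixed output law, and for the output law of the time-averaged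
input law this sum is at most `T` times the capacity (`directedInfo_output_map_le`).
-/

namespace CausalTracking

/-! ### Divergences of composition-products -/

section Divergence

open InformationTheory

variable {α β γ : Type*} [MeasurableSpace α] [MeasurableSpace β] [MeasurableSpace γ]

theorem klDiv_map_of_leftInverse (μ ν : Measure α) [IsFiniteMeasure μ] [IsFiniteMeasure ν]
    {f : α → β} {g : β → α} (hf : Measurable f) (hg : Measurable g)
    (h : Function.LeftInverse g f) :
    klDiv (μ.map f) (ν.map f) = klDiv μ ν := by
  refine le_antisymm (klDiv_map_le μ ν hf) ?_
  have := klDiv_map_le (μ.map f) (ν.map f) hg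
  rwa [Measure.map_map hg hf, Measure.map_map hg hf, h.comp_eq_id, Measure.map_id,
    Measure.map_id] at this

theorem measurable_klDiv_kernel [MeasurableSpace.CountableOrCountablyGenerated α β]
    (κ η : Kernel α β) [IsFiniteKernel κ] [IsFiniteKernel η] :
    Measurable fun a => klDiv (κ a) (η a) := by
  classical
  have h : (fun a => klDiv (κ a) (η a)) = fun a => if κ a ≪ η a then
      ∫⁻ b, ENNReal.ofReal (klFun (κ.rnDeriv η a b).toReal) ∂η a else ∞ := by
    funext a
    rw [klDiv_eq_lintegral_klFun]
    refine ite_congr rfl (fun _ => lintegral_congr_ae ?_) fun _ => rfl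
    filter_upwards [Kernel.rnDeriv_eq_rnDeriv_measure (κ := κ) (η := η) (a := a)] with b hb
    rw [hb]
  rw [h]
  refine Measurable.ite (Kernel.measurableSet_absolutelyContinuous κ η) ?_ measurable_const
  have hm : Measurable fun p : α × β => ENNReal.ofReal (klFun (κ.rnDeriv η p.1 p.2).toReal) :=
    (measurable_klFun.comp (Kernel.measurable_rnDeriv κ η).ennreal_toReal).ennreal_ofReal
  exact hm.lintegral_kernel_prod_right'

/-- The divergence of two composition-products over the same base is the mean of the divergences
of the kernels. -/
theorem klDiv_compProd_right_eq_lintegral [MeasurableSpace.CountableOrCountablyGenerated α β]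
    (μ : Measure α) [IsFiniteMeasure μ] (κ η : Kernel α β) [IsFiniteKernel κ] [IsFiniteKernel η] :
    klDiv (μ ⊗ₘ κ) (μ ⊗ₘ η) = ∫⁻ a, klDiv (κ a) (η a) ∂μ := by
  by_cases h : ∀ᵐ a ∂μ, κ a ≪ η a
  · have hac : μ ⊗ₘ κ ≪ μ ⊗ₘ η := Measure.absolutelyContinuous_compProd_right_iff.2 h
    have hκ : κ =ᵐ[μ] η.withDensity (κ.rnDeriv η) := by
      filter_upwards [h] with a ha using (Kernel.withDensity_rnDeriv_eq ha).symm
    have hd : μ ⊗ₘ κ = (μ ⊗ₘ η).withDensity fun p => κ.rnDeriv η p.1 p.2 := by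
      rw [Measure.compProd_congr hκ, Measure.compProd_withDensity (Kernel.measurable_rnDeriv κ η)]
    have hr : (μ ⊗ₘ κ).rnDeriv (μ ⊗ₘ η) =ᵐ[μ ⊗ₘ η] fun p => κ.rnDeriv η p.1 p.2 := by
      rw [hd]; exact Measure.rnDeriv_withDensity _ (Kernel.measurable_rnDeriv κ η)
    rw [klDiv_eq_lintegral_klFun_of_ac hac]
    have : ∫⁻ p, ENNReal.ofReal (klFun ((μ ⊗ₘ κ).rnDeriv (μ ⊗ₘ η) p).toReal) ∂(μ ⊗ₘ η)
        = ∫⁻ p, ENNReal.ofReal (klFun (κ.rnDeriv η p.1 p.2).toReal) ∂(μ ⊗ₘ η) := by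
      refine lintegral_congr_ae ?_
      filter_upwards [hr] with p hp
      rw [hp]
    have hm : Measurable fun p : α × β => ENNReal.ofReal (klFun (κ.rnDeriv η p.1 p.2).toReal) :=
      (measurable_klFun.comp (Kernel.measurable_rnDeriv κ η).ennreal_toReal).ennreal_ofReal
    rw [this, Measure.lintegral_compProd hm]
    refine lintegral_congr_ae ?_
    filter_upwards [h] with a ha
    rw [klDiv_eq_lintegral_klFun_of_ac ha]
    refine lintegral_congr_ae ?_
    filter_upwards [Kernel.rnDeriv_eq_rnDeriv_measure (κ := κ) (η := η) (a := a)] with b hb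
    rw [hb]
  -- without absolute continuity both sides are infinite
  · rw [klDiv_of_not_ac fun hac => h (Measure.absolutelyContinuous_compProd_right_iff.1 hac)]
    by_contra hne
    refine h ?_
    filter_upwards [ae_lt_top (measurable_klDiv_kernel κ η) (Ne.symm hne)] with a ha
    exact (klDiv_ne_top_iff.1 ha.ne).1

/-- If `b` is drawn from `f a`, the law of `(f a, b)` depends on `a` only through the law of
`f a`. -/
theorem compProd_comap_map (μ : Measure α) [IsFiniteMeasure μ] {f : α → γ} (hf : Measurable f)
    (κ : Kernel γ β) [IsSFiniteKernel κ] :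
    (μ ⊗ₘ κ.comap f hf).map (Prod.map f id) = μ.map f ⊗ₘ κ := by
  refine Measure.ext_of_lintegral _ fun g hg => ?_
  have hm : Measurable fun p : α × β => g (Prod.map f id p) := hg.comp (hf.prodMap measurable_id)
  rw [lintegral_map hg (hf.prodMap measurable_id), Measure.lintegral_compProd hm,
    Measure.lintegral_compProd hg, lintegral_map _ hf]
  · rfl
  · exact hg.lintegral_kernel_prod_right'

/-- Two conditionally independent samples may be drawn in either order. -/
theorem compProd_prodMkRight_swap (μ : Measure α) [IsFiniteMeasure μ] (κ : Kernel α β)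
    (η : Kernel α γ) [IsFiniteKernel κ] [IsFiniteKernel η] :
    ((μ ⊗ₘ κ) ⊗ₘ η.prodMkRight β).map (fun p => ((p.1.1, p.2), p.1.2))
      = (μ ⊗ₘ η) ⊗ₘ κ.prodMkRight γ := by
  have hm : Measurable fun p : (α × β) × γ => ((p.1.1, p.2), p.1.2) := by fun_prop
  refine Measure.ext_of_lintegral _ fun g hg => ?_
  rw [lintegral_map hg hm, Measure.lintegral_compProd (by fun_prop), Measure.lintegral_compProd,
    Measure.lintegral_compProd hg, Measure.lintegral_compProd]
  · refine lintegral_congr fun a => ?_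
    simp only [Kernel.prodMkRight_apply]
    rw [lintegral_lintegral_swap]
    exact (hg.comp (by fun_prop : Measurable fun q : β × γ => ((a, q.2), q.1))).aemeasurable
  · exact hg.lintegral_kernel_prod_right'
  · exact (hg.comp hm).lintegral_kernel_prod_right'

theorem compProd_prod_eq (μ : Measure α) [IsFiniteMeasure μ] (κ : Kernel α β)
    (η : Kernel α γ) [IsFiniteKernel κ] [IsFiniteKernel η] :
    ((μ ⊗ₘ κ) ⊗ₘ η.prodMkRight β).map (fun p => (p.1.1, p.1.2, p.2)) = μ ⊗ₘ (κ ×ₖ η) := by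
  have hm : Measurable fun p : (α × β) × γ => (p.1.1, p.1.2, p.2) := by fun_prop
  refine Measure.ext_of_lintegral _ fun g hg => ?_
  rw [lintegral_map hg hm, Measure.lintegral_compProd (by fun_prop), Measure.lintegral_compProd,
    Measure.lintegral_compProd hg]
  · refine lintegral_congr fun a => ?_
    simp only [Kernel.prodMkRight_apply, Kernel.prod_apply]
    rw [lintegral_prod]
    exact (hg.comp (by fun_prop : Measurable fun q : β × γ => (a, q.1, q.2))).aemeasurable
  · exact (hg.comp hm).lintegral_kernel_prod_right'

/-- The Donsker–Varadhan lower bound on the divergence. -/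
theorem ofReal_integral_le_klDiv (P Q : Measure α) [IsProbabilityMeasure P]
    [IsProbabilityMeasure Q] {f : α → ℝ} (hfP : Integrable f P) (hf : Measurable f)
    (hQ : ∫⁻ x, ENNReal.ofReal (Real.exp (f x)) ∂Q ≤ 1) :
    ENNReal.ofReal (∫ x, f x ∂P) ≤ klDiv P Q := by
  by_cases htop : klDiv P Q = ∞
  · simp [htop]
  obtain ⟨hac, hint⟩ := klDiv_ne_top_iff.1 htop
  have hexp : Integrable (fun x => Real.exp (f x)) Q := by
    refine ⟨hf.exp.aestronglyMeasurable, ?_⟩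
    rw [hasFiniteIntegral_iff_ofReal (ae_of_all _ fun x => (Real.exp_pos _).le)]
    exact hQ.trans_lt ENNReal.one_lt_top
  have hle : ∫ x, Real.exp (f x) ∂Q ≤ 1 := by
    rw [integral_eq_lintegral_of_nonneg_ae (ae_of_all _ fun x => (Real.exp_pos _).le)
      hf.exp.aestronglyMeasurable]
    simpa using ENNReal.toReal_mono ENNReal.one_ne_top hQ
  have hpos : 0 < ∫ x, Real.exp (f x) ∂Q := integral_exp_pos hexp
  have := isProbabilityMeasure_tilted hexp
  have hac' : P ≪ Q.tilted f := hac.trans (absolutelyContinuous_tilted hexp)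
  have hint' := integrable_llr_tilted_right hac hfP hint hexp
  have h0 := integral_llr_add_sub_measure_univ_nonneg hac' hint'
  rw [integral_llr_tilted_right hac hfP hexp hint] at h0
  have hlog := Real.log_nonpos hpos.le hle
  rw [klDiv_of_ac_of_integrable hac hint]
  refine ENNReal.ofReal_le_ofReal ?_
  simp only [probReal_univ] at h0 ⊢
  linarith

/-- Change of reference measure: if `R` has density `exp f` with respect to `Q`, the divergences
from `Q` and from `R` differ by the mean of `f`. -/
theorem klDiv_withDensity_exp (P Q R : Measure α) [IsProbabilityMeasure P]
    [IsProbabilityMeasure Q] [IsProbabilityMeasure R] {f : α → ℝ} (hfP : Integrable f P)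
    (hf : Measurable f) (hR : R = Q.withDensity fun x => ENNReal.ofReal (Real.exp (f x)))
    (htop : klDiv P Q ≠ ∞) :
    klDiv P R ≠ ∞ ∧ (klDiv P R).toReal = (klDiv P Q).toReal - ∫ x, f x ∂P := by
  obtain ⟨hac, hint⟩ := klDiv_ne_top_iff.1 htop
  have h1 : ∫⁻ x, ENNReal.ofReal (Real.exp (f x)) ∂Q = 1 := by
    have := measure_univ (μ := R)
    rwa [hR, withDensity_apply _ MeasurableSet.univ, setLIntegral_univ] at this
  have hexp : Integrable (fun x => Real.exp (f x)) Q := by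
    refine ⟨hf.exp.aestronglyMeasurable, ?_⟩
    rw [hasFiniteIntegral_iff_ofReal (ae_of_all _ fun x => (Real.exp_pos _).le), h1]
    exact ENNReal.one_lt_top
  have hone : ∫ x, Real.exp (f x) ∂Q = 1 := by
    rw [integral_eq_lintegral_of_nonneg_ae (ae_of_all _ fun x => (Real.exp_pos _).le)
      hf.exp.aestronglyMeasurable, h1, ENNReal.toReal_one]
  have hRt : R = Q.tilted f := by
    rw [hR, Measure.tilted]; simp [hone]
  have hac' : P ≪ R := by rw [hRt]; exact hac.trans (absolutelyContinuous_tilted hexp)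
  have hint' : Integrable (llr P R) P := by
    rw [hRt]; exact integrable_llr_tilted_right hac hfP hint hexp
  refine ⟨klDiv_ne_top hac' hint', ?_⟩
  rw [toReal_klDiv_of_measure_eq hac' (by simp), toReal_klDiv_of_measure_eq hac (by simp), hRt,
    integral_llr_tilted_right hac hfP hexp hint, hone]
  simp

end Divergence

/-! ### Conditional mutual information -/

section CondMutualInfo

open InformationTheory

variable {Ω A A' B E : Type*} [MeasurableSpace Ω]
  [MeasurableSpace A] [StandardBorelSpace A] [Nonempty A]
  [MeasurableSpace A'] [StandardBorelSpace A'] [Nonempty A']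
  [MeasurableSpace B] [StandardBorelSpace B] [Nonempty B] [MeasurableSpace E]
  {μ : Measure Ω} [IsFiniteMeasure μ] {X : Ω → A} {Y : Ω → B} {Z : Ω → E}

/-- The conditional mutual information as the divergence from the reference in which `Y` is drawn
from `Z` alone. -/
theorem condMutualInfo_eq_klDiv_compProd (hX : Measurable X) (hY : Measurable Y)
    (hZ : Measurable Z) :
    condMutualInfo μ X Y Z = klDiv (μ.map fun ω => ((Z ω, X ω), Y ω))
      (μ.map (fun ω => (Z ω, X ω)) ⊗ₘ (condDistrib Y Z μ).prodMkRight A) := by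
  rw [← compProd_map_condDistrib hX.aemeasurable,
    ← klDiv_map_of_leftInverse _ _
      (f := fun p : (E × A) × B => (p.1.1, p.1.2, p.2)) (g := fun p => ((p.1, p.2.1), p.2.2))
      (by fun_prop) (by fun_prop) (fun _ => rfl),
    compProd_prod_eq, Measure.map_map (by fun_prop) (by fun_prop)]
  rfl

theorem condMutualInfo_comm (hX : Measurable X) (hY : Measurable Y) (hZ : Measurable Z) :
    condMutualInfo μ X Y Z = condMutualInfo μ Y X Z := by
  rw [condMutualInfo_eq_klDiv_compProd hX hY hZ, condMutualInfo_eq_klDiv_compProd hY hX hZ,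
    ← klDiv_map_of_leftInverse _ _
      (f := fun p : (E × A) × B => ((p.1.1, p.2), p.1.2))
      (g := fun p => ((p.1.1, p.2), p.1.2)) (by fun_prop) (by fun_prop) (fun _ => rfl),
    ← compProd_map_condDistrib hX.aemeasurable, compProd_prodMkRight_swap,
    compProd_map_condDistrib hY.aemeasurable, Measure.map_map (by fun_prop) (by fun_prop)]
  rfl

/-- The divergence from a reference that predicts `Y` from `Z` alone, through an arbitrary kernel,
splits into the conditional mutual information and the divergence of the prediction. -/
theorem klDiv_compProd_prodMkRight_eq_add (hX : Measurable X) (hY : Measurable Y)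
    (hZ : Measurable Z) (η : Kernel E B) [IsMarkovKernel η] :
    klDiv (μ.map fun ω => ((Z ω, X ω), Y ω)) (μ.map (fun ω => (Z ω, X ω)) ⊗ₘ η.prodMkRight A)
      = condMutualInfo μ X Y Z + klDiv (μ.map fun ω => (Z ω, Y ω)) (μ.map Z ⊗ₘ η) := by
  rw [condMutualInfo_comm hX hY hZ, condMutualInfo_eq_klDiv_compProd hY hX hZ,
    ← klDiv_map_of_leftInverse _ _
      (f := fun p : (E × A) × B => ((p.1.1, p.2), p.1.2))
      (g := fun p => ((p.1.1, p.2), p.1.2)) (by fun_prop) (by fun_prop) (fun _ => rfl),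
    ← compProd_map_condDistrib hX.aemeasurable, compProd_prodMkRight_swap,
    Measure.map_map (by fun_prop) (by fun_prop)]
  have h : (μ.map ((fun p : (E × A) × B => ((p.1.1, p.2), p.1.2)) ∘ fun ω => ((Z ω, X ω), Y ω)))
      = μ.map (fun ω => (Z ω, Y ω)) ⊗ₘ condDistrib X (fun ω => (Z ω, Y ω)) μ := by
    rw [compProd_map_condDistrib hX.aemeasurable]; rfl
  have h' : μ.map (fun ω => ((Z ω, Y ω), X ω))
      = μ.map (fun ω => (Z ω, Y ω)) ⊗ₘ condDistrib X (fun ω => (Z ω, Y ω)) μ :=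
    (compProd_map_condDistrib hX.aemeasurable).symm
  rw [h, klDiv_compProd_eq_add, h', add_comm]

/-- The conditional mutual information is a lower bound on the divergence from any reference that
predicts `Y` from `Z` alone. -/
theorem condMutualInfo_le_klDiv (hX : Measurable X) (hY : Measurable Y)
    (hZ : Measurable Z) (η : Kernel E B) [IsMarkovKernel η] :
    condMutualInfo μ X Y Z ≤ klDiv (μ.map fun ω => ((Z ω, X ω), Y ω))
      (μ.map (fun ω => (Z ω, X ω)) ⊗ₘ η.prodMkRight A) := by
  rw [klDiv_compProd_prodMkRight_eq_add hX hY hZ]; exact le_self_add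

theorem condMutualInfo_comp_left_le {f : A → A'} (hf : Measurable f) (hX : Measurable X)
    (hY : Measurable Y) (hZ : Measurable Z) :
    condMutualInfo μ (fun ω => f (X ω)) Y Z ≤ condMutualInfo μ X Y Z := by
  rw [condMutualInfo_eq_klDiv_compProd hX hY hZ,
    condMutualInfo_eq_klDiv_compProd (X := fun ω => f (X ω)) (hf.comp hX) hY hZ]
  have hg : Measurable (Prod.map id f : E × A → E × A') := measurable_id.prodMap hf
  have hk : (condDistrib Y Z μ).prodMkRight A
      = ((condDistrib Y Z μ).prodMkRight A').comap _ hg := by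
    ext p; rfl
  refine le_of_eq_of_le ?_ (klDiv_map_le _ _ (hg.prodMap measurable_id))
  rw [hk, compProd_comap_map, Measure.map_map (hg.prodMap measurable_id) (by fun_prop),
    Measure.map_map hg (by fun_prop)]
  rfl

end CondMutualInfo

/-- Coarsening the conditioning variable of a prediction kernel lowers the divergence. -/
theorem klDiv_comp_compProd_le {Ω E E' B : Type*} [MeasurableSpace Ω] [MeasurableSpace E]
    [MeasurableSpace E'] [MeasurableSpace B] (μ : Measure Ω) [IsFiniteMeasure μ] {Y : Ω → B}
    {Z : Ω → E} (hY : Measurable Y) (hZ : Measurable Z) {f : E → E'} (hf : Measurable f)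
    (κ : Kernel E' B) [IsMarkovKernel κ] :
    InformationTheory.klDiv (μ.map fun ω => (f (Z ω), Y ω)) (μ.map (fun ω => f (Z ω)) ⊗ₘ κ)
      ≤ InformationTheory.klDiv (μ.map fun ω => (Z ω, Y ω)) (μ.map Z ⊗ₘ κ.comap f hf) := by
  refine le_of_eq_of_le ?_ (InformationTheory.klDiv_map_le _ _ (hf.prodMap measurable_id))
  rw [compProd_comap_map, Measure.map_map (hf.prodMap measurable_id) (by fun_prop),
    Measure.map_map hf hZ]
  rfl

/-! ### Gaussian kernels -/

section Gaussian

variable {E : Type*} [MeasurableSpace E]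

/-- The Gaussian kernel with mean `m` depending measurably on the conditioning variable and with
constant variance `v`. -/
noncomputable def gaussKernel (m : E → ℝ) (hm : Measurable m) (v : ℝ≥0) : Kernel E ℝ :=
  ⟨fun h => gaussianReal (m h) v, measurable_gaussianReal.comp (hm.prodMk measurable_const)⟩

theorem gaussKernel_apply (m : E → ℝ) (hm : Measurable m) (v : ℝ≥0) (h : E) :
    gaussKernel m hm v h = gaussianReal (m h) v := rfl

instance (m : E → ℝ) (hm : Measurable m) (v : ℝ≥0) : IsMarkovKernel (gaussKernel m hm v) :=
  ⟨fun h => by rw [gaussKernel_apply]; infer_instance⟩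

/-- The logarithm of the density of `N(m₂, v₂)` with respect to `N(m₁, v₁)`. -/
noncomputable def gaussLogRatio (m₁ : ℝ) (v₁ : ℝ≥0) (m₂ : ℝ) (v₂ : ℝ≥0) (x : ℝ) : ℝ :=
  1 / 2 * Real.log (v₁ / v₂) + (x - m₁) ^ 2 / (2 * v₁) - (x - m₂) ^ 2 / (2 * v₂)

theorem gaussianPDFReal_mul_exp_gaussLogRatio {v₁ v₂ : ℝ≥0} (h₁ : v₁ ≠ 0) (h₂ : v₂ ≠ 0)
    (m₁ m₂ x : ℝ) :
    gaussianPDFReal m₁ v₁ x * Real.exp (gaussLogRatio m₁ v₁ m₂ v₂ x)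
      = gaussianPDFReal m₂ v₂ x := by
  have p₁ : (0 : ℝ) < v₁ := by positivity
  have p₂ : (0 : ℝ) < v₂ := by positivity
  have hl : Real.exp (1 / 2 * Real.log (v₁ / v₂)) = √(v₁ / v₂ : ℝ) := by
    rw [Real.sqrt_eq_rpow, Real.rpow_def_of_pos (by positivity), mul_comm]
  have he : Real.exp (-(x - m₁) ^ 2 / (2 * v₁)) * Real.exp (gaussLogRatio m₁ v₁ m₂ v₂ x)
      = √(v₁ / v₂ : ℝ) * Real.exp (-(x - m₂) ^ 2 / (2 * v₂)) := by
    rw [← Real.exp_add, ← hl, ← Real.exp_add, gaussLogRatio]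
    congr 1
    ring
  have hc : (√(2 * Real.pi * v₁))⁻¹ * √(v₁ / v₂ : ℝ) = (√(2 * Real.pi * v₂))⁻¹ := by
    have q₁ : √(v₁ : ℝ) ≠ 0 := by positivity
    rw [Real.sqrt_div p₁.le, Real.sqrt_mul (by positivity) (v₁ : ℝ),
      Real.sqrt_mul (by positivity) (v₂ : ℝ), mul_inv, mul_inv]
    field_simp
  unfold gaussianPDFReal
  rw [mul_assoc, he, ← mul_assoc, hc]

theorem gaussianReal_eq_withDensity {v₁ v₂ : ℝ≥0} (h₁ : v₁ ≠ 0) (h₂ : v₂ ≠ 0) (m₁ m₂ : ℝ) :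
    gaussianReal m₂ v₂ = (gaussianReal m₁ v₁).withDensity
      fun x => ENNReal.ofReal (Real.exp (gaussLogRatio m₁ v₁ m₂ v₂ x)) := by
  have hm : Measurable fun x => ENNReal.ofReal (Real.exp (gaussLogRatio m₁ v₁ m₂ v₂ x)) := by
    unfold gaussLogRatio; fun_prop
  rw [gaussianReal_of_var_ne_zero _ h₁, gaussianReal_of_var_ne_zero _ h₂,
    ← withDensity_mul _ (measurable_gaussianPDF _ _) hm]
  congr 1
  funext x
  rw [Pi.mul_apply, gaussianPDF, gaussianPDF, ← ENNReal.ofReal_mul (gaussianPDFReal_nonneg _ _ _),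
    gaussianPDFReal_mul_exp_gaussLogRatio h₁ h₂]

theorem compProd_gaussKernel_eq_withDensity (μ : Measure E) [IsFiniteMeasure μ]
    {m₁ m₂ : E → ℝ} (hm₁ : Measurable m₁) (hm₂ : Measurable m₂) {v₁ v₂ : ℝ≥0} (h₁ : v₁ ≠ 0)
    (h₂ : v₂ ≠ 0) :
    μ ⊗ₘ gaussKernel m₂ hm₂ v₂ = (μ ⊗ₘ gaussKernel m₁ hm₁ v₁).withDensity fun p =>
      ENNReal.ofReal (Real.exp (gaussLogRatio (m₁ p.1) v₁ (m₂ p.1) v₂ p.2)) := by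
  have hf : Measurable (Function.uncurry fun (h : E) (x : ℝ) =>
      ENNReal.ofReal (Real.exp (gaussLogRatio (m₁ h) v₁ (m₂ h) v₂ x))) := by
    unfold gaussLogRatio Function.uncurry; fun_prop
  have hk : gaussKernel m₂ hm₂ v₂ = (gaussKernel m₁ hm₁ v₁).withDensity fun h x =>
      ENNReal.ofReal (Real.exp (gaussLogRatio (m₁ h) v₁ (m₂ h) v₂ x)) := by
    ext1 h
    rw [Kernel.withDensity_apply _ hf, gaussKernel_apply, gaussKernel_apply,
      gaussianReal_eq_withDensity h₁ h₂]
  have : IsMarkovKernel ((gaussKernel m₁ hm₁ v₁).withDensity fun h x =>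
      ENNReal.ofReal (Real.exp (gaussLogRatio (m₁ h) v₁ (m₂ h) v₂ x))) := by
    rw [← hk]; infer_instance
  rw [hk, Measure.compProd_withDensity hf]

theorem integrable_sq_gaussianReal (m : ℝ) (v : ℝ≥0) :
    Integrable (fun x : ℝ => x ^ 2) (gaussianReal m v) :=
  (memLp_id_gaussianReal (μ := m) (v := v) 2).integrable_sq

theorem lintegral_sq_gaussianReal (m : ℝ) (v : ℝ≥0) (c b : ℝ) :
    ∫⁻ x, ENNReal.ofReal ((c - b * x) ^ 2) ∂(gaussianReal m v)
      = ENNReal.ofReal ((c - b * m) ^ 2 + b ^ 2 * v) := by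
  have h1 : Integrable (fun x : ℝ => x) (gaussianReal m v) :=
    (memLp_id_gaussianReal (μ := m) (v := v) 1).integrable le_rfl
  have h2 := integrable_sq_gaussianReal m v
  have hv : ∫ x, x ^ 2 ∂(gaussianReal m v) = v + m ^ 2 := by
    have := variance_eq_sub (memLp_id_gaussianReal (μ := m) (v := v) 2)
    rw [variance_id_gaussianReal] at this
    simp only [Pi.pow_apply, id_eq, integral_id_gaussianReal] at this
    linarith
  have h3 : (fun x : ℝ => (c - b * x) ^ 2) = fun x => c ^ 2 - 2 * c * b * x + b ^ 2 * x ^ 2 := by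
    funext x; ring
  have hi : Integrable (fun x : ℝ => (c - b * x) ^ 2) (gaussianReal m v) := by
    rw [h3]; exact ((integrable_const _).sub (h1.const_mul _)).add (h2.const_mul _)
  rw [← ofReal_integral_eq_lintegral_ofReal hi (ae_of_all _ fun x => sq_nonneg _), h3,
    integral_add (f := fun x => c ^ 2 - 2 * c * b * x)
      ((integrable_const _).sub (h1.const_mul _)) (h2.const_mul _),
    integral_sub (integrable_const _) (h1.const_mul _), integral_const_mul, integral_const_mul, hv,
    integral_id_gaussianReal]
  congr 1
  simp only [integral_const, probReal_univ, smul_eq_mul]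
  ring

/-- Completion of the square: the joint density of a Gaussian variable and of its noisy observation,
factored in the two orders. -/
theorem gaussianPDFReal_mul_gaussianPDFReal {p n : ℝ≥0} (hp : p ≠ 0) (hn : n ≠ 0) (m x y : ℝ) :
    gaussianPDFReal m p x * gaussianPDFReal 0 n (y - x)
      = gaussianPDFReal m (p + n) y
        * gaussianPDFReal (m + p / (p + n) * (y - m)) (p * n / (p + n)) x := by
  have hp' : (0 : ℝ) < p := by positivity
  have hn' : (0 : ℝ) < n := by positivity
  have hc : (√(2 * Real.pi * p))⁻¹ * (√(2 * Real.pi * n))⁻¹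
      = (√(2 * Real.pi * (p + n)))⁻¹ * (√(2 * Real.pi * (p * n / (p + n))))⁻¹ := by
    rw [← mul_inv, ← mul_inv, ← Real.sqrt_mul (by positivity), ← Real.sqrt_mul (by positivity)]
    congr 2
    field_simp
  have he : -(x - m) ^ 2 / (2 * p) + -(y - x - 0) ^ 2 / (2 * n) = -(y - m) ^ 2 / (2 * (p + n))
      + -(x - (m + p / (p + n) * (y - m))) ^ 2 / (2 * (p * n / (p + n))) := by
    field_simp
    ring
  unfold gaussianPDFReal
  push_cast
  rw [mul_mul_mul_comm, hc, ← Real.exp_add, he, Real.exp_add]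
  ring

/-- Bayes' rule for a Gaussian variable observed in independent Gaussian noise. -/
theorem map_add_gaussianReal_prod {p n : ℝ≥0} (hp : p ≠ 0) (hn : n ≠ 0) (m : ℝ) :
    ((gaussianReal m p).prod (gaussianReal 0 n)).map (fun q => (q.1 + q.2, q.1))
      = gaussianReal m (p + n) ⊗ₘ gaussKernel (fun y => m + p / (p + n) * (y - m))
          (by fun_prop) (p * n / (p + n)) := by
  have hpn : p + n ≠ 0 := by positivity
  have hs : p * n / (p + n) ≠ 0 := by positivity
  have hm : Measurable fun q : ℝ × ℝ => (q.1 + q.2, q.1) := by fun_prop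
  refine Measure.ext_of_lintegral _ fun f hf => ?_
  have hfm : Measurable fun q : ℝ × ℝ => f (q.1 + q.2, q.1) := hf.comp hm
  rw [lintegral_map hf hm, lintegral_prod _ hfm.aemeasurable, Measure.lintegral_compProd hf]
  simp only [gaussKernel_apply]
  rw [gaussianReal_of_var_ne_zero _ hp, gaussianReal_of_var_ne_zero _ hn,
    gaussianReal_of_var_ne_zero _ hpn,
    lintegral_withDensity_eq_lintegral_mul _ (measurable_gaussianPDF _ _)
      hfm.lintegral_prod_right',
    lintegral_withDensity_eq_lintegral_mul _ (measurable_gaussianPDF _ _)]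
  swap
  · have := hf.lintegral_kernel_prod_right' (κ := gaussKernel (fun y => m + p / (p + n) * (y - m))
      (by fun_prop) (p * n / (p + n)))
    simpa only [gaussKernel_apply] using this
  simp only [Pi.mul_apply]
  calc ∫⁻ x, gaussianPDF m p x
        * ∫⁻ z, f (x + z, x) ∂(volume.withDensity (gaussianPDF 0 n))
      = ∫⁻ x, ∫⁻ y, gaussianPDF m p x * (gaussianPDF 0 n (y - x) * f (y, x)) := by
        refine lintegral_congr fun x => ?_
        have hfx : Measurable fun z => f (x + z, x) := hf.comp (by fun_prop)
        rw [lintegral_withDensity_eq_lintegral_mul _ (measurable_gaussianPDF _ _) hfx,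
          ← lintegral_const_mul _ ((measurable_gaussianPDF _ _).mul hfx),
          ← lintegral_sub_right_eq_self _ x]
        refine lintegral_congr fun y => ?_
        simp
    _ = ∫⁻ y, ∫⁻ x, gaussianPDF m p x * (gaussianPDF 0 n (y - x) * f (y, x)) := by
        refine lintegral_lintegral_swap ?_
        have h1 : Measurable fun q : ℝ × ℝ => f (q.2, q.1) := hf.comp measurable_swap
        refine Measurable.aemeasurable ?_
        exact ((measurable_gaussianPDF _ _).comp measurable_fst).mul
          (((measurable_gaussianPDF _ _).comp (measurable_snd.sub measurable_fst)).mul h1)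
    _ = _ := by
        refine lintegral_congr fun y => ?_
        have hfy : Measurable fun x => f (y, x) := hf.comp (by fun_prop)
        rw [gaussianReal_of_var_ne_zero _ hs,
          lintegral_withDensity_eq_lintegral_mul _ (measurable_gaussianPDF _ _) hfy,
          ← lintegral_const_mul _ ((measurable_gaussianPDF _ _).mul hfy)]
        refine lintegral_congr fun x => ?_
        rw [Pi.mul_apply, ← mul_assoc, ← mul_assoc]
        congr 1
        simp only [gaussianPDF]
        rw [← ENNReal.ofReal_mul (gaussianPDFReal_nonneg _ _ _),
          ← ENNReal.ofReal_mul (gaussianPDFReal_nonneg _ _ _),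
          gaussianPDFReal_mul_gaussianPDFReal hp hn]

end Gaussian

theorem integrable_and_integral_sq {Ω : Type*} [MeasurableSpace Ω] {μ : Measure Ω} {f : Ω → ℝ}
    (hf : Measurable f) {d : ℝ≥0} (h : ∫⁻ ω, ENNReal.ofReal (f ω ^ 2) ∂μ = d) :
    Integrable (fun ω => f ω ^ 2) μ ∧ ∫ ω, f ω ^ 2 ∂μ = d := by
  constructor
  · refine ⟨(hf.pow_const 2).aestronglyMeasurable, ?_⟩
    rw [hasFiniteIntegral_iff_ofReal (ae_of_all _ fun x => sq_nonneg _), h]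
    exact ENNReal.coe_lt_top
  · rw [integral_eq_lintegral_of_nonneg_ae (ae_of_all _ fun x => sq_nonneg _)
      (hf.pow_const 2).aestronglyMeasurable, h, ENNReal.coe_toReal]

/-- The mean square of a sum with an independent centred Gaussian term. -/
theorem lintegral_lintegral_sq_gaussianReal {Ω : Type*} [MeasurableSpace Ω] (μ : Measure Ω)
    [IsProbabilityMeasure μ] {e : Ω → ℝ} (he : Measurable e) {d : ℝ≥0}
    (hd : ∫⁻ ω, ENNReal.ofReal (e ω ^ 2) ∂μ = d) (a b : ℝ) (v : ℝ≥0) :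
    ∫⁻ ω, ∫⁻ z, ENNReal.ofReal ((a * e ω - b * z) ^ 2) ∂(gaussianReal 0 v) ∂μ
      = (‖a‖₊ ^ 2 * d + ‖b‖₊ ^ 2 * v : ℝ≥0) := by
  have h (ω : Ω) : ∫⁻ z, ENNReal.ofReal ((a * e ω - b * z) ^ 2) ∂(gaussianReal 0 v)
      = ENNReal.ofReal (a ^ 2) * ENNReal.ofReal (e ω ^ 2) + ENNReal.ofReal (b ^ 2 * v) := by
    rw [lintegral_sq_gaussianReal, ENNReal.ofReal_add (by positivity) (by positivity),
      mul_zero, sub_zero, mul_pow, ENNReal.ofReal_mul (by positivity)]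
  simp_rw [h]
  rw [lintegral_add_right _ measurable_const, lintegral_const_mul _ (by fun_prop), hd]
  simp only [lintegral_const, measure_univ, mul_one]
  rw [← ENNReal.ofReal_coe_nnreal, ← ENNReal.ofReal_mul (by positivity),
    ← ENNReal.ofReal_add (by positivity) (by positivity), ← ENNReal.ofReal_coe_nnreal]
  congr 1
  push_cast
  simp

/-! ### One step of the Kalman filter -/

/-- The variance of the next source sample when the present one has error variance `d`. -/
noncomputable def predVar (lam : ℝ) (v d : ℝ≥0) : ℝ≥0 := ‖lam‖₊ ^ 2 * d + v

/-- The error variance of the next source sample after its side information, of noise variance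
`n`, has been observed. -/
noncomputable def filtVar (lam : ℝ) (v n d : ℝ≥0) : ℝ≥0 :=
  predVar lam v d * n / (predVar lam v d + n)

/-- The Kalman estimate of the next source sample from the estimate `xh` of the present one and
the side information `y`, when `p` is the predicted variance. -/
noncomputable def filtMean (lam : ℝ) (p n : ℝ≥0) (xh y : ℝ) : ℝ :=
  lam * xh + p / (p + n) * (y - lam * xh)

theorem measurable_filtMean {E : Type*} [MeasurableSpace E] (lam : ℝ) (p n : ℝ≥0) {xh y : E → ℝ}
    (hx : Measurable xh) (hy : Measurable y) :
    Measurable fun h => filtMean lam p n (xh h) (y h) := by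
  unfold filtMean; fun_prop

theorem coe_predVar (lam : ℝ) (v d : ℝ≥0) : (predVar lam v d : ℝ) = lam ^ 2 * d + v := by
  simp [predVar]

theorem predVar_pos {lam : ℝ} {v d : ℝ≥0} (hv : 0 < v) : 0 < predVar lam v d :=
  add_pos_of_nonneg_of_pos (by positivity) hv

theorem filtVar_pos {lam : ℝ} {v n d : ℝ≥0} (hv : 0 < v) (hn : 0 < n) :
    0 < filtVar lam v n d := by
  have := predVar_pos (lam := lam) (d := d) hv
  unfold filtVar; positivity

section KalmanStep

variable (lam : ℝ) {v n d : ℝ≥0}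

theorem map_gaussianReal_prod_mul_add (m : ℝ) (d v : ℝ≥0) :
    ((gaussianReal m d).prod (gaussianReal 0 v)).map (fun q => lam * q.1 + q.2)
      = gaussianReal (lam * m) (predVar lam v d) := by
  have h : (fun q : ℝ × ℝ => lam * q.1 + q.2)
      = (fun q : ℝ × ℝ => q.1 + q.2) ∘ Prod.map (lam * ·) id := rfl
  rw [h, ← Measure.map_map (by fun_prop) (by fun_prop),
    ← Measure.map_prod_map _ _ (by fun_prop) measurable_id, gaussianReal_map_const_mul,
    Measure.map_id, ← Measure.conv, gaussianReal_conv_gaussianReal, add_zero]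
  congr 1
  ext
  simp [predVar]

theorem map_gaussianReal_kalman (hv : 0 < v) (hn : 0 < n) (m : ℝ) :
    ((gaussianReal m d).prod ((gaussianReal 0 v).prod (gaussianReal 0 n))).map
        (fun q => (lam * q.1 + q.2.1 + q.2.2, lam * q.1 + q.2.1))
      = gaussianReal (lam * m) (predVar lam v d + n) ⊗ₘ
        gaussKernel (fun y => filtMean lam (predVar lam v d) n m y)
          (measurable_filtMean _ _ _ measurable_const measurable_id) (filtVar lam v n d) := by
  have h : (fun q : ℝ × ℝ × ℝ => (lam * q.1 + q.2.1 + q.2.2, lam * q.1 + q.2.1))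
      ∘ MeasurableEquiv.prodAssoc
      = (fun q : ℝ × ℝ => (q.1 + q.2, q.1)) ∘ Prod.map (fun q : ℝ × ℝ => lam * q.1 + q.2) id := rfl
  rw [← Measure.prodAssoc_prod, Measure.map_map (by fun_prop) (by fun_prop), h,
    ← Measure.map_map (by fun_prop) (by fun_prop),
    ← Measure.map_prod_map _ _ (by fun_prop) measurable_id, map_gaussianReal_prod_mul_add,
    Measure.map_id, map_add_gaussianReal_prod (predVar_pos hv).ne' hn.ne']
  rfl

variable {Ω E : Type*} [MeasurableSpace Ω] [MeasurableSpace E] {μ : Measure Ω}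
  [IsProbabilityMeasure μ] {H : Ω → E} {X V N : Ω → ℝ} {xh : E → ℝ}

/-- If the last source sample has the Gaussian law `N(xh, d)` given the past, then the next side
information is Gaussian given the past, and the next source sample is Gaussian given the past and
the side information, with the means and the variances of the Kalman filter. -/
theorem map_compProd_kalman (hv : 0 < v) (hn : 0 < n) (hxh : Measurable xh) (ν : Measure E)
    [IsProbabilityMeasure ν] :
    ((ν ⊗ₘ gaussKernel xh hxh d).prod ((gaussianReal 0 v).prod (gaussianReal 0 n))).map
        (fun q => ((q.1.1, lam * q.1.2 + q.2.1 + q.2.2), lam * q.1.2 + q.2.1))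
      = (ν ⊗ₘ gaussKernel (fun h => lam * xh h) (hxh.const_mul lam) (predVar lam v d + n)) ⊗ₘ
        gaussKernel (fun p => filtMean lam (predVar lam v d) n (xh p.1) p.2)
          (measurable_filtMean _ _ _ (hxh.comp measurable_fst) measurable_snd)
          (filtVar lam v n d) := by
  have hm : Measurable fun q : (E × ℝ) × ℝ × ℝ =>
    ((q.1.1, lam * q.1.2 + q.2.1 + q.2.2), lam * q.1.2 + q.2.1) := by fun_prop
  refine Measure.ext_of_lintegral _ fun f hf => ?_
  have hfm : Measurable fun q : (E × ℝ) × ℝ × ℝ =>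
    f ((q.1.1, lam * q.1.2 + q.2.1 + q.2.2), lam * q.1.2 + q.2.1) := hf.comp hm
  have hfi := hf.lintegral_kernel_prod_right'
    (κ := gaussKernel (fun p : E × ℝ => filtMean lam (predVar lam v d) n (xh p.1) p.2)
          (measurable_filtMean _ _ _ (hxh.comp measurable_fst) measurable_snd)
          (filtVar lam v n d))
  rw [lintegral_map hf hm, lintegral_prod _ hfm.aemeasurable, Measure.lintegral_compProd
    hfm.lintegral_prod_right', Measure.lintegral_compProd hf, Measure.lintegral_compProd hfi]
  refine lintegral_congr fun h => ?_
  have hfh : Measurable fun q : ℝ × ℝ => f ((h, q.1), q.2) := hf.comp (by fun_prop)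
  have key := congrArg (fun ρ => ∫⁻ q, f ((h, q.1), q.2) ∂ρ)
    (map_gaussianReal_kalman lam (d := d) hv hn (xh h))
  rw [lintegral_map hfh (by fun_prop), lintegral_prod _ (by fun_prop),
    Measure.lintegral_compProd hfh] at key
  exact key

/-- The driving noise `V` and the observation noise `N` of the next sample are independent centred
Gaussians of variances `v` and `n`, independent of the past `H` and of the last source sample
`X`. -/
def IsNoiseStep (μ : Measure Ω) (H : Ω → E) (X V N : Ω → ℝ) (v n : ℝ≥0) : Prop :=
  μ.map (fun ω => ((H ω, X ω), (V ω, N ω)))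
    = (μ.map fun ω => (H ω, X ω)).prod ((gaussianReal 0 v).prod (gaussianReal 0 n))

/-- The divergence of the posterior law of the source from its Gaussian approximation pays, at the
next sample, for the divergence of the side information from its Gaussian prediction and for the
divergence of the filtered law from its Gaussian approximation. -/
theorem klDiv_kalman_le (hv : 0 < v) (hn : 0 < n) (hH : Measurable H) (hX : Measurable X)
    (hV : Measurable V) (hN : Measurable N) (hxh : Measurable xh)
    (hlaw : IsNoiseStep μ H X V N v n) :
    InformationTheory.klDiv (μ.map fun ω => (H ω, lam * X ω + V ω + N ω))
        (μ.map H ⊗ₘ gaussKernel (fun h => lam * xh h) (hxh.const_mul lam) (predVar lam v d + n))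
      + InformationTheory.klDiv
        (μ.map fun ω => ((H ω, lam * X ω + V ω + N ω), lam * X ω + V ω))
        (μ.map (fun ω => (H ω, lam * X ω + V ω + N ω)) ⊗ₘ
          gaussKernel (fun p => filtMean lam (predVar lam v d) n (xh p.1) p.2)
            (measurable_filtMean _ _ _ (hxh.comp measurable_fst) measurable_snd)
            (filtVar lam v n d))
      ≤ InformationTheory.klDiv (μ.map fun ω => (H ω, X ω)) (μ.map H ⊗ₘ gaussKernel xh hxh d) := by
  have := Measure.isProbabilityMeasure_map (μ := μ) hH.aemeasurable
  have hm : Measurable fun q : (E × ℝ) × ℝ × ℝ =>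
    ((q.1.1, lam * q.1.2 + q.2.1 + q.2.2), lam * q.1.2 + q.2.1) := by fun_prop
  -- adjoin the independent noises on both sides, process the data, and apply the chain rule
  rw [← InformationTheory.klDiv_compProd_left (μ.map fun ω => (H ω, X ω))
    (μ.map H ⊗ₘ gaussKernel xh hxh d)
    (Kernel.const _ ((gaussianReal 0 v).prod (gaussianReal 0 n))), Measure.compProd_const,
    Measure.compProd_const, ← hlaw]
  refine le_of_eq_of_le ?_ (InformationTheory.klDiv_map_le _ _ hm)
  rw [map_compProd_kalman lam hv hn, Measure.map_map hm (by fun_prop)]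
  have h : μ.map ((fun q : (E × ℝ) × ℝ × ℝ =>
      ((q.1.1, lam * q.1.2 + q.2.1 + q.2.2), lam * q.1.2 + q.2.1))
        ∘ fun ω => ((H ω, X ω), V ω, N ω))
      = μ.map (fun ω => (H ω, lam * X ω + V ω + N ω)) ⊗ₘ
        condDistrib (fun ω => lam * X ω + V ω) (fun ω => (H ω, lam * X ω + V ω + N ω)) μ := by
    rw [compProd_map_condDistrib (by fun_prop)]; rfl
  have h' : μ.map (fun ω => ((H ω, lam * X ω + V ω + N ω), lam * X ω + V ω))
      = μ.map (fun ω => (H ω, lam * X ω + V ω + N ω)) ⊗ₘ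
        condDistrib (fun ω => lam * X ω + V ω) (fun ω => (H ω, lam * X ω + V ω + N ω)) μ := by
    rw [compProd_map_condDistrib (by fun_prop)]
  rw [h, h']
  conv_rhs => rw [InformationTheory.klDiv_compProd_eq_add]

/-- The mean square errors of the prediction and of the filtered estimate of the next sample. -/
theorem lintegral_sq_kalman (hv : 0 < v) (hn : 0 < n) (hH : Measurable H) (hX : Measurable X)
    (hV : Measurable V) (hN : Measurable N) (hxh : Measurable xh)
    (hlaw : IsNoiseStep μ H X V N v n)
    (hd : ∫⁻ ω, ENNReal.ofReal ((X ω - xh (H ω)) ^ 2) ∂μ = d) :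
    ∫⁻ ω, ENNReal.ofReal ((lam * X ω + V ω - lam * xh (H ω)) ^ 2) ∂μ = predVar lam v d ∧
    ∫⁻ ω, ENNReal.ofReal ((lam * X ω + V ω
      - filtMean lam (predVar lam v d) n (xh (H ω)) (lam * X ω + V ω + N ω)) ^ 2) ∂μ
        = filtVar lam v n d := by
  have := Measure.isProbabilityMeasure_map (μ := μ) (hH.prodMk hX).aemeasurable
  set ρ := μ.map fun ω => (H ω, X ω) with hρ
  set e : (E × ℝ) → ℝ := fun p => p.2 - xh p.1 with he
  have hem : Measurable e := by fun_prop
  have hde : ∫⁻ p, ENNReal.ofReal (e p ^ 2) ∂ρ = d := by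
    rw [hρ, lintegral_map (by fun_prop) (by fun_prop)]; exact hd
  have key (a b : ℝ) : ∫⁻ ω, ENNReal.ofReal ((a * (lam * e (H ω, X ω) + V ω) - b * N ω) ^ 2) ∂μ
      = (‖a‖₊ ^ 2 * predVar lam v d + ‖b‖₊ ^ 2 * n : ℝ≥0) := by
    have hg : Measurable fun q : (E × ℝ) × ℝ × ℝ =>
        ENNReal.ofReal ((a * (lam * e q.1 + q.2.1) - b * q.2.2) ^ 2) := by fun_prop
    have h1 : ∫⁻ q : (E × ℝ) × ℝ, ENNReal.ofReal ((lam * e q.1 + q.2) ^ 2)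
        ∂(ρ.prod (gaussianReal 0 v)) = predVar lam v d := by
      rw [lintegral_prod _ (by fun_prop)]
      have h := lintegral_lintegral_sq_gaussianReal ρ hem hde lam (-1) v
      simp only [neg_mul, one_mul, sub_neg_eq_add, nnnorm_neg, nnnorm_one, one_pow] at h
      exact h
    have h2 := lintegral_lintegral_sq_gaussianReal (ρ.prod (gaussianReal 0 v))
      (e := fun q => lam * e q.1 + q.2) (by fun_prop) h1 a b n
    rw [← h2, lintegral_prod _ (by fun_prop),
      ← lintegral_map (f := fun q : (E × ℝ) × ℝ × ℝ =>
        ENNReal.ofReal ((a * (lam * e q.1 + q.2.1) - b * q.2.2) ^ 2))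
        (g := fun ω => ((H ω, X ω), (V ω, N ω))) hg (by fun_prop), hlaw,
      lintegral_prod _ hg.aemeasurable]
    refine lintegral_congr fun p => ?_
    rw [lintegral_prod _ (by fun_prop)]
  constructor
  · have h := key 1 0
    simp only [one_mul, zero_mul, sub_zero, nnnorm_one, one_pow, nnnorm_zero, ne_eq,
      OfNat.ofNat_ne_zero, not_false_eq_true, zero_pow, zero_mul, add_zero] at h
    rw [← h]
    refine lintegral_congr fun ω => ?_
    simp only [he]
    congr 2
    ring
  · have hp : (0 : ℝ) < predVar lam v d := predVar_pos hv
    have hn' : (0 : ℝ) < n := hn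
    set p := predVar lam v d with hpdef
    have h := key (1 - p / (p + n)) (p / (p + n))
    have hc : (‖(1 - p / (p + n) : ℝ)‖₊ ^ 2 * p + ‖(p / (p + n) : ℝ)‖₊ ^ 2 * n : ℝ≥0)
        = filtVar lam v n d := by
      rw [← NNReal.coe_inj, filtVar]
      push_cast
      rw [Real.norm_eq_abs, Real.norm_eq_abs, sq_abs, sq_abs, ← hpdef]
      field_simp
      ring
    rw [← hc, ← h]
    refine lintegral_congr fun ω => ?_
    simp only [he, filtMean]
    congr 2
    ring

end KalmanStep

/-! ### One transmission: Gaussian bounds on the information -/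

section Estimator

variable {Ω E : Type*} [MeasurableSpace Ω] [MeasurableSpace E] {μ : Measure Ω} {Z : Ω → E}
  {X : Ω → ℝ}

/-- An estimator may be modified so that its error variance is positive, does not exceed that of a
given estimator, and exceeds the original one by arbitrarily little, without falling below it
unless it is the given one. -/
theorem exists_estimator {s : ℝ≥0} (hs : 0 < s) (hX : Measurable X) (hZ : Measurable Z)
    {m g : E → ℝ} (hm : Measurable m) (hg : Measurable g)
    (h1 : ∫⁻ ω, ENNReal.ofReal ((X ω - m (Z ω)) ^ 2) ∂μ = s) {ε : ℝ≥0} (hε : 0 < ε) :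
    ∃ g' : E → ℝ, Measurable g' ∧ ∃ d : ℝ≥0, 0 < d ∧ d ≤ s ∧
      ∫⁻ ω, ENNReal.ofReal ((X ω - g' (Z ω)) ^ 2) ∂μ = d ∧
      (d : ℝ≥0∞) ≤ ∫⁻ ω, ENNReal.ofReal ((X ω - g (Z ω)) ^ 2) ∂μ + ε ∧
      (d = s ∨ ∫⁻ ω, ENNReal.ofReal ((X ω - g (Z ω)) ^ 2) ∂μ ≤ d) := by
  set δ := ∫⁻ ω, ENNReal.ofReal ((X ω - g (Z ω)) ^ 2) ∂μ with hδ
  rcases le_or_gt (s : ℝ≥0∞) δ with h | h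
  · exact ⟨m, hm, s, hs, le_rfl, h1, h.trans le_self_add, Or.inl rfl⟩
  have hδt : δ ≠ ∞ := (h.trans ENNReal.coe_lt_top).ne
  by_cases h0 : δ = 0
  -- if the error vanishes, mix in a little of the other estimator
  · set e := min ε s with he
    have hepos : 0 < e := lt_min hε hs
    set θ : ℝ := √((e : ℝ) / s) with hθ
    have hθ2 : θ ^ 2 * s = e := by
      have hs' : (0 : ℝ) < s := hs
      rw [hθ, Real.sq_sqrt (by positivity)]
      field_simp
    refine ⟨fun z => (1 - θ) * g z + θ * m z, by fun_prop, e, hepos, min_le_right _ _, ?_, ?_,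
      Or.inr (h0.le.trans zero_le)⟩
    · have hae : ∀ᵐ ω ∂μ, X ω = g (Z ω) := by
        rw [hδ, lintegral_eq_zero_iff (by fun_prop)] at h0
        filter_upwards [h0] with ω hω
        have : (X ω - g (Z ω)) ^ 2 ≤ 0 := ENNReal.ofReal_eq_zero.1 hω
        nlinarith [pow_eq_zero_iff (two_ne_zero) |>.1 (le_antisymm this (sq_nonneg _))]
      calc ∫⁻ ω, ENNReal.ofReal ((X ω - ((1 - θ) * g (Z ω) + θ * m (Z ω))) ^ 2) ∂μ
          = ∫⁻ ω, ENNReal.ofReal (θ ^ 2) * ENNReal.ofReal ((X ω - m (Z ω)) ^ 2) ∂μ := by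
            refine lintegral_congr_ae ?_
            filter_upwards [hae] with ω hω
            rw [← hω, ← ENNReal.ofReal_mul (by positivity)]
            congr 1
            ring
        _ = e := by
            rw [lintegral_const_mul _ (by fun_prop), h1, ← ENNReal.ofReal_coe_nnreal,
              ← ENNReal.ofReal_mul (by positivity), hθ2, ENNReal.ofReal_coe_nnreal]
    · rw [h0, zero_add]
      exact ENNReal.coe_le_coe.2 (min_le_left _ _)
  · refine ⟨g, hg, δ.toNNReal, ENNReal.toNNReal_pos h0 hδt, ?_, ?_, ?_, ?_⟩
    · rw [← ENNReal.coe_le_coe, ENNReal.coe_toNNReal hδt]; exact h.le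
    · rw [ENNReal.coe_toNNReal hδt]
    · rw [ENNReal.coe_toNNReal hδt]; exact le_self_add
    · rw [ENNReal.coe_toNNReal hδt]; exact Or.inr le_rfl

end Estimator

section Update

open InformationTheory

variable {Ω E : Type*} [MeasurableSpace Ω] [MeasurableSpace E] {μ : Measure Ω}
  [IsProbabilityMeasure μ] {Z : Ω → E} {X W : Ω → ℝ}

theorem gaussKernel_prodMkRight {m : E → ℝ} (hm : Measurable m) (v : ℝ≥0) :
    (gaussKernel m hm v).prodMkRight ℝ
      = gaussKernel (fun p : E × ℝ => m p.1) (hm.comp measurable_fst) v := by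
  ext1 p; rfl

/-- If an observation `W` lowers the error variance of a source sample from `s` to `d`, the
information it conveys is at least `1/2 log (s / d)`, up to the change of the divergence of the
law of the sample from its Gaussian approximation. -/
theorem klDiv_update_le {s d : ℝ≥0} (hs : 0 < s) (hd : 0 < d) (hds : d ≤ s)
    (hX : Measurable X) (hW : Measurable W) (hZ : Measurable Z) {m : E → ℝ} (hm : Measurable m)
    {g : E × ℝ → ℝ} (hg : Measurable g)
    (h1 : ∫⁻ ω, ENNReal.ofReal ((X ω - m (Z ω)) ^ 2) ∂μ = s)
    (h2 : ∫⁻ ω, ENNReal.ofReal ((X ω - g (Z ω, W ω)) ^ 2) ∂μ = d) :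
    klDiv (μ.map fun ω => ((Z ω, W ω), X ω)) (μ.map (fun ω => (Z ω, W ω)) ⊗ₘ gaussKernel g hg d)
        + ENNReal.ofReal (1 / 2 * Real.log (s / d))
      ≤ condMutualInfo μ X W Z
        + klDiv (μ.map fun ω => (Z ω, X ω)) (μ.map Z ⊗ₘ gaussKernel m hm s) := by
  rw [condMutualInfo_comm hX hW hZ, ← klDiv_compProd_prodMkRight_eq_add hW hX hZ,
    gaussKernel_prodMkRight]
  have := Measure.isProbabilityMeasure_map (μ := μ) (hZ.prodMk hW).aemeasurable
  have := Measure.isProbabilityMeasure_map (μ := μ) ((hZ.prodMk hW).prodMk hX).aemeasurable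
  set P := μ.map fun ω => ((Z ω, W ω), X ω) with hP
  by_cases htop : klDiv P (μ.map (fun ω => (Z ω, W ω)) ⊗ₘ
      gaussKernel (fun p : E × ℝ => m p.1) (hm.comp measurable_fst) s) = ∞
  · rw [htop]; exact le_top
  set f : (E × ℝ) × ℝ → ℝ := fun p => gaussLogRatio (m p.1.1) s (g p.1) d p.2 with hf
  have hfm : Measurable f := by simp only [hf, gaussLogRatio]; fun_prop
  obtain ⟨i1, e1⟩ := integrable_and_integral_sq (f := fun ω => X ω - m (Z ω)) (by fun_prop) h1
  obtain ⟨i2, e2⟩ := integrable_and_integral_sq (f := fun ω => X ω - g (Z ω, W ω))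
    (by fun_prop) h2
  have hmap : Measurable fun ω => ((Z ω, W ω), X ω) := (hZ.prodMk hW).prodMk hX
  have hs' : (0 : ℝ) < s := hs
  have hd' : (0 : ℝ) < d := hd
  have hcomp : (f ∘ fun ω => ((Z ω, W ω), X ω)) = fun ω => 1 / 2 * Real.log (s / d)
      + (X ω - m (Z ω)) ^ 2 / (2 * s) - (X ω - g (Z ω, W ω)) ^ 2 / (2 * d) := rfl
  have hi : Integrable (f ∘ fun ω => ((Z ω, W ω), X ω)) μ := by
    rw [hcomp]
    exact ((integrable_const _).add (i1.div_const _)).sub (i2.div_const _)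
  have hfP : Integrable f P := (integrable_map_measure hfm.aestronglyMeasurable
    hmap.aemeasurable).2 hi
  have hint : ∫ p, f p ∂P = 1 / 2 * Real.log (s / d) := by
    rw [hP, integral_map hmap.aemeasurable hfm.aestronglyMeasurable]
    change ∫ ω, (1 / 2 * Real.log (s / d)
      + (X ω - m (Z ω)) ^ 2 / (2 * s) - (X ω - g (Z ω, W ω)) ^ 2 / (2 * d)) ∂μ = _
    rw [integral_sub (f := fun ω => 1 / 2 * Real.log (s / d) + (X ω - m (Z ω)) ^ 2 / (2 * s))
      ((integrable_const _).add (i1.div_const _)) (i2.div_const _),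
      integral_add (integrable_const _) (i1.div_const _), integral_div, integral_div, e1, e2]
    simp only [integral_const, probReal_univ, smul_eq_mul]
    field_simp
    ring
  obtain ⟨hne, heq⟩ := klDiv_withDensity_exp P _ _ hfP hfm
    (compProd_gaussKernel_eq_withDensity (m₁ := fun p : E × ℝ => m p.1)
      (μ.map fun ω => (Z ω, W ω)) (hm.comp measurable_fst) hg hs.ne' hd.ne') htop
  have hlog : 0 ≤ 1 / 2 * Real.log (s / d : ℝ) := by
    have : (1 : ℝ) ≤ s / d := (one_le_div hd').2 (NNReal.coe_le_coe.2 hds)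
    have := Real.log_nonneg this
    positivity
  rw [← ENNReal.ofReal_toReal hne, ← ENNReal.ofReal_add ENNReal.toReal_nonneg hlog, heq, hint,
    sub_add_cancel, ENNReal.ofReal_toReal htop]

/-- An affine map with random offset `c` carries a Gaussian kernel to a Gaussian kernel. -/
theorem map_affine_compProd_gaussKernel {F : Type*} [MeasurableSpace F] (ρ : Measure F)
    [IsFiniteMeasure ρ] {m c : F → ℝ} (hm : Measurable m) (hc : Measurable c) (b : ℝ) (v : ℝ≥0) :
    (ρ ⊗ₘ gaussKernel m hm v).map (fun p => (p.1, c p.1 + b * p.2))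
      = ρ ⊗ₘ gaussKernel (fun z => c z + b * m z) (hc.add (hm.const_mul b)) (‖b‖₊ ^ 2 * v) := by
  have hmap : Measurable fun p : F × ℝ => (p.1, c p.1 + b * p.2) := by fun_prop
  refine Measure.ext_of_lintegral _ fun f hf => ?_
  have hf' : Measurable fun p : F × ℝ => f (p.1, c p.1 + b * p.2) := hf.comp hmap
  rw [lintegral_map hf hmap, Measure.lintegral_compProd hf', Measure.lintegral_compProd hf]
  refine lintegral_congr fun z => ?_
  have h : gaussianReal (c z + b * m z) (‖b‖₊ ^ 2 * v)
      = (gaussianReal (m z) v).map fun x => c z + b * x := by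
    have h' : (fun x : ℝ => c z + b * x) = (c z + ·) ∘ (b * ·) := rfl
    rw [h', ← Measure.map_map (by fun_prop) (by fun_prop), gaussianReal_map_const_mul,
      gaussianReal_map_const_add, add_comm]
    congr 2
    ext
    simp
  have hfz : Measurable fun x => f (z, x) := hf.comp (by fun_prop)
  rw [gaussKernel_apply, gaussKernel_apply, h, lintegral_map hfz (by fun_prop)]

/-- The information conveyed by a Gaussian test channel with signal power `q` and unit noise. -/
theorem condMutualInfo_le_of_gaussian {A : Type*} [MeasurableSpace A] [StandardBorelSpace A]
    [Nonempty A] {X : Ω → A} (hX : Measurable X) (hW : Measurable W) (hZ : Measurable Z)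
    {m : E × A → ℝ} (hm : Measurable m) {c : E → ℝ} (hc : Measurable c) (b : ℝ) {q : ℝ≥0}
    (hq : ∫⁻ ω, ENNReal.ofReal (m (Z ω, X ω) ^ 2) ∂μ = q)
    (hlaw : μ.map (fun ω => ((Z ω, X ω), W ω)) = μ.map (fun ω => (Z ω, X ω)) ⊗ₘ
      gaussKernel (fun p => c p.1 + b * m p) ((hc.comp measurable_fst).add (hm.const_mul b))
        (‖b‖₊ ^ 2)) :
    condMutualInfo μ X W Z ≤ ENNReal.ofReal (1 / 2 * Real.log (1 + q)) := by
  have := Measure.isProbabilityMeasure_map (μ := μ) (hZ.prodMk hX).aemeasurable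
  set ρ := μ.map fun ω => (Z ω, X ω) with hρ
  refine (condMutualInfo_le_klDiv hX hW hZ (gaussKernel c hc (‖b‖₊ ^ 2 * (1 + q)))).trans ?_
  have hr : ρ ⊗ₘ (gaussKernel c hc (‖b‖₊ ^ 2 * (1 + q))).prodMkRight A
      = (ρ ⊗ₘ gaussKernel (fun _ => 0) measurable_const (1 + q)).map
        (fun p => (p.1, c p.1.1 + b * p.2)) := by
    rw [map_affine_compProd_gaussKernel (c := fun p : E × A => c p.1) ρ measurable_const
      (hc.comp measurable_fst)]
    congr 1
    ext1 p
    simp [gaussKernel_apply]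
  have hl : ρ ⊗ₘ gaussKernel (fun p => c p.1 + b * m p)
      ((hc.comp measurable_fst).add (hm.const_mul b)) (‖b‖₊ ^ 2)
      = (ρ ⊗ₘ gaussKernel m hm 1).map (fun p => (p.1, c p.1.1 + b * p.2)) := by
    rw [map_affine_compProd_gaussKernel (c := fun p : E × A => c p.1) ρ hm
      (hc.comp measurable_fst)]
    congr 1
    ext1 p
    simp [gaussKernel_apply]
  rw [hlaw, hr, hl]
  refine (klDiv_map_le _ _ (by fun_prop)).trans ?_
  set P := ρ ⊗ₘ gaussKernel m hm 1 with hP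
  have hq' : (1 + q : ℝ≥0) ≠ 0 := by positivity
  set f : (E × A) × ℝ → ℝ := fun p => gaussLogRatio (m p.1) 1 0 (1 + q) p.2 with hf
  have hfm : Measurable f := by simp only [hf, gaussLogRatio]; fun_prop
  have hqρ : ∫⁻ p, ENNReal.ofReal (m p ^ 2) ∂ρ = q := by
    rw [hρ, lintegral_map (by fun_prop) (by fun_prop)]; exact hq
  have l1 : ∫⁻ p, ENNReal.ofReal ((p.2 - m p.1) ^ 2) ∂P = (1 : ℝ≥0) := by
    rw [hP, Measure.lintegral_compProd (by fun_prop)]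
    have h (z : E × A) : ∫⁻ x, ENNReal.ofReal ((x - m z) ^ 2) ∂(gaussKernel m hm 1 z) = 1 := by
      have := lintegral_sq_gaussianReal (m z) 1 (-m z) (-1)
      simp only [neg_mul, one_mul, sub_neg_eq_add, neg_add_cancel] at this
      simpa [gaussKernel_apply, add_comm, sub_eq_add_neg] using this
    simp [h]
  have l2 : ∫⁻ p, ENNReal.ofReal (p.2 ^ 2) ∂P = (1 + q : ℝ≥0) := by
    rw [hP, Measure.lintegral_compProd (by fun_prop)]
    have h (z : E × A) : ∫⁻ x, ENNReal.ofReal (x ^ 2) ∂(gaussKernel m hm 1 z)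
        = ENNReal.ofReal (m z ^ 2) + 1 := by
      have := lintegral_sq_gaussianReal (m z) 1 0 (-1)
      simp only [neg_mul, one_mul, sub_neg_eq_add, zero_add] at this
      rw [gaussKernel_apply, this, ENNReal.ofReal_add (by positivity) (by positivity)]
      simp
    simp only [h]
    rw [lintegral_add_right _ measurable_const, hqρ]
    simp [add_comm]
  obtain ⟨i1, e1⟩ := integrable_and_integral_sq (f := fun p : (E × A) × ℝ => p.2 - m p.1)
    (by fun_prop) l1
  obtain ⟨i2, e2⟩ := integrable_and_integral_sq (f := fun p : (E × A) × ℝ => p.2)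
    (by fun_prop) l2
  have hfe : f = fun p : (E × A) × ℝ => 1 / 2 * Real.log ((1 : ℝ≥0) / (1 + q : ℝ≥0))
      + (p.2 - m p.1) ^ 2 / (2 * (1 : ℝ≥0)) - (p.2 - 0) ^ 2 / (2 * (1 + q : ℝ≥0)) := rfl
  simp only [sub_zero] at hfe
  have hfP : Integrable f P := by
    rw [hfe]
    exact ((integrable_const _).add (i1.div_const _)).sub (i2.div_const _)
  have hint : ∫ p, f p ∂P = -(1 / 2 * Real.log (1 + q)) := by
    rw [hfe, integral_sub (f := fun p : (E × A) × ℝ =>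
        1 / 2 * Real.log ((1 : ℝ≥0) / (1 + q : ℝ≥0)) + (p.2 - m p.1) ^ 2 / (2 * (1 : ℝ≥0)))
      ((integrable_const _).add (i1.div_const _)) (i2.div_const _),
      integral_add (integrable_const _) (i1.div_const _), integral_div, integral_div, e1, e2]
    have : (0 : ℝ) < 1 + q := by positivity
    simp only [integral_const, probReal_univ, smul_eq_mul]
    push_cast
    rw [one_div (1 + (q : ℝ)), Real.log_inv]
    field_simp
    ring
  obtain ⟨hne, heq⟩ := klDiv_withDensity_exp P P _ hfP hfm
    (compProd_gaussKernel_eq_withDensity ρ hm measurable_const one_ne_zero hq') (by simp)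
  rw [← ENNReal.ofReal_toReal hne, heq, hint, klDiv_self]
  simp

end Update

/-! ### Estimation from nearly Gaussian side information -/

section Gap

open InformationTheory

variable {E : Type*} [MeasurableSpace E]

/-- The Gaussian moment generating function. -/
theorem lintegral_exp_gaussianReal {v : ℝ≥0} (hv : v ≠ 0) (m r : ℝ) :
    ∫⁻ x, ENNReal.ofReal (Real.exp (r * (x - m) - r ^ 2 * v / 2)) ∂(gaussianReal m v) = 1 := by
  have h := measure_univ (μ := gaussianReal (m + r * v) v)
  rw [gaussianReal_eq_withDensity hv hv m, withDensity_apply _ MeasurableSet.univ,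
    setLIntegral_univ] at h
  rw [← h]
  refine lintegral_congr fun x => ?_
  have hv' : (v : ℝ) ≠ 0 := by exact_mod_cast hv
  congr 2
  rw [gaussLogRatio, div_self hv', Real.log_one]
  field_simp
  ring

/-- Under a Gaussian law with additional noise, the innovation of the original variable given the
noisy one is centred and sub-Gaussian, whatever multiplier `r` of the noisy variable is used. -/
theorem lintegral_exp_mul_innovation_le_one (ν : Measure E) [IsProbabilityMeasure ν] {m : E → ℝ}
    (hm : Measurable m) {a τ : ℝ≥0} (ha : a ≠ 0) (hτ : τ ≠ 0) {r : E × ℝ → ℝ} (hr : Measurable r) :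
    ∫⁻ z, ENNReal.ofReal (Real.exp (r (z.1.1, z.1.2 + z.2)
        * (z.1.2 - (m z.1.1 + a / (a + τ) * (z.1.2 + z.2 - m z.1.1)))
        - r (z.1.1, z.1.2 + z.2) ^ 2 * τ / 2))
      ∂((ν ⊗ₘ gaussKernel m hm a).prod (gaussianReal 0 τ)) ≤ 1 := by
  have hF : Measurable fun z : (E × ℝ) × ℝ => ENNReal.ofReal (Real.exp (r (z.1.1, z.1.2 + z.2)
        * (z.1.2 - (m z.1.1 + a / (a + τ) * (z.1.2 + z.2 - m z.1.1)))
        - r (z.1.1, z.1.2 + z.2) ^ 2 * τ / 2)) := by fun_prop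
  rw [lintegral_prod _ hF.aemeasurable, Measure.lintegral_compProd hF.lintegral_prod_right']
  have hu (u : E) : ∫⁻ y, ∫⁻ ζ, ENNReal.ofReal (Real.exp (r (u, y + ζ)
        * (y - (m u + a / (a + τ) * (y + ζ - m u))) - r (u, y + ζ) ^ 2 * τ / 2))
        ∂(gaussianReal 0 τ) ∂(gaussianReal (m u) a) ≤ 1 := by
    have hG : Measurable fun q : ℝ × ℝ => ENNReal.ofReal (Real.exp (r (u, q.1)
        * (q.2 - (m u + a / (a + τ) * (q.1 - m u))) - r (u, q.1) ^ 2 * τ / 2)) := by fun_prop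
    have h := lintegral_map (μ := (gaussianReal (m u) a).prod (gaussianReal 0 τ)) hG
      (by fun_prop : Measurable fun q : ℝ × ℝ => (q.1 + q.2, q.1))
    rw [map_add_gaussianReal_prod ha hτ, Measure.lintegral_compProd hG,
      lintegral_prod _ (by fun_prop)] at h
    rw [← h]
    refine (lintegral_mono (g := fun _ => 1) fun y => ?_).trans (by simp)
    rw [gaussKernel_apply]
    have hv : a * τ / (a + τ) ≠ 0 := by positivity
    refine le_trans (lintegral_mono fun x => ?_)
      (lintegral_exp_gaussianReal hv (m u + a / (a + τ) * (y - m u)) (r (u, y))).le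
    refine ENNReal.ofReal_le_ofReal (Real.exp_le_exp.2 ?_)
    have hb : ((a * τ / (a + τ) : ℝ≥0) : ℝ) ≤ τ := by
      have ha' : (0 : ℝ) < a := by positivity
      have hτ' : (0 : ℝ) < τ := by positivity
      push_cast
      rw [div_le_iff₀ (by positivity)]
      nlinarith
    have := mul_le_mul_of_nonneg_left hb (sq_nonneg (r (u, y)))
    linarith
  refine (lintegral_mono (g := fun _ => 1) fun u => ?_).trans (by simp)
  exact hu u

/-- The law of `(σ, ν)`, where `ν` is the noise of variance `n` and `σ` is `ν` plus an independent
noise of variance `τ`: drawing `σ` first, `ν` is obtained by Bayes' rule. -/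
theorem map_compProd_gaussKernel_noise (ρ : Measure (E × ℝ)) [IsProbabilityMeasure ρ] {n τ : ℝ≥0}
    (hn : n ≠ 0) (hτ : τ ≠ 0) :
    ((ρ.prod (gaussianReal 0 (n + τ))) ⊗ₘ
        gaussKernel (fun q => n / (n + τ) * q.2) (by fun_prop) (n * τ / (n + τ))).map
        (fun z => ((z.1.1.1, z.1.1.2 + z.2), z.1.2 - z.2))
      = ((ρ.prod (gaussianReal 0 n)).map fun q => (q.1.1, q.1.2 + q.2)).prod
          (gaussianReal 0 τ) := by
  have hm1 : Measurable fun q : (E × ℝ) × ℝ => (q.1.1, q.1.2 + q.2) := by fun_prop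
  have := Measure.isProbabilityMeasure_map (μ := ρ.prod (gaussianReal 0 n)) hm1.aemeasurable
  have hm2 : Measurable fun z : ((E × ℝ) × ℝ) × ℝ =>
    ((z.1.1.1, z.1.1.2 + z.2), z.1.2 - z.2) := by fun_prop
  refine Measure.ext_of_lintegral _ fun f hf => ?_
  have hf2 : Measurable fun z : ((E × ℝ) × ℝ) × ℝ =>
    f ((z.1.1.1, z.1.1.2 + z.2), z.1.2 - z.2) := hf.comp hm2
  have hfi := hf2.lintegral_kernel_prod_right'
    (κ := gaussKernel (fun q : (E × ℝ) × ℝ => n / (n + τ) * q.2) (by fun_prop) (n * τ / (n + τ)))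
  have hfj : Measurable fun q : (E × ℝ) × ℝ =>
      ∫⁻ y, f ((q.1.1, q.1.2 + q.2), y) ∂(gaussianReal 0 τ) := hf.lintegral_prod_right'.comp hm1
  rw [lintegral_map hf hm2, Measure.lintegral_compProd hf2, lintegral_prod _ hfi.aemeasurable,
    lintegral_prod _ hf.aemeasurable, lintegral_map hf.lintegral_prod_right' hm1,
    lintegral_prod (fun q : (E × ℝ) × ℝ =>
      ∫⁻ y, f ((q.1.1, q.1.2 + q.2), y) ∂(gaussianReal 0 τ)) hfj.aemeasurable]
  refine lintegral_congr fun x => ?_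
  have hG : Measurable fun q : ℝ × ℝ => f ((x.1, x.2 + q.2), q.1 - q.2) :=
    hf.comp (by fun_prop)
  have h := lintegral_map (μ := (gaussianReal 0 n).prod (gaussianReal 0 τ)) hG
    (by fun_prop : Measurable fun q : ℝ × ℝ => (q.1 + q.2, q.1))
  rw [map_add_gaussianReal_prod hn hτ, Measure.lintegral_compProd hG,
    lintegral_prod (fun q : ℝ × ℝ => f ((x.1, x.2 + q.1), q.1 + q.2 - q.1))
      (hf.comp (by fun_prop : Measurable fun q : ℝ × ℝ =>
        ((x.1, x.2 + q.1), q.1 + q.2 - q.1))).aemeasurable] at h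
  simpa [gaussKernel_apply] using h

theorem memLp_two_of_lintegral_sq {Ω : Type*} [MeasurableSpace Ω] {μ : Measure Ω} {f : Ω → ℝ}
    (hf : Measurable f) {d : ℝ≥0} (h : ∫⁻ ω, ENNReal.ofReal (f ω ^ 2) ∂μ = d) : MemLp f 2 μ :=
  (memLp_two_iff_integrable_sq hf.aestronglyMeasurable).2 (integrable_and_integral_sq hf h).1

/-- The estimation error from side information that has been smoothed by an additional noise of
variance `τ` is almost that of the Gaussian case, if the law of the side information is almost
Gaussian. -/
theorem filtVar_le_lintegral_sq_add_klDiv (ρ : Measure (E × ℝ)) [IsProbabilityMeasure ρ]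
    {m : E → ℝ} (hm : Measurable m) {p n τ : ℝ≥0} (hp : p ≠ 0) (hn : n ≠ 0) (hτ : τ ≠ 0)
    (hpm : ∫⁻ q, ENNReal.ofReal ((q.2 - m q.1) ^ 2) ∂ρ = p) {g : E × ℝ → ℝ} (hg : Measurable g)
    {B : ℝ} (hB : ∀ u y, |g (u, y) - y| ≤ B) :
    ((p * (n + τ) / (p + (n + τ)) : ℝ≥0) : ℝ≥0∞)
      ≤ ∫⁻ q, ENNReal.ofReal ((q.1.2 - g (q.1.1, q.1.2 + q.2)) ^ 2)
          ∂(ρ.prod (gaussianReal 0 (n + τ)))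
        + ENNReal.ofReal (2 * ((n + τ) ^ 2 / τ)) *
          klDiv ((ρ.prod (gaussianReal 0 n)).map fun q => (q.1.1, q.1.2 + q.2))
            (ρ.map Prod.fst ⊗ₘ gaussKernel m hm (p + n)) := by
  set M := ρ.prod (gaussianReal 0 (n + τ)) with hM
  set k : (E × ℝ) × ℝ → ℝ := fun q => n / (n + τ) * q.2 with hk
  have hkm : Measurable k := by fun_prop
  set v : ℝ≥0 := n * τ / (n + τ) with hv
  set P := M ⊗ₘ gaussKernel k hkm v with hP
  have hm1 : Measurable fun q : (E × ℝ) × ℝ => (q.1.1, q.1.2 + q.2) := by fun_prop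
  have hm2 : Measurable fun z : ((E × ℝ) × ℝ) × ℝ =>
    ((z.1.1.1, z.1.1.2 + z.2), z.1.2 - z.2) := by fun_prop
  have := Measure.isProbabilityMeasure_map (μ := ρ.prod (gaussianReal 0 n)) hm1.aemeasurable
  have := Measure.isProbabilityMeasure_map (μ := ρ) measurable_fst.aemeasurable
  have := Measure.isProbabilityMeasure_map (μ := P) hm2.aemeasurable
  have hn' : (0 : ℝ) < n := by positivity
  have hp' : (0 : ℝ) < p := by positivity
  have hτ' : (0 : ℝ) < τ := by positivity
  set β : ℝ := p / (p + n + τ) with hβ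
  -- the linear estimate from the smoothed side information
  set m' : (E × ℝ) × ℝ → ℝ := fun q => m q.1.1 + β * (q.1.2 + q.2 - m q.1.1) with hm'
  set q : (E × ℝ) × ℝ → ℝ := fun z => g (z.1.1, z.1.2 + z.2) - m' z with hq
  set r : E × ℝ → ℝ := fun z => (g z - (m z.1 + β * (z.2 - m z.1))) / (n + τ) with hr
  have hrm : Measurable r := by fun_prop
  have hqm : Measurable q := by fun_prop
  -- moments under `M`
  have memN : MemLp (fun z : (E × ℝ) × ℝ => z.2) 2 M := by
    have h : Measure.map Prod.snd M = gaussianReal 0 (n + τ) := by simp [hM]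
    have h2 := memLp_id_gaussianReal (μ := 0) (v := n + τ) 2
    rw [← h] at h2
    exact (memLp_map_measure_iff (f := Prod.snd) (by fun_prop) (by fun_prop)).1 h2
  have memX : MemLp (fun z : (E × ℝ) × ℝ => z.1.2 - m z.1.1) 2 M := by
    have h : Measure.map Prod.fst M = ρ := by simp [hM]
    have h2 := memLp_two_of_lintegral_sq (f := fun z : E × ℝ => z.2 - m z.1) (by fun_prop) hpm
    rw [← h] at h2
    exact (memLp_map_measure_iff (f := Prod.fst) (by fun_prop) (by fun_prop)).1 h2
  have memG : MemLp (fun z : (E × ℝ) × ℝ => g (z.1.1, z.1.2 + z.2) - (z.1.2 + z.2)) 2 M :=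
    MemLp.of_bound (by fun_prop) B (ae_of_all _ fun z => hB _ _)
  have meme : MemLp (fun z : (E × ℝ) × ℝ => z.1.2 - m' z) 2 M := by
    have h : (fun z : (E × ℝ) × ℝ => z.1.2 - m' z)
        = fun z => (1 - β) * (z.1.2 - m z.1.1) - β * z.2 := by
      funext z; simp only [hm']; ring
    rw [h]; exact (memX.const_mul _).sub (memN.const_mul _)
  have memq : MemLp q 2 M := by
    have h : q = fun z => (g (z.1.1, z.1.2 + z.2) - (z.1.2 + z.2))
        + ((z.1.2 - m' z) + z.2) := by
      funext z; simp only [hq]; ring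
    rw [h]; exact memG.add (meme.add memN)
  have ie : ∫ z, (z.1.2 - m' z) ^ 2 ∂M = p * (n + τ) / (p + (n + τ)) := by
    have hl : ∫⁻ z, ENNReal.ofReal ((z.1.2 - m' z) ^ 2) ∂M
        = (‖1 - β‖₊ ^ 2 * p + ‖β‖₊ ^ 2 * (n + τ) : ℝ≥0) := by
      rw [← lintegral_lintegral_sq_gaussianReal ρ (e := fun z : E × ℝ => z.2 - m z.1)
        (by fun_prop) hpm (1 - β) β (n + τ), hM, lintegral_prod _ (by fun_prop)]
      refine lintegral_congr fun z => lintegral_congr fun y => ?_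
      simp only [hm']
      congr 2; ring
    rw [(integrable_and_integral_sq (by fun_prop) hl).2]
    push_cast
    rw [Real.norm_eq_abs, Real.norm_eq_abs, sq_abs, sq_abs, hβ]
    field_simp
    ring
  -- the correlation of the error with any function of the smoothed side information
  have meme' : MemLp (fun z : ((E × ℝ) × ℝ) × ℝ => z.2 - k z.1) 2 P := by
    refine memLp_two_of_lintegral_sq (by fun_prop) (d := v) ?_
    rw [hP, Measure.lintegral_compProd (by fun_prop)]
    have h (z : (E × ℝ) × ℝ) : ∫⁻ x, ENNReal.ofReal ((x - k z) ^ 2) ∂(gaussKernel k hkm v z)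
        = v := by
      have := lintegral_sq_gaussianReal (k z) v (-k z) (-1)
      simp only [neg_mul, one_mul, sub_neg_eq_add, neg_add_cancel] at this
      simpa [gaussKernel_apply, add_comm, sub_eq_add_neg] using this
    simp [h]
  have hfstP : Measure.map Prod.fst P = M := by
    rw [hP, ← Measure.fst, Measure.fst_compProd]
  have up {f : (E × ℝ) × ℝ → ℝ} (hf : Measurable f) (h : MemLp f 2 M) :
      MemLp (fun z : ((E × ℝ) × ℝ) × ℝ => f z.1) 2 P := by
    rw [← hfstP] at h
    exact (memLp_map_measure_iff (f := Prod.fst) (by fun_prop) (by fun_prop)).1 h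
  have upi {f : (E × ℝ) × ℝ → ℝ} (hf : Measurable f) : ∫ z, f z.1 ∂P = ∫ z, f z ∂M := by
    rw [← hfstP, integral_map (by fun_prop) (by fun_prop)]
  have iqe : Integrable (fun z : ((E × ℝ) × ℝ) × ℝ => q z.1 * (z.2 - k z.1)) P :=
    (up hqm memq).integrable_mul meme'
  have iqe0 : ∫ z : ((E × ℝ) × ℝ) × ℝ, q z.1 * (z.2 - k z.1) ∂P = 0 := by
    rw [hP, Measure.integral_compProd iqe]
    have h (z : (E × ℝ) × ℝ) : ∫ x, q z * (x - k z) ∂(gaussKernel k hkm v z) = 0 := by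
      rw [integral_const_mul, gaussKernel_apply, integral_sub (f := fun x => x)
        ((memLp_id_gaussianReal (μ := k z) (v := v) 1).integrable le_rfl) (integrable_const _)]
      simp
    simp [h]
  -- the Donsker–Varadhan bound, for the test function linear in the innovation
  set f : (E × ℝ) × ℝ → ℝ := fun z => r (z.1.1, z.1.2 + z.2)
        * (z.1.2 - (m z.1.1 + (p + n : ℝ≥0) / ((p + n : ℝ≥0) + τ) * (z.1.2 + z.2 - m z.1.1)))
        - r (z.1.1, z.1.2 + z.2) ^ 2 * τ / 2 with hf
  have hfm : Measurable f := by fun_prop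
  have hfT : (fun z : ((E × ℝ) × ℝ) × ℝ => f ((z.1.1.1, z.1.1.2 + z.2), z.1.2 - z.2))
      = fun z => (τ / (n + τ) ^ 2 * ((z.1.1.2 - m' z.1) * q z.1)
        + 1 / (n + τ) * (q z.1 * (z.2 - k z.1))) - τ / (2 * (n + τ) ^ 2) * q z.1 ^ 2 := by
    funext z
    simp only [hf, hr, hq, hm', hk, hβ]
    push_cast
    rw [show z.1.1.2 + z.2 + (z.1.2 - z.2) = z.1.1.2 + z.1.2 by ring]
    field_simp
    ring
  have i1 : Integrable (fun z : ((E × ℝ) × ℝ) × ℝ => (z.1.1.2 - m' z.1) * q z.1) P :=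
    (up (by fun_prop) meme).integrable_mul (up hqm memq)
  have i2 : Integrable (fun z : ((E × ℝ) × ℝ) × ℝ => q z.1 ^ 2) P :=
    (up hqm memq).integrable_sq
  have ifT : Integrable
      (fun z : ((E × ℝ) × ℝ) × ℝ => f ((z.1.1.1, z.1.1.2 + z.2), z.1.2 - z.2)) P := by
    rw [hfT]
    exact ((i1.const_mul _).add (iqe.const_mul _)).sub (i2.const_mul _)
  have hintf : ∫ z, f z ∂(P.map fun z => ((z.1.1.1, z.1.1.2 + z.2), z.1.2 - z.2))
      = τ / (2 * (n + τ) ^ 2) * (2 * ∫ z, (z.1.2 - m' z) * q z ∂M - ∫ z, q z ^ 2 ∂M) := by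
    rw [integral_map hm2.aemeasurable hfm.aestronglyMeasurable, hfT,
      integral_sub (f := fun z : ((E × ℝ) × ℝ) × ℝ => τ / (n + τ) ^ 2 * ((z.1.1.2 - m' z.1) * q z.1)
        + 1 / (n + τ) * (q z.1 * (z.2 - k z.1)))
      ((i1.const_mul _).add (iqe.const_mul _)) (i2.const_mul _),
      integral_add (i1.const_mul _) (iqe.const_mul _), integral_const_mul, integral_const_mul,
      integral_const_mul, iqe0, upi (f := fun z => q z ^ 2) (by fun_prop),
      upi (f := fun z => (z.1.2 - m' z) * q z) (by fun_prop)]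
    field_simp
    ring
  have hDV := ofReal_integral_le_klDiv
    (P.map fun z => ((z.1.1.1, z.1.1.2 + z.2), z.1.2 - z.2))
    ((ρ.map Prod.fst ⊗ₘ gaussKernel m hm (p + n)).prod (gaussianReal 0 τ))
    ((integrable_map_measure hfm.aestronglyMeasurable hm2.aemeasurable).2 ifT) hfm
    (lintegral_exp_mul_innovation_le_one (ρ.map Prod.fst) hm (by positivity) hτ hrm)
  rw [hintf, map_compProd_gaussKernel_noise ρ hn hτ,
    ← Measure.compProd_const (μ := ρ.map Prod.fst ⊗ₘ gaussKernel m hm (p + n)),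
    ← Measure.compProd_const (μ := (ρ.prod (gaussianReal 0 n)).map _), klDiv_compProd_left] at hDV
  -- expand the square
  have hX : ∀ z : (E × ℝ) × ℝ, (z.1.2 - g (z.1.1, z.1.2 + z.2)) ^ 2
      = (z.1.2 - m' z) ^ 2 - 2 * ((z.1.2 - m' z) * q z) + q z ^ 2 := by
    intro z; simp only [hq]; ring
  have j1 : Integrable (fun z : (E × ℝ) × ℝ => (z.1.2 - m' z) * q z) M := meme.integrable_mul memq
  have j2 : Integrable (fun z => q z ^ 2) M := memq.integrable_sq
  have j3 : Integrable (fun z : (E × ℝ) × ℝ => (z.1.2 - m' z) ^ 2) M := meme.integrable_sq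
  rw [← ofReal_integral_eq_lintegral_ofReal (by
    simp_rw [hX]; exact (j3.sub (j1.const_mul _)).add j2) (ae_of_all _ fun z => sq_nonneg _)]
  simp_rw [hX]
  rw [integral_add (f := fun z : (E × ℝ) × ℝ => (z.1.2 - m' z) ^ 2 - 2 * ((z.1.2 - m' z) * q z))
    (j3.sub (j1.const_mul _)) j2, integral_sub j3 (j1.const_mul _), integral_const_mul, ie]
  set a := ∫ z, (z.1.2 - m' z) * q z ∂M
  set b := ∫ z, q z ^ 2 ∂M
  refine le_trans ?_ (add_le_add_right (mul_le_mul_right hDV _) _)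
  rw [← ENNReal.ofReal_mul (by positivity), ← ENNReal.ofReal_coe_nnreal]
  refine le_trans (ENNReal.ofReal_le_ofReal ?_) ENNReal.ofReal_add_le
  push_cast
  field_simp
  ring_nf
  exact le_rfl

/-- The centred Gaussian density of variance `n` is at most a multiple of that of variance
`n + τ`, with a factor that tends to `1` with `τ → 0`. -/
theorem mul_lintegral_gaussianReal_le {n τ : ℝ≥0} (hn : n ≠ 0) {h : ℝ → ℝ≥0∞}
    (hh : Measurable h) :
    ENNReal.ofReal (n / (n + τ)) * ∫⁻ x, h x ∂(gaussianReal 0 n)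
      ≤ ∫⁻ x, h x ∂(gaussianReal 0 (n + τ)) := by
  have hnτ : n + τ ≠ 0 := by positivity
  have hn' : (0 : ℝ) < n := by positivity
  rw [gaussianReal_of_var_ne_zero _ hn, gaussianReal_of_var_ne_zero _ hnτ,
    lintegral_withDensity_eq_lintegral_mul _ (measurable_gaussianPDF _ _) hh,
    lintegral_withDensity_eq_lintegral_mul _ (measurable_gaussianPDF _ _) hh,
    ← lintegral_const_mul _ ((measurable_gaussianPDF _ _).mul hh)]
  refine lintegral_mono fun x => ?_
  simp only [Pi.mul_apply]
  rw [← mul_assoc]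
  refine mul_le_mul_left ?_ _
  rw [gaussianPDF, gaussianPDF, ← ENNReal.ofReal_mul (by positivity)]
  refine ENNReal.ofReal_le_ofReal ?_
  unfold gaussianPDFReal
  rw [← mul_assoc]
  refine mul_le_mul ?_ ?_ (Real.exp_pos _).le (by positivity)
  · have h1 : (n / (n + τ) : ℝ) ≤ √(n / (n + τ) : ℝ) := by
      refine Real.le_sqrt_of_sq_le ?_
      have : (n / (n + τ) : ℝ) ≤ 1 := by
        rw [div_le_one (by positivity)]; linarith [τ.coe_nonneg]
      have h0 : (0 : ℝ) ≤ n / (n + τ) := by positivity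
      nlinarith
    refine (mul_le_mul_of_nonneg_right h1 (by positivity)).trans (le_of_eq ?_)
    push_cast
    have q₁ : √(n : ℝ) ≠ 0 := by positivity
    rw [Real.sqrt_div hn'.le, Real.sqrt_mul (by positivity) (n : ℝ),
      Real.sqrt_mul (by positivity) (n + τ : ℝ), mul_inv, mul_inv]
    field_simp
  · refine Real.exp_le_exp.2 ?_
    rw [neg_div, neg_div, neg_le_neg_iff]
    push_cast
    gcongr
    linarith [τ.coe_nonneg]

/-- Clipping the estimate to the interval of radius `B` around the noisy observation hurts only if
the noise exceeds `B`. -/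
theorem sq_sub_clip_le (x ν a B : ℝ) (hB : 0 < B) :
    (x - max (x + ν - B) (min a (x + ν + B))) ^ 2 ≤ (x - a) ^ 2 + 4 * ν ^ 4 / B ^ 2 := by
  rcases le_or_gt |ν| B with h | h
  · refine le_add_of_le_of_nonneg (sq_le_sq.2 ?_) (by positivity)
    obtain ⟨h1, h2⟩ := abs_le.1 h
    rcases le_total a (x + ν + B) with h3 | h3
    · rw [min_eq_left h3]
      rcases le_total a (x + ν - B) with h4 | h4
      · rw [max_eq_left h4, abs_of_nonneg (by linarith), abs_of_nonneg (by linarith)]; linarith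
      · rw [max_eq_right h4]
    · rw [min_eq_right h3, max_eq_right (by linarith), abs_of_nonpos (by linarith),
        abs_of_nonpos (by linarith)]
      linarith
  · have h1 : |x - max (x + ν - B) (min a (x + ν + B))| ≤ 2 * |ν| := by
      have e1 : x + ν - B ≤ max (x + ν - B) (min a (x + ν + B)) := le_max_left _ _
      have e2 : max (x + ν - B) (min a (x + ν + B)) ≤ x + ν + B :=
        max_le (by linarith) (min_le_right _ _)
      rw [abs_le]
      constructor <;> cases abs_cases ν <;> linarith
    have h2 : (x - max (x + ν - B) (min a (x + ν + B))) ^ 2 ≤ 4 * ν ^ 2 := by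
      rw [← sq_abs, ← sq_abs ν]
      nlinarith [abs_nonneg (x - max (x + ν - B) (min a (x + ν + B))), abs_nonneg ν]
    have h3 : B ^ 2 ≤ ν ^ 2 := by
      rw [← sq_abs ν]; exact pow_le_pow_left₀ hB.le h.le 2
    have h4 : 4 * ν ^ 2 ≤ 4 * ν ^ 4 / B ^ 2 := by
      rw [le_div_iff₀ (by positivity)]
      nlinarith [sq_nonneg ν]
    linarith [sq_nonneg (x - a)]

theorem sq_sub_clip_le_sq_add_sq (x ν a : ℝ) {B : ℝ} (hB : 0 ≤ B) :
    (x - max (x + ν - B) (min a (x + ν + B))) ^ 2 ≤ 2 * ν ^ 2 + 2 * B ^ 2 := by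
  have e1 : x + ν - B ≤ max (x + ν - B) (min a (x + ν + B)) := le_max_left _ _
  have e2 : max (x + ν - B) (min a (x + ν + B)) ≤ x + ν + B :=
    max_le (by linarith) (min_le_right _ _)
  set c := max (x + ν - B) (min a (x + ν + B))
  have h : (x + ν - c) ^ 2 ≤ B ^ 2 := sq_le_sq' (by linarith) (by linarith)
  nlinarith [sq_nonneg (x + ν - c + ν)]

/-- For errors bounded by a quadratic function of the noise, a small increase `τ` of the noise
variance increases the mean error by little. -/
theorem lintegral_le_lintegral_add_of_le_sq (ρ : Measure (E × ℝ)) [IsProbabilityMeasure ρ]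
    {n τ : ℝ≥0} (hn : n ≠ 0) {φ : (E × ℝ) × ℝ → ℝ} (hφ : Measurable φ) (h0 : ∀ z, 0 ≤ φ z) {B : ℝ}
    (hB : ∀ z, φ z ≤ 2 * z.2 ^ 2 + 2 * B ^ 2) :
    ∫⁻ z, ENNReal.ofReal (φ z) ∂(ρ.prod (gaussianReal 0 (n + τ)))
      ≤ ∫⁻ z, ENNReal.ofReal (φ z) ∂(ρ.prod (gaussianReal 0 n))
        + ENNReal.ofReal (τ * (4 + 2 * B ^ 2 / n)) := by
  have hn' : (0 : ℝ) < n := by positivity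
  set h : (E × ℝ) × ℝ → ℝ := fun z => 2 * z.2 ^ 2 + 2 * B ^ 2 - φ z with hh
  have hhm : Measurable h := by fun_prop
  have tot (a : ℝ≥0) : ∫⁻ z, ENNReal.ofReal (φ z) ∂(ρ.prod (gaussianReal 0 a))
      + ∫⁻ z, ENNReal.ofReal (h z) ∂(ρ.prod (gaussianReal 0 a))
        = ENNReal.ofReal (2 * a + 2 * B ^ 2) := by
    rw [← lintegral_add_left (by fun_prop)]
    have h1 (z : (E × ℝ) × ℝ) : ENNReal.ofReal (φ z) + ENNReal.ofReal (h z)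
        = 2 * ENNReal.ofReal ((0 - 1 * z.2) ^ 2) + ENNReal.ofReal (2 * B ^ 2) := by
      rw [← ENNReal.ofReal_add (h0 z) (sub_nonneg.2 (hB z)), ← ENNReal.ofReal_ofNat,
        ← ENNReal.ofReal_mul (by positivity), ← ENNReal.ofReal_add (by positivity) (by positivity)]
      congr 1; ring
    rw [lintegral_congr h1, lintegral_add_right _ measurable_const,
      lintegral_const_mul _ (by fun_prop), lintegral_prod _ (by fun_prop)]
    dsimp only
    have h2 := lintegral_sq_gaussianReal 0 a 0 1
    rw [h2]
    simp only [lintegral_const, measure_univ, mul_one]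
    rw [← ENNReal.ofReal_ofNat, ← ENNReal.ofReal_mul (by positivity),
      ← ENNReal.ofReal_add (by positivity) (by positivity)]
    congr 1; ring
  have hle : ENNReal.ofReal (n / (n + τ)) * ∫⁻ z, ENNReal.ofReal (h z) ∂(ρ.prod (gaussianReal 0 n))
      ≤ ∫⁻ z, ENNReal.ofReal (h z) ∂(ρ.prod (gaussianReal 0 (n + τ))) := by
    rw [lintegral_prod _ (by fun_prop), lintegral_prod _ (by fun_prop),
      ← lintegral_const_mul _ hhm.ennreal_ofReal.lintegral_prod_right']
    exact lintegral_mono fun z => mul_lintegral_gaussianReal_le hn (by fun_prop)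
  have t1 := tot (n + τ)
  have t0 := tot n
  set a := ∫⁻ z, ENNReal.ofReal (φ z) ∂(ρ.prod (gaussianReal 0 (n + τ)))
  set b := ∫⁻ z, ENNReal.ofReal (φ z) ∂(ρ.prod (gaussianReal 0 n))
  set θ := ENNReal.ofReal (n / (n + τ)) with hθ
  have hθ1 : θ ≤ 1 := by
    rw [hθ, ENNReal.ofReal_le_one, div_le_one (by positivity)]; linarith [τ.coe_nonneg]
  have key : a + θ * ENNReal.ofReal (2 * n + 2 * B ^ 2)
      ≤ b + ENNReal.ofReal (τ * (4 + 2 * B ^ 2 / n)) + θ * ENNReal.ofReal (2 * n + 2 * B ^ 2) := by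
    calc a + θ * ENNReal.ofReal (2 * n + 2 * B ^ 2)
        = a + θ * ∫⁻ z, ENNReal.ofReal (h z) ∂(ρ.prod (gaussianReal 0 n)) + θ * b := by
          rw [← t0]; ring
      _ ≤ ENNReal.ofReal (2 * (n + τ : ℝ≥0) + 2 * B ^ 2) + 1 * b := by
          rw [← t1]; gcongr
      _ ≤ (ENNReal.ofReal (τ * (4 + 2 * B ^ 2 / n)) + θ * ENNReal.ofReal (2 * n + 2 * B ^ 2))
          + 1 * b := by
          refine add_le_add_left ?_ _
          rw [hθ, ← ENNReal.ofReal_mul (by positivity),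
            ← ENNReal.ofReal_add (by positivity) (by positivity)]
          refine ENNReal.ofReal_le_ofReal ?_
          have hτ := τ.coe_nonneg
          have h1 : (1 - τ / n : ℝ) ≤ n / (n + τ) := by
            rw [le_div_iff₀ (by positivity)]
            field_simp
            nlinarith
          have h2 := mul_le_mul_of_nonneg_right h1 (by positivity : 0 ≤ 2 * (n : ℝ) + 2 * B ^ 2)
          have h3 : (1 - τ / n : ℝ) * (2 * n + 2 * B ^ 2)
              = 2 * n + 2 * B ^ 2 - τ * (2 + 2 * B ^ 2 / n) := by
            field_simp
          push_cast
          linarith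
      _ = _ := by rw [one_mul]; ring
  exact (ENNReal.add_le_add_iff_right (ENNReal.mul_ne_top
    (hθ1.trans_lt ENNReal.one_lt_top).ne ENNReal.ofReal_ne_top)).1 key

theorem mul_div_add_le_mul_div_add (p n τ : ℝ≥0) (hn : n ≠ 0) :
    p * n / (p + n) ≤ p * (n + τ) / (p + (n + τ)) := by
  have hn' : 0 < n := pos_iff_ne_zero.2 hn
  rw [div_le_div_iff₀ (by positivity) (by positivity), ← NNReal.coe_le_coe]
  push_cast
  have := mul_nonneg (mul_nonneg p.coe_nonneg p.coe_nonneg) τ.coe_nonneg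
  nlinarith

/-- Stability of the Gaussian estimation error: the error of any estimator that uses the side
information `x + ν` and a variable `u` independent of the noise `ν` is almost at least the
Gaussian one when the divergence of the side information from its Gaussian approximation is
small, uniformly in the variance `p` of the source. -/
theorem exists_forall_filtVar_le {n ε : ℝ≥0} (hn : n ≠ 0) (hε : 0 < ε) :
    ∃ c : ℝ≥0, ∀ (E : Type) [MeasurableSpace E] (ρ : Measure (E × ℝ)) [IsProbabilityMeasure ρ]
      (m : E → ℝ) (hm : Measurable m) (p : ℝ≥0) (g : E × ℝ → ℝ), p ≠ 0 →
      ∫⁻ q, ENNReal.ofReal ((q.2 - m q.1) ^ 2) ∂ρ = p → Measurable g →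
      ((p * n / (p + n) : ℝ≥0) : ℝ≥0∞)
        ≤ ∫⁻ q, ENNReal.ofReal ((q.1.2 - g (q.1.1, q.1.2 + q.2)) ^ 2)
            ∂(ρ.prod (gaussianReal 0 n)) + ε
          + c * klDiv ((ρ.prod (gaussianReal 0 n)).map fun q => (q.1.1, q.1.2 + q.2))
            (ρ.map Prod.fst ⊗ₘ gaussKernel m hm (p + n)) := by
  have hn' : (0 : ℝ) < n := by positivity
  have hε' : (0 : ℝ) < ε := hε
  set M4 : ℝ := ∫ x, x ^ 4 ∂(gaussianReal 0 n) with hM4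
  have hM4i : Integrable (fun x : ℝ => x ^ 4) (gaussianReal 0 n) := by
    have := (memLp_id_gaussianReal (μ := 0) (v := n) 4).integrable_norm_pow (by norm_num)
    refine this.congr (ae_of_all _ fun x => ?_)
    simp only [id, Real.norm_eq_abs]
    exact Even.pow_abs (by decide) x
  have hM40 : 0 ≤ M4 := integral_nonneg fun x => by positivity
  -- the clipping radius `B` and the additional noise variance `τ` cost at most `ε / 2` each
  set B : ℝ := 1 + 8 * M4 / ε with hB
  have hB1 : 1 ≤ B := by rw [hB]; linarith [show 0 ≤ 8 * M4 / ε by positivity]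
  have hBM : 4 * M4 / B ^ 2 ≤ ε / 2 := by
    rw [div_le_iff₀ (by positivity)]
    have h1 : ε * B = ε + 8 * M4 := by rw [hB]; field_simp
    have h2 : B ≤ B ^ 2 := by nlinarith
    nlinarith
  set t : ℝ := ε / 2 / (4 + 2 * B ^ 2 / n) with ht
  have htpos : 0 < t := by positivity
  set τ : ℝ≥0 := ⟨t, htpos.le⟩ with hτ
  have hτc : (τ : ℝ) = t := rfl
  have hτ0 : τ ≠ 0 := by
    intro h; rw [← NNReal.coe_inj, hτc] at h; exact htpos.ne' h
  have hτB : (τ : ℝ) * (4 + 2 * B ^ 2 / n) = ε / 2 := by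
    rw [hτc, ht]; field_simp
  refine ⟨(2 * ((n + τ) ^ 2 / τ) : ℝ).toNNReal, fun E _ ρ _ m hm p g hp hpm hg => ?_⟩
  set gB : E × ℝ → ℝ := fun z => max (z.2 - B) (min (g z) (z.2 + B)) with hgB
  have hgBm : Measurable gB := by fun_prop
  have h1 := filtVar_le_lintegral_sq_add_klDiv ρ hm hp hn hτ0 hpm hgBm (B := B) fun u y => by
    have e1 : y - B ≤ gB (u, y) := le_max_left _ _
    have e2 : gB (u, y) ≤ y + B := max_le (by linarith) (min_le_right _ _)
    rw [abs_le]; constructor <;> linarith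
  have h2 := lintegral_le_lintegral_add_of_le_sq ρ (τ := τ) hn
    (φ := fun q => (q.1.2 - gB (q.1.1, q.1.2 + q.2)) ^ 2) (by fun_prop)
    (fun z => sq_nonneg _) (B := B)
    fun z => sq_sub_clip_le_sq_add_sq z.1.2 z.2 (g (z.1.1, z.1.2 + z.2)) (by linarith)
  rw [hτB] at h2
  have h3 : ∫⁻ q, ENNReal.ofReal ((q.1.2 - gB (q.1.1, q.1.2 + q.2)) ^ 2)
        ∂(ρ.prod (gaussianReal 0 n))
      ≤ ∫⁻ q, ENNReal.ofReal ((q.1.2 - g (q.1.1, q.1.2 + q.2)) ^ 2)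
        ∂(ρ.prod (gaussianReal 0 n)) + ENNReal.ofReal (ε / 2) := by
    calc _ ≤ ∫⁻ q, (ENNReal.ofReal ((q.1.2 - g (q.1.1, q.1.2 + q.2)) ^ 2)
          + ENNReal.ofReal (4 * q.2 ^ 4 / B ^ 2)) ∂(ρ.prod (gaussianReal 0 n)) := by
          refine lintegral_mono fun q => ?_
          rw [← ENNReal.ofReal_add (by positivity) (by positivity)]
          exact ENNReal.ofReal_le_ofReal (sq_sub_clip_le _ _ _ _ (by linarith))
      _ = ∫⁻ q, ENNReal.ofReal ((q.1.2 - g (q.1.1, q.1.2 + q.2)) ^ 2)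
          ∂(ρ.prod (gaussianReal 0 n)) + ENNReal.ofReal (4 * M4 / B ^ 2) := by
          rw [lintegral_add_left (by fun_prop)]
          congr 1
          rw [lintegral_prod _ (by fun_prop)]
          simp only [lintegral_const, measure_univ, mul_one]
          rw [← ofReal_integral_eq_lintegral_ofReal ((hM4i.const_mul 4).div_const _)
            (ae_of_all _ fun x => by positivity), integral_div, integral_const_mul]
      _ ≤ _ := by gcongr
  have hεε : (ε : ℝ≥0∞) = ENNReal.ofReal (ε / 2) + ENNReal.ofReal (ε / 2) := by
    rw [← ENNReal.ofReal_add (by positivity) (by positivity), add_halves,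
      ENNReal.ofReal_coe_nnreal]
  calc ((p * n / (p + n) : ℝ≥0) : ℝ≥0∞) ≤ (p * (n + τ) / (p + (n + τ)) : ℝ≥0) :=
        ENNReal.coe_le_coe.2 (mul_div_add_le_mul_div_add p n τ hn)
    _ ≤ _ := h1
    _ ≤ _ := by
        rw [hεε, ← add_assoc]
        exact add_le_add_left (h2.trans (add_le_add_left h3 _)) _

end Gap

/-! ### The joint law of source, side information and transmitted samples -/

section JointLaw

/-- The extension of a finite history to an infinite sequence by a default value. -/
def extendHist {S : Type*} [Inhabited S] {t : ℕ} (h : Fin t → S) : ℕ → S :=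
  fun i => if hi : i < t then h ⟨i, hi⟩ else default

theorem measurable_extendHist {S : Type*} [Inhabited S] [MeasurableSpace S] (t : ℕ) :
    Measurable (extendHist : (Fin t → S) → ℕ → S) := by
  refine measurable_pi_lambda _ fun i => ?_
  unfold extendHist
  by_cases hi : i < t
  · simpa [hi] using measurable_pi_apply _
  · simp [hi]

theorem extendHist_apply {S : Type*} [Inhabited S] {t : ℕ} (s : ℕ → S) {i : ℕ} (hi : i < t) :
    extendHist (hist s t) i = s i := by
  simp [extendHist, hist, hi]

theorem hist_congr {S : Type*} {s s' : ℕ → S} {t : ℕ} (h : ∀ i < t, s i = s' i) :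
    hist s t = hist s' t :=
  funext fun i => h i i.isLt

/-- The first `T` transmitted samples depend on the first `T` source samples only. -/
theorem CausalKernel.law_congr {S W : Type*} [MeasurableSpace S] [MeasurableSpace W]
    (κ : CausalKernel S W) {T : ℕ} {s s' : ℕ → S} (h : ∀ i < T, s i = s' i) :
    κ.law T s = κ.law T s' := by
  induction T with
  | zero => rfl
  | succ T ih =>
    have := κ.markov T
    have h1 := ih fun i hi => h i (hi.trans (Nat.lt_succ_self T))
    have h2 := hist_congr h
    unfold CausalKernel.law
    rw [Kernel.map_apply _ (measurable_snoc T), Kernel.map_apply _ (measurable_snoc T),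
      Kernel.compProd_apply_eq_compProd_sectR, Kernel.compProd_apply_eq_compProd_sectR, h1]
    congr 2
    ext1 w
    simp [Kernel.sectR_apply, Kernel.comap_apply, h2]

/-- The innovations of the source and of the side information at time `t`. -/
def innov (lam : ℝ) (s : ℕ → ℝ × ℝ) (t : ℕ) : ℝ × ℝ :=
  ((s t).1 - lam * (if t = 0 then 0 else (s (t - 1)).1), (s t).2 - (s t).1)

theorem measurable_innov (lam : ℝ) (t : ℕ) : Measurable fun s => innov lam s t := by
  unfold innov
  split_ifs <;> fun_prop

theorem innov_sourceMap (lam : ℝ) (e : ℕ → ℝ × ℝ) (t : ℕ) :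
    innov lam (sourceMap lam e) t = e t := by
  cases t with
  | zero => simp [innov, sourceMap, gaussMarkov]
  | succ t => simp [innov, sourceMap, gaussMarkov]

theorem gaussMarkov_congr (lam : ℝ) {v v' : ℕ → ℝ} {t : ℕ} (h : ∀ i ≤ t, v i = v' i) :
    gaussMarkov lam v t = gaussMarkov lam v' t := by
  induction t with
  | zero => exact h 0 le_rfl
  | succ t ih =>
    simp only [gaussMarkov]
    rw [ih fun i hi => h i (hi.trans (Nat.le_succ t)), h _ le_rfl]

theorem hist_sourceMap_congr (lam : ℝ) {e e' : ℕ → ℝ × ℝ} {t : ℕ} (h : ∀ i < t, e i = e' i) :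
    hist (sourceMap lam e) t = hist (sourceMap lam e') t := by
  refine hist_congr fun i hi => ?_
  simp only [sourceMap]
  rw [gaussMarkov_congr lam (v' := fun i => (e' i).1)
    (fun j hj => by rw [h j (hj.trans_lt hi)]), h i hi]

variable (lam : ℝ) (varV varN : ℝ≥0)

/-- The innovations at time `t` are independent of the source and side information before `t`. -/
theorem map_hist_innov_sourceLaw (t : ℕ) :
    (sourceLaw lam varV varN).map (fun s => (hist s t, innov lam s t))
      = ((sourceLaw lam varV varN).map fun s => hist s t).prod
          ((gaussianReal 0 varV).prod (gaussianReal 0 varN)) := by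
  set γ := (gaussianReal 0 varV).prod (gaussianReal 0 varN) with hγ
  have hprob : IsProbabilityMeasure (noiseLaw varV varN) := by unfold noiseLaw; infer_instance
  have hind : iIndepFun (fun (i : ℕ) (e : ℕ → ℝ × ℝ) => e i) (noiseLaw varV varN) :=
    iIndepFun_infinitePi (P := fun _ => γ) (X := fun _ x => x) fun _ => measurable_id
  have h1 := hind.indepFun_finset (Finset.range t) {t} (by simp) fun i => measurable_pi_apply i
  have h2 : IndepFun (fun e : ℕ → ℝ × ℝ => hist (sourceMap lam e) t) (fun e => e t)
      (noiseLaw varV varN) := by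
    have hψ : Measurable fun r : ({t} : Finset ℕ) → ℝ × ℝ =>
        r ⟨t, Finset.mem_singleton_self t⟩ := measurable_pi_apply _
    have := h1.comp (φ := fun r : Finset.range t → ℝ × ℝ =>
        hist (sourceMap lam (extendHist fun i : Fin t => r ⟨i, Finset.mem_range.2 i.isLt⟩)) t)
      ((measurable_hist t).comp ((measurable_sourceMap lam).comp
        ((measurable_extendHist t).comp (by fun_prop)))) hψ
    refine this.congr (ae_of_all _ fun e => ?_) (ae_of_all _ fun e => rfl)
    exact hist_sourceMap_congr lam fun i hi => extendHist_apply e hi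
  have h3 := (indepFun_iff_map_prod_eq_prod_map_map
    ((measurable_hist t).comp (measurable_sourceMap lam)).aemeasurable
    (measurable_pi_apply t).aemeasurable).1 h2
  have h4 : (noiseLaw varV varN).map (fun e => e t) = γ :=
    Measure.infinitePi_map_eval (fun _ : ℕ => γ) t
  unfold sourceLaw
  rw [Measure.map_map ((measurable_hist t).prodMk (measurable_innov lam t))
    (measurable_sourceMap lam), Measure.map_map (measurable_hist t) (measurable_sourceMap lam),
    ← h4]
  refine Eq.trans ?_ h3
  congr 1
  funext e
  simp only [Function.comp, innov_sourceMap]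

variable {W : Type*} [MeasurableSpace W] (κ : CausalKernel (ℝ × ℝ) W)

theorem measurable_histStep (t : ℕ) : Measurable
    (fun p : (ℕ → ℝ × ℝ) × (Fin t → W) => (hist p.1 (t + 1), p.2)) :=
  ((measurable_hist (t + 1)).comp measurable_fst).prodMk measurable_snd

theorem measurable_histFin {T k : ℕ} (hk : k ≤ T) :
    Measurable fun w : Fin T → W => histFin w hk :=
  measurable_pi_lambda _ fun _ => measurable_pi_apply _

/-- The law up to time `t + 1` is obtained from the law up to time `t` by drawing one more
sample. -/
theorem jointBoth_succ (t : ℕ) : jointBoth lam varV varN κ (t + 1)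
    = ((jointBoth lam varV varN κ t) ⊗ₘ ((κ.step t).comap _ (measurable_histStep t))).map
        fun p => (p.1.1, (Fin.snoc p.1.2 p.2 : Fin (t + 1) → W)) := by
  have := κ.markov t
  have hm : Measurable fun p : ((ℕ → ℝ × ℝ) × (Fin t → W)) × W =>
      (p.1.1, (Fin.snoc p.1.2 p.2 : Fin (t + 1) → W)) :=
    (measurable_fst.comp measurable_fst).prodMk ((measurable_snoc t).comp
      ((measurable_snd.comp measurable_fst).prodMk measurable_snd))
  refine Measure.ext_of_lintegral _ fun f hf => ?_
  have hfm : Measurable fun p : ((ℕ → ℝ × ℝ) × (Fin t → W)) × W =>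
      f (p.1.1, (Fin.snoc p.1.2 p.2 : Fin (t + 1) → W)) := hf.comp hm
  rw [lintegral_map hf hm, Measure.lintegral_compProd hfm]
  unfold jointBoth
  rw [Measure.lintegral_compProd hf, Measure.lintegral_compProd]
  swap
  · exact hfm.lintegral_kernel_prod_right'
  refine lintegral_congr fun s => ?_
  have hfs : Measurable fun w => f (s, w) := hf.comp (by fun_prop)
  have hfss : Measurable fun q : (Fin t → W) × W =>
      f (s, (Fin.snoc q.1 q.2 : Fin (t + 1) → W)) := hfs.comp (measurable_snoc t)
  rw [CausalKernel.law, Kernel.lintegral_map _ (measurable_snoc t) _ hfs,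
    Kernel.lintegral_compProd _ _ _ hfss]

theorem map_histFin_jointBoth {k T : ℕ} (hk : k ≤ T) :
    (jointBoth lam varV varN κ T).map (fun ω => (ω.1, histFin ω.2 hk))
      = jointBoth lam varV varN κ k := by
  induction T, hk using Nat.le_induction with
  | base =>
    have h : (fun ω : (ℕ → ℝ × ℝ) × (Fin k → W) => (ω.1, histFin ω.2 le_rfl)) = id := rfl
    rw [h, Measure.map_id]
  | succ T hk ih =>
    have := κ.markov T
    have hm : Measurable fun p : ((ℕ → ℝ × ℝ) × (Fin T → W)) × W =>
        (p.1.1, (Fin.snoc p.1.2 p.2 : Fin (T + 1) → W)) :=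
      (measurable_fst.comp measurable_fst).prodMk ((measurable_snoc T).comp
        ((measurable_snd.comp measurable_fst).prodMk measurable_snd))
    have hm2 : Measurable fun ω : (ℕ → ℝ × ℝ) × (Fin (T + 1) → W) =>
        (ω.1, histFin ω.2 (hk.trans (Nat.le_succ T))) :=
      measurable_fst.prodMk ((measurable_histFin _).comp measurable_snd)
    have h : (fun ω : (ℕ → ℝ × ℝ) × (Fin (T + 1) → W) =>
          (ω.1, histFin ω.2 (hk.trans (Nat.le_succ T))))
          ∘ (fun p : ((ℕ → ℝ × ℝ) × (Fin T → W)) × W =>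
            (p.1.1, (Fin.snoc p.1.2 p.2 : Fin (T + 1) → W)))
        = (fun ω : (ℕ → ℝ × ℝ) × (Fin T → W) => (ω.1, histFin ω.2 hk)) ∘ Prod.fst := by
      funext p
      refine Prod.ext rfl (funext fun i => ?_)
      exact Fin.snoc_castSucc (α := fun _ => W) p.2 p.1.2 (Fin.castLE hk i)
    have hm3 : Measurable fun ω : (ℕ → ℝ × ℝ) × (Fin T → W) => (ω.1, histFin ω.2 hk) :=
      measurable_fst.prodMk ((measurable_histFin _).comp measurable_snd)
    rw [jointBoth_succ, Measure.map_map hm2 hm, h, ← Measure.map_map hm3 measurable_fst,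
      ← Measure.fst, Measure.fst_compProd, ih]

/-- The next sample is drawn by the kernel at time `t`. -/
theorem map_step_jointBoth {t T : ℕ} (ht : t < T) :
    (jointBoth lam varV varN κ T).map (fun ω => ((ω.1, histFin ω.2 ht.le), ω.2 ⟨t, ht⟩))
      = (jointBoth lam varV varN κ T).map (fun ω => (ω.1, histFin ω.2 ht.le))
        ⊗ₘ (κ.step t).comap _ (measurable_histStep t) := by
  have := κ.markov t
  have hm : Measurable fun p : ((ℕ → ℝ × ℝ) × (Fin t → W)) × W =>
      (p.1.1, (Fin.snoc p.1.2 p.2 : Fin (t + 1) → W)) :=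
    (measurable_fst.comp measurable_fst).prodMk ((measurable_snoc t).comp
      ((measurable_snd.comp measurable_fst).prodMk measurable_snd))
  have hm2 : Measurable fun ω : (ℕ → ℝ × ℝ) × (Fin (t + 1) → W) =>
      ((ω.1, (fun i => ω.2 i.castSucc : Fin t → W)), ω.2 (Fin.last t)) := by fun_prop
  have h1 : (fun ω : (ℕ → ℝ × ℝ) × (Fin T → W) => ((ω.1, histFin ω.2 ht.le), ω.2 ⟨t, ht⟩))
      = (fun ω : (ℕ → ℝ × ℝ) × (Fin (t + 1) → W) =>
        ((ω.1, (fun i => ω.2 i.castSucc : Fin t → W)), ω.2 (Fin.last t)))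
        ∘ fun ω => (ω.1, histFin ω.2 ht) := rfl
  have hm3 : Measurable fun ω : (ℕ → ℝ × ℝ) × (Fin T → W) =>
      (ω.1, histFin ω.2 (Nat.succ_le_of_lt ht)) :=
    measurable_fst.prodMk ((measurable_histFin _).comp measurable_snd)
  rw [map_histFin_jointBoth, h1, ← Measure.map_map hm2 hm3,
    map_histFin_jointBoth lam varV varN κ (Nat.succ_le_of_lt ht), jointBoth_succ,
    Measure.map_map hm2 hm]
  have h2 : (fun ω : (ℕ → ℝ × ℝ) × (Fin (t + 1) → W) =>
        ((ω.1, (fun i => ω.2 i.castSucc : Fin t → W)), ω.2 (Fin.last t)))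
      ∘ (fun p : ((ℕ → ℝ × ℝ) × (Fin t → W)) × W =>
        (p.1.1, (Fin.snoc p.1.2 p.2 : Fin (t + 1) → W))) = id := by
    funext p
    simp
  rw [h2, Measure.map_id]

/-- The innovations at time `t` are independent of the past, transmitted samples included. -/
theorem map_innov_jointBoth {t T : ℕ} (ht : t ≤ T) :
    (jointBoth lam varV varN κ T).map
        (fun ω => ((hist ω.1 t, histFin ω.2 ht), innov lam ω.1 t))
      = ((jointBoth lam varV varN κ T).map fun ω => (hist ω.1 t, histFin ω.2 ht)).prod
          ((gaussianReal 0 varV).prod (gaussianReal 0 varN)) := by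
  have hm1 : Measurable fun ω : (ℕ → ℝ × ℝ) × (Fin T → W) => (ω.1, histFin ω.2 ht) :=
    measurable_fst.prodMk ((measurable_histFin _).comp measurable_snd)
  have hm2 : Measurable fun ω : (ℕ → ℝ × ℝ) × (Fin t → W) => (hist ω.1 t, ω.2) :=
    ((measurable_hist t).comp measurable_fst).prodMk measurable_snd
  have hm3 : Measurable fun ω : (ℕ → ℝ × ℝ) × (Fin t → W) =>
    ((hist ω.1 t, ω.2), innov lam ω.1 t) :=
    hm2.prodMk ((measurable_innov lam t).comp measurable_fst)
  have h1 : (fun ω : (ℕ → ℝ × ℝ) × (Fin T → W) =>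
        ((hist ω.1 t, histFin ω.2 ht), innov lam ω.1 t))
      = (fun ω : (ℕ → ℝ × ℝ) × (Fin t → W) => ((hist ω.1 t, ω.2), innov lam ω.1 t))
        ∘ fun ω => (ω.1, histFin ω.2 ht) := rfl
  have h2 : (fun ω : (ℕ → ℝ × ℝ) × (Fin T → W) => (hist ω.1 t, histFin ω.2 ht))
      = (fun ω : (ℕ → ℝ × ℝ) × (Fin t → W) => (hist ω.1 t, ω.2))
        ∘ fun ω => (ω.1, histFin ω.2 ht) := rfl
  rw [h1, h2, ← Measure.map_map hm3 hm1, ← Measure.map_map hm2 hm1, map_histFin_jointBoth]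
  have := Measure.isProbabilityMeasure_map (μ := jointBoth lam varV varN κ t) hm2.aemeasurable
  set γ := (gaussianReal 0 varV).prod (gaussianReal 0 varN)
  refine Measure.ext_of_lintegral _ fun f hf => ?_
  -- the conditional law of the transmitted samples depends on the source only through the past
  set κ' : Kernel (Fin t → ℝ × ℝ) (Fin t → W) := (κ.law t).comap _ (measurable_extendHist t)
  have hκ (s : ℕ → ℝ × ℝ) : κ.law t s = κ' (hist s t) :=
    κ.law_congr fun i hi => (extendHist_apply s hi).symm
  have hF : Measurable fun q : (Fin t → ℝ × ℝ) × ℝ × ℝ => ∫⁻ w, f ((q.1, w), q.2) ∂(κ' q.1) := by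
    have : Measurable fun z : ((Fin t → ℝ × ℝ) × ℝ × ℝ) × (Fin t → W) =>
      f ((z.1.1, z.2), z.1.2) := hf.comp (by fun_prop)
    exact this.lintegral_kernel_prod_right' (κ := κ'.comap Prod.fst measurable_fst)
  have hG : Measurable fun q : (Fin t → ℝ × ℝ) × (Fin t → W) => ∫⁻ e, f (q, e) ∂γ :=
    hf.lintegral_prod_right'
  have hl := congrArg (fun ν => ∫⁻ q, ∫⁻ w, f ((q.1, w), q.2) ∂(κ' q.1) ∂ν)
    (map_hist_innov_sourceLaw lam varV varN t)
  rw [lintegral_map hF ((measurable_hist t).prodMk (measurable_innov lam t)),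
    lintegral_prod _ hF.aemeasurable, lintegral_map hF.lintegral_prod_right'
      (measurable_hist t)] at hl
  rw [lintegral_map hf hm3, lintegral_prod _ hf.aemeasurable, lintegral_map hG hm2]
  have hf3 : Measurable fun ω : (ℕ → ℝ × ℝ) × (Fin t → W) =>
    f ((hist ω.1 t, ω.2), innov lam ω.1 t) := hf.comp hm3
  have hG2 : Measurable fun ω : (ℕ → ℝ × ℝ) × (Fin t → W) =>
    ∫⁻ e, f ((hist ω.1 t, ω.2), e) ∂γ := hG.comp hm2
  unfold jointBoth
  rw [Measure.lintegral_compProd hf3, Measure.lintegral_compProd hG2]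
  simp only [hκ]
  refine hl.trans (lintegral_congr fun s => ?_)
  have hfs : Measurable fun q : (ℝ × ℝ) × (Fin t → W) => f ((hist s t, q.2), q.1) :=
    hf.comp (by fun_prop)
  exact lintegral_lintegral_swap (μ := γ) (ν := κ' (hist s t))
    (f := fun e w => f ((hist s t, w), e)) hfs.aemeasurable

/-- A causal kernel that ignores the side information. -/
def CausalKernel.pull (κ : CausalKernel ℝ W) : CausalKernel (ℝ × ℝ) W where
  step k := (κ.step k).comap (fun p => ((fun i => (p.1 i).1 : Fin (k + 1) → ℝ), p.2))
    (by fun_prop)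
  markov k := by have := κ.markov k; infer_instance

theorem CausalKernel.law_pull (κ : CausalKernel ℝ W) (T : ℕ) (s : ℕ → ℝ × ℝ) :
    κ.pull.law T s = κ.law T (srcX s) := by
  induction T with
  | zero => rfl
  | succ T ih =>
    have := κ.markov T
    have := κ.pull.markov T
    unfold CausalKernel.law
    rw [Kernel.map_apply _ (measurable_snoc T), Kernel.map_apply _ (measurable_snoc T),
      Kernel.compProd_apply_eq_compProd_sectR, Kernel.compProd_apply_eq_compProd_sectR, ih]
    rfl

theorem jointDec_eq_jointBoth_pull (κ : CausalKernel ℝ W) (T : ℕ) :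
    jointDec lam varV varN κ T = jointBoth lam varV varN κ.pull T := by
  unfold jointDec jointBoth
  congr 1
  ext1 s
  rw [CausalKernel.law_pull]
  rfl

end JointLaw

/-! ### Information balance of one step -/

section Balance

open InformationTheory

/-- An invertible recoding of the conditioning variable does not raise the conditional mutual
information. -/
theorem condMutualInfo_comp_right_le {Ω A B E E' : Type*} [MeasurableSpace Ω]
    [MeasurableSpace A] [StandardBorelSpace A] [Nonempty A]
    [MeasurableSpace B] [StandardBorelSpace B] [Nonempty B] [MeasurableSpace E]
    [MeasurableSpace E'] {μ : Measure Ω} [IsFiniteMeasure μ] {X : Ω → A} {Y : Ω → B} {Z : Ω → E}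
    (hX : Measurable X) (hY : Measurable Y) (hZ : Measurable Z) {φ : E → E'} {ψ : E' → E}
    (hφ : Measurable φ) (hψ : Measurable ψ) (h : Function.LeftInverse ψ φ) :
    condMutualInfo μ X Y (fun ω => φ (Z ω)) ≤ condMutualInfo μ X Y Z := by
  refine (condMutualInfo_le_klDiv hX hY (hφ.comp hZ) ((condDistrib Y Z μ).comap ψ hψ)).trans ?_
  have hf : Measurable (Prod.map φ id : E × A → E' × A) := hφ.prodMap measurable_id
  refine (klDiv_comp_compProd_le (f := (Prod.map φ id : E × A → E' × A))
    (Z := fun ω => (Z ω, X ω)) μ hY (hZ.prodMk hX) hf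
    (((condDistrib Y Z μ).comap ψ hψ).prodMkRight A)).trans (le_of_eq ?_)
  have hk : (((condDistrib Y Z μ).comap ψ hψ).prodMkRight A).comap (Prod.map φ id) hf
      = (condDistrib Y Z μ).prodMkRight A := by
    ext1 p
    simp [Kernel.comap_apply, h p.1]
  rw [hk, condMutualInfo_eq_klDiv_compProd hX hY hZ]

theorem map_comp_compProd {Ω A A' B : Type*} [MeasurableSpace Ω] [MeasurableSpace A]
    [MeasurableSpace A'] [MeasurableSpace B] {μ : Measure Ω} [IsFiniteMeasure μ] {X : Ω → A}
    {Y : Ω → B} (hX : Measurable X) (hY : Measurable Y) {f : A → A'} (hf : Measurable f)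
    (κ : Kernel A' B) [IsMarkovKernel κ]
    (h : μ.map (fun ω => (X ω, Y ω)) = μ.map X ⊗ₘ κ.comap f hf) :
    μ.map (fun ω => (f (X ω), Y ω)) = μ.map (fun ω => f (X ω)) ⊗ₘ κ := by
  have h1 : (fun ω => (f (X ω), Y ω)) = Prod.map f id ∘ fun ω => (X ω, Y ω) := rfl
  have h2 : (fun ω => f (X ω)) = f ∘ X := rfl
  rw [h1, h2, ← Measure.map_map (hf.prodMap measurable_id) (hX.prodMk hY), h,
    compProd_comap_map, Measure.map_map hf hX]

/-- If `W` is drawn from `X` and a function `π H` of the past `H` alone, the information that `W`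
conveys about `X` given `π H` is at least the sum of what it conveys given the past and further
side information `Y`, and of what it conveys about `Y` given the past. -/
theorem condMutualInfo_add_le_of_map_eq {Ω A B C E E₀ : Type*} [MeasurableSpace Ω]
    [MeasurableSpace A] [StandardBorelSpace A] [Nonempty A]
    [MeasurableSpace B] [StandardBorelSpace B] [Nonempty B]
    [MeasurableSpace C] [StandardBorelSpace C] [Nonempty C]
    [MeasurableSpace E] [MeasurableSpace E₀] {μ : Measure Ω} [IsProbabilityMeasure μ]
    {X : Ω → A} {W : Ω → B} {Y : Ω → C} {H : Ω → E} (hX : Measurable X) (hW : Measurable W)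
    (hY : Measurable Y) (hH : Measurable H) {π : E → E₀} (hπ : Measurable π)
    (κ : Kernel (E₀ × A) B) [IsMarkovKernel κ]
    (h : μ.map (fun ω => (((H ω, Y ω), X ω), W ω)) = μ.map (fun ω => ((H ω, Y ω), X ω)) ⊗ₘ
      κ.comap (fun p => (π p.1.1, p.2)) (by fun_prop)) :
    condMutualInfo μ X W (fun ω => (H ω, Y ω)) + condMutualInfo μ W Y H
      ≤ condMutualInfo μ X W (fun ω => π (H ω)) := by
  set c := condDistrib W (fun ω => π (H ω)) μ with hc
  have hf : Measurable fun p : (E × C) × A => (π p.1.1, p.2) := by fun_prop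
  have hZ : Measurable fun ω => ((H ω, Y ω), X ω) := (hH.prodMk hY).prodMk hX
  have := Measure.isProbabilityMeasure_map (μ := μ) hZ.aemeasurable
  have hπH : Measurable fun ω => (π (H ω), X ω) := (hπ.comp hH).prodMk hX
  have := Measure.isProbabilityMeasure_map (μ := μ) hπH.aemeasurable
  have hproj := map_comp_compProd hZ hW hf κ h
  have key : condMutualInfo μ X W (fun ω => π (H ω))
      = klDiv (μ.map fun ω => (((H ω, Y ω), X ω), W ω))
        (μ.map (fun ω => ((H ω, Y ω), X ω)) ⊗ₘ
          ((c.comap π hπ).prodMkRight C).prodMkRight A) := by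
    rw [condMutualInfo_eq_klDiv_compProd (Z := fun ω => π (H ω)) hX hW (hπ.comp hH)]
    change klDiv (μ.map fun ω => ((π (H ω), X ω), W ω))
      (μ.map (fun ω => (π (H ω), X ω)) ⊗ₘ c.prodMkRight A) = _
    simp only at hproj
    rw [hproj, h, klDiv_compProd_right_eq_lintegral, klDiv_compProd_right_eq_lintegral]
    have h1 : μ.map (fun ω => (π (H ω), X ω))
        = (μ.map fun ω => ((H ω, Y ω), X ω)).map fun p => (π p.1.1, p.2) := by
      rw [Measure.map_map hf hZ]; rfl
    rw [h1, lintegral_map (measurable_klDiv_kernel _ _) hf]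
    rfl
  rw [key, klDiv_compProd_prodMkRight_eq_add hX hW (hH.prodMk hY)
    ((c.comap π hπ).prodMkRight C)]
  refine add_le_add_right ?_ _
  rw [condMutualInfo_comm hW hY hH]
  exact condMutualInfo_le_klDiv hY hW hH _

variable (lam : ℝ) {v n d d' : ℝ≥0} {Ω E E' : Type*} [MeasurableSpace Ω] [MeasurableSpace E]
  [MeasurableSpace E'] {μ : Measure Ω} [IsProbabilityMeasure μ] {H : Ω → E} {X V N W : Ω → ℝ}
  {xh : E → ℝ} {xh' : E' → ℝ}

/-- The balance of divergences over one step: the divergence of the posterior law from its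
Gaussian approximation, the rate spent on reducing the error variance from the filtered one to
`d'`, and the divergence of the side information from its Gaussian prediction are paid by the
information conveyed and by the previous divergence. -/
theorem klDiv_posterior_step_le (hv : 0 < v) (hn : 0 < n) (hH : Measurable H) (hX : Measurable X)
    (hV : Measurable V) (hN : Measurable N) (hW : Measurable W) (hxh : Measurable xh)
    (hxh' : Measurable xh') (hlaw : IsNoiseStep μ H X V N v n)
    (hd : ∫⁻ ω, ENNReal.ofReal ((X ω - xh (H ω)) ^ 2) ∂μ = d)
    {f : (E × ℝ) × ℝ → E'} (hf : Measurable f) (hd0 : 0 < d') (hds : d' ≤ filtVar lam v n d)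
    (hd' : ∫⁻ ω, ENNReal.ofReal
      ((lam * X ω + V ω - xh' (f ((H ω, lam * X ω + V ω + N ω), W ω))) ^ 2) ∂μ = d') :
    klDiv (μ.map fun ω => (f ((H ω, lam * X ω + V ω + N ω), W ω), lam * X ω + V ω))
        (μ.map (fun ω => f ((H ω, lam * X ω + V ω + N ω), W ω)) ⊗ₘ gaussKernel xh' hxh' d')
      + ENNReal.ofReal (1 / 2 * Real.log (filtVar lam v n d / d'))
      + klDiv (μ.map fun ω => (H ω, lam * X ω + V ω + N ω))
        (μ.map H ⊗ₘ gaussKernel (fun h => lam * xh h) (hxh.const_mul lam) (predVar lam v d + n))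
      ≤ condMutualInfo μ (fun ω => lam * X ω + V ω) W (fun ω => (H ω, lam * X ω + V ω + N ω))
        + klDiv (μ.map fun ω => (H ω, X ω)) (μ.map H ⊗ₘ gaussKernel xh hxh d) := by
  have hX' : Measurable fun ω => lam * X ω + V ω := by fun_prop
  have hZ : Measurable fun ω => (H ω, lam * X ω + V ω + N ω) := by fun_prop
  have hA := klDiv_kalman_le lam hv hn hH hX hV hN hxh hlaw (d := d)
  have hB := klDiv_update_le (filtVar_pos hv hn) hd0 hds hX' hW hZ
    (measurable_filtMean lam (predVar lam v d) n (hxh.comp measurable_fst) measurable_snd)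
    (hxh'.comp hf) (lintegral_sq_kalman lam hv hn hH hX hV hN hxh hlaw hd).2 hd'
  have hC := klDiv_comp_compProd_le μ hX' (hZ.prodMk hW) hf (gaussKernel xh' hxh' d')
  have hk : (gaussKernel xh' hxh' d').comap f hf = gaussKernel (xh' ∘ f) (hxh'.comp hf) d' := rfl
  rw [hk] at hC
  calc _ ≤ _ := add_le_add_left (add_le_add_left hC _) _
    _ ≤ _ := add_le_add_left hB _
    _ ≤ _ := by
      rw [add_assoc]
      refine add_le_add_right ?_ _
      rw [add_comm]
      exact hA

end Balance

/-! ### Lower bounds on the directed information of a scheme -/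

section Converse

open InformationTheory

/-- The source sample that precedes time `t`; it vanishes at the initial time. -/
def lastX (t : ℕ) (s : ℕ → ℝ × ℝ) : ℝ := if t = 0 then 0 else (s (t - 1)).1

theorem measurable_lastX (t : ℕ) : Measurable (lastX t) := by
  unfold lastX
  split_ifs <;> fun_prop

theorem lastX_extendHist (t : ℕ) (s : ℕ → ℝ × ℝ) : lastX t (extendHist (hist s t)) = lastX t s := by
  unfold lastX
  split_ifs with h
  · rfl
  · rw [extendHist_apply s (by omega)]

theorem fst_eq_innov (lam : ℝ) (s : ℕ → ℝ × ℝ) (t : ℕ) :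
    lam * lastX t s + (innov lam s t).1 = (s t).1 := by
  simp [innov, lastX]

theorem snd_eq_innov (lam : ℝ) (s : ℕ → ℝ × ℝ) (t : ℕ) :
    (s t).1 + (innov lam s t).2 = (s t).2 := by
  simp [innov]

/-- What the decoder knows before time `t`: the transmitted samples and the side information. -/
def past {T t : ℕ} (ht : t ≤ T) (ω : (ℕ → ℝ × ℝ) × (Fin T → ℝ)) : (Fin t → ℝ) × (Fin t → ℝ) :=
  (histFin ω.2 ht, hist (srcY ω.1) t)

theorem measurable_srcY : Measurable srcY :=
  measurable_pi_lambda _ fun k => measurable_snd.comp (measurable_pi_apply k)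

theorem measurable_past {T t : ℕ} (ht : t ≤ T) : Measurable (past ht) :=
  ((measurable_histFin ht).comp measurable_snd).prodMk
    ((measurable_hist t).comp (measurable_srcY.comp measurable_fst))

/-- Appending the side information and the transmitted sample at time `t` to the past. -/
def appendPast {t : ℕ} (p : (((Fin t → ℝ) × (Fin t → ℝ)) × ℝ) × ℝ) :
    (Fin (t + 1) → ℝ) × (Fin (t + 1) → ℝ) :=
  (Fin.snoc p.1.1.1 p.2, Fin.snoc p.1.1.2 p.1.2)

theorem measurable_appendPast {t : ℕ} : Measurable (appendPast (t := t)) :=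
  ((measurable_snoc t).comp (by fun_prop : Measurable
      fun p : (((Fin t → ℝ) × (Fin t → ℝ)) × ℝ) × ℝ => (p.1.1.1, p.2))).prodMk
    ((measurable_snoc t).comp (by fun_prop : Measurable
      fun p : (((Fin t → ℝ) × (Fin t → ℝ)) × ℝ) × ℝ => (p.1.1.2, p.1.2)))

theorem appendPast_past {T t : ℕ} (ht : t < T) (ω : (ℕ → ℝ × ℝ) × (Fin T → ℝ)) :
    appendPast ((past ht.le ω, (ω.1 t).2), ω.2 ⟨t, ht⟩) = past (Nat.succ_le_of_lt ht) ω := by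
  refine Prod.ext (funext fun i => ?_) (funext fun i => ?_)
  · refine Fin.lastCases ?_ (fun j => ?_) i
    · simp [appendPast, past, histFin]; rfl
    · simp [appendPast, past, histFin]
  · refine Fin.lastCases ?_ (fun j => ?_) i
    · simp [appendPast, past, hist, srcY]
    · simp [appendPast, past, hist, srcY]

variable (lam : ℝ) (varV varN : ℝ≥0)

theorem isNoiseStep_jointBoth (κ : CausalKernel (ℝ × ℝ) ℝ) {t T : ℕ} (ht : t ≤ T) :
    IsNoiseStep (jointBoth lam varV varN κ T) (past ht) (fun ω => lastX t ω.1)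
      (fun ω => (innov lam ω.1 t).1) (fun ω => (innov lam ω.1 t).2) varV varN := by
  set f : (Fin t → ℝ × ℝ) × (Fin t → ℝ) → ((Fin t → ℝ) × (Fin t → ℝ)) × ℝ :=
    fun q => ((q.2, fun i => (q.1 i).2), lastX t (extendHist q.1)) with hf
  have hfm : Measurable f := by
    have := (measurable_lastX t).comp (measurable_extendHist (S := ℝ × ℝ) t)
    exact Measurable.prodMk (by fun_prop) (this.comp measurable_fst)
  have hm1 : Measurable fun ω : (ℕ → ℝ × ℝ) × (Fin T → ℝ) => (hist ω.1 t, histFin ω.2 ht) :=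
    ((measurable_hist t).comp measurable_fst).prodMk ((measurable_histFin ht).comp measurable_snd)
  have hm2 : Measurable fun ω : (ℕ → ℝ × ℝ) × (Fin T → ℝ) => innov lam ω.1 t :=
    (measurable_innov lam t).comp measurable_fst
  have h := congrArg (fun ν => ν.map (Prod.map f id)) (map_innov_jointBoth lam varV varN κ ht)
  have := Measure.isProbabilityMeasure_map (μ := jointBoth lam varV varN κ T) hm1.aemeasurable
  rw [Measure.map_map (hfm.prodMap measurable_id) (hm1.prodMk hm2),
    ← Measure.map_prod_map _ _ hfm measurable_id, Measure.map_id, Measure.map_map hfm hm1] at h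
  have e1 : (f ∘ fun ω : (ℕ → ℝ × ℝ) × (Fin T → ℝ) => (hist ω.1 t, histFin ω.2 ht))
      = fun ω => (past ht ω, lastX t ω.1) := by
    funext ω
    simp only [hf, Function.comp, lastX_extendHist]
    rfl
  rw [e1] at h
  unfold IsNoiseStep
  rw [← h]
  congr 1
  funext ω
  have := congrFun e1 ω
  simp only [Function.comp] at this
  simp only [Function.comp, Prod.map, this]
  rfl

/-- The divergence of the posterior law of the last source sample, given what the decoder knows
before time `t`, from its Gaussian approximation with mean `xh` and variance `d`. -/
noncomputable def posteriorDiv {T t : ℕ} (ht : t ≤ T)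
    (μ : Measure ((ℕ → ℝ × ℝ) × (Fin T → ℝ))) (xh : (Fin t → ℝ) × (Fin t → ℝ) → ℝ)
    (hxh : Measurable xh) (d : ℝ≥0) : ℝ≥0∞ :=
  klDiv (μ.map fun ω => (past ht ω, lastX t ω.1)) (μ.map (past ht) ⊗ₘ gaussKernel xh hxh d)

/-- The divergence of the side information at time `t` from its Gaussian prediction. -/
noncomputable def sideDiv {T t : ℕ} (ht : t ≤ T)
    (μ : Measure ((ℕ → ℝ × ℝ) × (Fin T → ℝ))) (xh : (Fin t → ℝ) × (Fin t → ℝ) → ℝ)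
    (hxh : Measurable xh) (d : ℝ≥0) : ℝ≥0∞ :=
  klDiv (μ.map fun ω => (past ht ω, (ω.1 t).2))
    (μ.map (past ht) ⊗ₘ gaussKernel (fun h => lam * xh h) (hxh.const_mul lam)
      (predVar lam varV d + varN))

/-- The information conveyed at time `t` about the source, when the decoder also knows the side
information. -/
noncomputable def stepInfo {T t : ℕ} (ht : t < T)
    (μ : Measure ((ℕ → ℝ × ℝ) × (Fin T → ℝ))) [IsFiniteMeasure μ] : ℝ≥0∞ :=
  condMutualInfo μ (fun ω => hist (srcX ω.1) (t + 1)) (fun ω => ω.2 ⟨t, ht⟩)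
    (fun ω => (past ht.le ω, (ω.1 t).2))

variable {varV varN}

/-- The balance of divergences at time `t` of a scheme. -/
theorem posteriorDiv_succ_le (hV : 0 < varV) (hN : 0 < varN) (κ : CausalKernel (ℝ × ℝ) ℝ)
    {t T : ℕ} (ht : t < T) {xh : (Fin t → ℝ) × (Fin t → ℝ) → ℝ} (hxh : Measurable xh)
    {xh' : (Fin (t + 1) → ℝ) × (Fin (t + 1) → ℝ) → ℝ} (hxh' : Measurable xh') {d d' : ℝ≥0}
    (hd : ∫⁻ ω, ENNReal.ofReal ((lastX t ω.1 - xh (past ht.le ω)) ^ 2)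
      ∂(jointBoth lam varV varN κ T) = d)
    (hd0 : 0 < d') (hds : d' ≤ filtVar lam varV varN d)
    (hd' : ∫⁻ ω, ENNReal.ofReal (((ω.1 t).1 - xh' (past (Nat.succ_le_of_lt ht) ω)) ^ 2)
      ∂(jointBoth lam varV varN κ T) = d') :
    posteriorDiv (Nat.succ_le_of_lt ht) (jointBoth lam varV varN κ T) xh' hxh' d'
      + ENNReal.ofReal (1 / 2 * Real.log (filtVar lam varV varN d / d'))
      + sideDiv lam varV varN ht.le (jointBoth lam varV varN κ T) xh hxh d
      ≤ stepInfo ht (jointBoth lam varV varN κ T)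
        + posteriorDiv ht.le (jointBoth lam varV varN κ T) xh hxh d := by
  set μ := jointBoth lam varV varN κ T
  have hW : Measurable fun ω : (ℕ → ℝ × ℝ) × (Fin T → ℝ) => ω.2 ⟨t, ht⟩ := by fun_prop
  have hXt : Measurable fun ω : (ℕ → ℝ × ℝ) × (Fin T → ℝ) => hist (srcX ω.1) (t + 1) :=
    (measurable_hist _).comp (measurable_srcX.comp measurable_fst)
  have hl : Measurable fun ω : (ℕ → ℝ × ℝ) × (Fin T → ℝ) => lastX t ω.1 :=
    (measurable_lastX t).comp measurable_fst
  have hi : Measurable fun ω : (ℕ → ℝ × ℝ) × (Fin T → ℝ) => innov lam ω.1 t :=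
    (measurable_innov lam t).comp measurable_fst
  have key := klDiv_posterior_step_le (W := fun ω : (ℕ → ℝ × ℝ) × (Fin T → ℝ) => ω.2 ⟨t, ht⟩)
    (X := fun ω => lastX t ω.1) (V := fun ω => (innov lam ω.1 t).1)
    (N := fun ω => (innov lam ω.1 t).2)
    lam hV hN (measurable_past ht.le) hl (measurable_fst.comp hi) (measurable_snd.comp hi) hW hxh
    hxh' (isNoiseStep_jointBoth lam varV varN κ ht.le) hd measurable_appendPast hd0 hds (by
      simp only [fst_eq_innov, snd_eq_innov, appendPast_past]
      exact hd')
  simp only [fst_eq_innov, snd_eq_innov, appendPast_past] at key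
  have hI : condMutualInfo μ (fun ω => (ω.1 t).1) (fun ω => ω.2 ⟨t, ht⟩)
      (fun ω => (past ht.le ω, (ω.1 t).2)) ≤ stepInfo ht μ :=
    condMutualInfo_comp_left_le (f := fun x : Fin (t + 1) → ℝ => x (Fin.last t))
      (measurable_pi_apply _) hXt hW
      ((measurable_past ht.le).prodMk (by fun_prop))
  have hp : posteriorDiv (Nat.succ_le_of_lt ht) μ xh' hxh' d'
      = klDiv (μ.map fun ω => (past (Nat.succ_le_of_lt ht) ω, (ω.1 t).1))
        (μ.map (past (Nat.succ_le_of_lt ht)) ⊗ₘ gaussKernel xh' hxh' d') := by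
    simp [posteriorDiv, lastX]
  rw [hp]
  exact key.trans (add_le_add_left hI _)

/-- The distortion of the reconstruction at time `t`. -/
noncomputable def stepDist {T : ℕ} (μ : Measure ((ℕ → ℝ × ℝ) × (Fin T → ℝ)))
    (g : Reconstruction ℝ) {t : ℕ} (ht : t < T) : ℝ≥0∞ :=
  ∫⁻ ω, ENNReal.ofReal (((ω.1 t).1 - g.est t (past (Nat.succ_le_of_lt ht) ω)) ^ 2) ∂μ

/-- Summation of the balance of divergences.  `J` is the information conveyed at each time, `K` the
part of it that is not spent on the reduction of the error variance, and `P` a relation between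
the error variance and this part. -/
theorem exists_variances_of_step (hV : 0 < varV) (hN : 0 < varN) (κ : CausalKernel (ℝ × ℝ) ℝ)
    (T : ℕ) (g : Reconstruction ℝ) {ε : ℝ≥0} (hε : 0 < ε) (J : ℕ → ℝ≥0∞)
    (P : ℕ → ℝ≥0 → ℝ≥0∞ → Prop)
    (hstep : ∀ t (ht : t < T) (d : ℝ≥0) (xh : (Fin t → ℝ) × (Fin t → ℝ) → ℝ)
        (hxh : Measurable xh),
      ∫⁻ ω, ENNReal.ofReal ((lastX t ω.1 - xh (past ht.le ω)) ^ 2)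
        ∂(jointBoth lam varV varN κ T) = d →
      ∃ R : ℝ≥0∞, P t d (R + sideDiv lam varV varN ht.le (jointBoth lam varV varN κ T) xh hxh d) ∧
        stepInfo ht (jointBoth lam varV varN κ T) + R ≤ J t) :
    ∃ (d : ℕ → ℝ≥0) (K : ℕ → ℝ≥0∞), d 0 = 0 ∧ (∀ t (ht : t < T), 0 < d (t + 1) ∧
        d (t + 1) ≤ filtVar lam varV varN (d t) ∧
        (d (t + 1) : ℝ≥0∞) ≤ stepDist (jointBoth lam varV varN κ T) g ht + ε ∧
        (d (t + 1) = filtVar lam varV varN (d t) ∨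
          stepDist (jointBoth lam varV varN κ T) g ht ≤ d (t + 1)) ∧ P t (d t) (K t)) ∧
      ∑ t ∈ Finset.range T, (ENNReal.ofReal
        (1 / 2 * Real.log (filtVar lam varV varN (d t) / d (t + 1))) + K t)
        ≤ ∑ t ∈ Finset.range T, J t := by
  set μ := jointBoth lam varV varN κ T with hμ
  suffices h : ∀ k (hk : k ≤ T), ∃ (d : ℕ → ℝ≥0) (K : ℕ → ℝ≥0∞), d 0 = 0 ∧
      (∀ t (ht : t < k), 0 < d (t + 1) ∧ d (t + 1) ≤ filtVar lam varV varN (d t) ∧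
        (d (t + 1) : ℝ≥0∞) ≤ stepDist μ g (ht.trans_le hk) + ε ∧
        (d (t + 1) = filtVar lam varV varN (d t) ∨
          stepDist μ g (ht.trans_le hk) ≤ d (t + 1)) ∧ P t (d t) (K t)) ∧
      ∃ (xh : (Fin k → ℝ) × (Fin k → ℝ) → ℝ) (hxh : Measurable xh),
        ∫⁻ ω, ENNReal.ofReal ((lastX k ω.1 - xh (past hk ω)) ^ 2) ∂μ = d k ∧
        ∑ t ∈ Finset.range k, (ENNReal.ofReal
          (1 / 2 * Real.log (filtVar lam varV varN (d t) / d (t + 1))) + K t)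
          + posteriorDiv hk μ xh hxh (d k) ≤ ∑ t ∈ Finset.range k, J t by
    obtain ⟨d, K, h0, h1, xh, hxh, -, h3⟩ := h T le_rfl
    exact ⟨d, K, h0, h1, le_self_add.trans h3⟩
  intro k
  induction k with
  | zero =>
    intro hk
    refine ⟨fun _ => 0, fun _ => 0, rfl, fun t ht => absurd ht (Nat.not_lt_zero t), fun _ => 0,
      measurable_const, by simp [lastX], ?_⟩
    have h : μ.map (fun ω => (past hk ω, lastX 0 ω.1))
        = μ.map (past hk) ⊗ₘ gaussKernel (fun _ => 0) measurable_const 0 := by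
      have hk0 : gaussKernel (fun _ : (Fin 0 → ℝ) × (Fin 0 → ℝ) => 0) measurable_const 0
          = Kernel.const _ (Measure.dirac 0) := by
        ext1 p; simp [gaussKernel_apply]
      rw [hk0, Measure.compProd_const, Measure.prod_dirac,
        Measure.map_map (by fun_prop) (measurable_past hk)]
      rfl
    -- before the first sample the source is zero, as is its Gaussian approximation of variance zero
    rw [posteriorDiv, h, klDiv_self]
    simp
  | succ k ih =>
    intro hk
    have hkT : k < T := hk
    obtain ⟨d, K, h0, h1, xh, hxh, h2, h3⟩ := ih hkT.le
    obtain ⟨R, hP, hR⟩ := hstep k hkT (d k) xh hxh h2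
    -- the filtered estimate is the fallback estimator
    set m : (Fin (k + 1) → ℝ) × (Fin (k + 1) → ℝ) → ℝ := fun h =>
      filtMean lam (predVar lam varV (d k)) varN
        (xh (fun i => h.1 i.castSucc, fun i => h.2 i.castSucc)) (h.2 (Fin.last k)) with hm
    have hmm : Measurable m := measurable_filtMean _ _ _ (hxh.comp (by fun_prop)) (by fun_prop)
    have hl : Measurable fun ω : (ℕ → ℝ × ℝ) × (Fin T → ℝ) => lastX k ω.1 :=
      (measurable_lastX k).comp measurable_fst
    have hi : Measurable fun ω : (ℕ → ℝ × ℝ) × (Fin T → ℝ) => innov lam ω.1 k :=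
      (measurable_innov lam k).comp measurable_fst
    have hmf : ∫⁻ ω, ENNReal.ofReal (((ω.1 k).1 - m (past hk ω)) ^ 2) ∂μ
        = filtVar lam varV varN (d k) := by
      have := (lintegral_sq_kalman lam hV hN (measurable_past hkT.le) hl (measurable_fst.comp hi)
        (measurable_snd.comp hi) hxh (isNoiseStep_jointBoth lam varV varN κ hkT.le) h2).2
      simp only [Function.comp, fst_eq_innov, snd_eq_innov] at this
      exact this
    obtain ⟨xh', hxh', d', hd0, hds, hd', hdD, hdd⟩ := exists_estimator (μ := μ)
      (X := fun ω => (ω.1 k).1) (filtVar_pos hV hN) (by fun_prop) (measurable_past hk) hmm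
      (g.measurable_est k) hmf hε
    have hbal := posteriorDiv_succ_le lam hV hN κ hkT hxh hxh' h2 hd0 hds hd'
    refine ⟨Function.update d (k + 1) d', Function.update K k
      (R + sideDiv lam varV varN hkT.le μ xh hxh (d k)), ?_, ?_, xh', hxh', ?_, ?_⟩
    · rw [Function.update_of_ne (by omega), h0]
    · intro t ht
      rcases Nat.lt_succ_iff_lt_or_eq.1 ht with h | rfl
      · rw [Function.update_of_ne (by omega), Function.update_of_ne (by omega),
          Function.update_of_ne (by omega)]
        exact h1 t h
      · rw [Function.update_self, Function.update_self, Function.update_of_ne (by omega)]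
        exact ⟨hd0, hds, hdD, hdd, hP⟩
    · rw [Function.update_self, ← hd']; rfl
    · rw [Finset.sum_range_succ, Finset.sum_range_succ, Function.update_self, Function.update_self,
        Function.update_of_ne (by omega)]
      have hs : ∑ t ∈ Finset.range k, (ENNReal.ofReal (1 / 2 * Real.log
            (filtVar lam varV varN (Function.update d (k + 1) d' t)
              / Function.update d (k + 1) d' (t + 1)))
            + Function.update K k (R + sideDiv lam varV varN hkT.le μ xh hxh (d k)) t)
          = ∑ t ∈ Finset.range k, (ENNReal.ofReal
            (1 / 2 * Real.log (filtVar lam varV varN (d t) / d (t + 1))) + K t) := by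
        refine Finset.sum_congr rfl fun t ht => ?_
        have ht := Finset.mem_range.1 ht
        rw [Function.update_of_ne (by omega), Function.update_of_ne (by omega),
          Function.update_of_ne (by omega)]
      rw [hs]
      set S := ∑ t ∈ Finset.range k, (ENNReal.ofReal
            (1 / 2 * Real.log (filtVar lam varV varN (d t) / d (t + 1))) + K t)
      set ρ := ENNReal.ofReal (1 / 2 * Real.log (filtVar lam varV varN (d k) / d'))
      set s := sideDiv lam varV varN hkT.le μ xh hxh (d k)
      set A := posteriorDiv hkT.le μ xh hxh (d k)
      set A' := posteriorDiv hk μ xh' hxh' d'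
      calc S + (ρ + (R + s)) + A' = S + R + (A' + ρ + s) := by ring
        _ ≤ S + R + (stepInfo hkT μ + A) := add_le_add_right hbal _
        _ = (S + A) + (stepInfo hkT μ + R) := by ring
        _ ≤ _ := add_le_add h3 hR

end Converse

section ConverseSchemes

open InformationTheory

variable (lam : ℝ) {varV varN : ℝ≥0}

/-- The error variances behind a scheme in which the side information is available everywhere:
a sequence of variances, each at most the distortion of the scheme up to `ε`, along which the
reduction of the filtered variance is paid by the causally conditional directed information. -/
theorem exists_variances_jointBoth (hV : 0 < varV) (hN : 0 < varN) (κ : CausalKernel (ℝ × ℝ) ℝ)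
    (T : ℕ) (g : Reconstruction ℝ) {ε : ℝ≥0} (hε : 0 < ε) :
    ∃ d : ℕ → ℝ≥0, d 0 = 0 ∧ (∀ t (ht : t < T), 0 < d (t + 1) ∧
        d (t + 1) ≤ filtVar lam varV varN (d t) ∧
        (d (t + 1) : ℝ≥0∞) ≤ stepDist (jointBoth lam varV varN κ T) g ht + ε) ∧
      ∑ t ∈ Finset.range T, ENNReal.ofReal
        (1 / 2 * Real.log (filtVar lam varV varN (d t) / d (t + 1)))
        ≤ condDirectedInfo (jointBoth lam varV varN κ T) := by
  set μ := jointBoth lam varV varN κ T with hμ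
  set J : ℕ → ℝ≥0∞ := fun t => if ht : t < T then condMutualInfo μ
    (fun ω => hist (srcX ω.1) (t + 1)) (fun ω => ω.2 ⟨t, ht⟩)
    (fun ω => (histFin ω.2 ht.le, hist (srcY ω.1) (t + 1))) else 0 with hJ
  obtain ⟨d, K, h0, h1, h2⟩ := exists_variances_of_step lam hV hN κ T g hε J
    (fun _ _ _ => True) fun t ht d xh hxh hd => by
      refine ⟨0, trivial, ?_⟩
      rw [add_zero]
      simp only [hJ, ht, dif_pos]
      have hZ : Measurable fun ω : (ℕ → ℝ × ℝ) × (Fin T → ℝ) =>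
          (histFin ω.2 ht.le, hist (srcY ω.1) (t + 1)) :=
        ((measurable_histFin ht.le).comp measurable_snd).prodMk
          ((measurable_hist _).comp (measurable_srcY.comp measurable_fst))
      refine condMutualInfo_comp_right_le
        (φ := fun p : (Fin t → ℝ) × (Fin (t + 1) → ℝ) =>
          ((p.1, fun i : Fin t => p.2 i.castSucc), p.2 (Fin.last t)))
        (ψ := fun q => (q.1.1, Fin.snoc q.1.2 q.2))
        ((measurable_hist _).comp (measurable_srcX.comp measurable_fst))
        (by fun_prop) hZ (by fun_prop) ?_ fun p => ?_
      · exact Measurable.prodMk (by fun_prop) ((measurable_snoc t).comp (by fun_prop : Measurable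
          fun q : ((Fin t → ℝ) × (Fin t → ℝ)) × ℝ => (q.1.2, q.2)))
      · exact Prod.ext rfl (Fin.snoc_init_self p.2)
  refine ⟨d, h0, fun t ht => ⟨(h1 t ht).1, (h1 t ht).2.1, (h1 t ht).2.2.1⟩, ?_⟩
  refine (Finset.sum_le_sum fun t _ => le_self_add).trans (h2.trans (le_of_eq ?_))
  rw [Finset.sum_range, condDirectedInfo]
  exact Finset.sum_congr rfl fun t _ => dif_pos t.isLt

variable (varV varN)

/-- Without access to the side information, the transmitted sample is drawn from any variable that
determines the source and the previously transmitted samples. -/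
theorem map_step_jointDec (κ : CausalKernel ℝ ℝ) {t T : ℕ} (ht : t < T) {E : Type*}
    [MeasurableSpace E] {f : (ℕ → ℝ × ℝ) × (Fin t → ℝ) → E} (hf : Measurable f)
    {h : E → (Fin (t + 1) → ℝ) × (Fin t → ℝ)} (hh : Measurable h)
    (hhf : ∀ p, h (f p) = (hist (srcX p.1) (t + 1), p.2)) :
    (jointBoth lam varV varN κ.pull T).map
        (fun ω => (f (ω.1, histFin ω.2 ht.le), ω.2 ⟨t, ht⟩))
      = (jointBoth lam varV varN κ.pull T).map (fun ω => f (ω.1, histFin ω.2 ht.le))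
        ⊗ₘ (κ.step t).comap h hh := by
  have := κ.markov t
  have hm : Measurable fun ω : (ℕ → ℝ × ℝ) × (Fin T → ℝ) => (ω.1, histFin ω.2 ht.le) :=
    measurable_fst.prodMk ((measurable_histFin _).comp measurable_snd)
  refine map_comp_compProd (X := fun ω : (ℕ → ℝ × ℝ) × (Fin T → ℝ) => (ω.1, histFin ω.2 ht.le))
    (Y := fun ω => ω.2 ⟨t, ht⟩) hm (by fun_prop) hf ((κ.step t).comap h hh) ?_
  rw [map_step_jointBoth lam varV varN κ.pull ht]
  congr 1
  ext1 p
  rw [Kernel.comap_apply, Kernel.comap_apply, Kernel.comap_apply, hhf]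
  rfl

/-- Without access to the side information, the transmitted sample is independent of the present
noise of the side information. -/
theorem map_noise_jointDec (κ : CausalKernel ℝ ℝ) {t T : ℕ} (ht : t < T) :
    (jointBoth lam varV varN κ.pull T).map
        (fun ω => (((past ht.le ω, ω.2 ⟨t, ht⟩), (ω.1 t).1), (innov lam ω.1 t).2))
      = ((jointBoth lam varV varN κ.pull T).map
        fun ω => ((past ht.le ω, ω.2 ⟨t, ht⟩), (ω.1 t).1)).prod (gaussianReal 0 varN) := by
  have := κ.markov t
  set μ := jointBoth lam varV varN κ.pull T with hμ
  -- the past, together with the present innovation of the source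
  set A : (ℕ → ℝ × ℝ) × (Fin t → ℝ) → ((Fin t → ℝ × ℝ) × (Fin t → ℝ)) × ℝ :=
    fun p => ((hist p.1 t, p.2), (innov lam p.1 t).1) with hA
  have hAm : Measurable A := (((measurable_hist t).comp measurable_fst).prodMk
    measurable_snd).prodMk (measurable_fst.comp ((measurable_innov lam t).comp measurable_fst))
  have hm : Measurable fun ω : (ℕ → ℝ × ℝ) × (Fin T → ℝ) => (ω.1, histFin ω.2 ht.le) :=
    measurable_fst.prodMk ((measurable_histFin _).comp measurable_snd)
  have hn : Measurable fun s : ℕ → ℝ × ℝ => (innov lam s t).2 :=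
    measurable_snd.comp (measurable_innov lam t)
  set fA : ((Fin t → ℝ × ℝ) × (Fin t → ℝ)) × ℝ → (Fin (t + 1) → ℝ) × (Fin t → ℝ) := fun q =>
    (Fin.snoc (fun i => (q.1.1 i).1) (lam * lastX t (extendHist q.1.1) + q.2), q.1.2) with hfA
  have hfAm : Measurable fA := by
    have h1 := (measurable_lastX t).comp (measurable_extendHist (S := ℝ × ℝ) t)
    have h2 : Measurable fun q : ((Fin t → ℝ × ℝ) × (Fin t → ℝ)) × ℝ =>
        ((fun i => (q.1.1 i).1 : Fin t → ℝ), lam * lastX t (extendHist q.1.1) + q.2) :=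
      Measurable.prodMk (by fun_prop)
        (((h1.comp (measurable_fst.comp measurable_fst)).const_mul lam).add measurable_snd)
    exact ((measurable_snoc t).comp h2).prodMk (by fun_prop)
  have hfAA (p : (ℕ → ℝ × ℝ) × (Fin t → ℝ)) : fA (A p) = (hist (srcX p.1) (t + 1), p.2) := by
    refine Prod.ext (funext fun i => ?_) rfl
    simp only [hfA, hA, lastX_extendHist, fst_eq_innov]
    refine Fin.lastCases ?_ (fun j => ?_) i
    · simp [hist, srcX]
    · simp [hist, srcX]
  have hAω : Measurable fun ω : (ℕ → ℝ × ℝ) × (Fin T → ℝ) => A (ω.1, histFin ω.2 ht.le) :=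
    hAm.comp hm
  have hnω : Measurable fun ω : (ℕ → ℝ × ℝ) × (Fin T → ℝ) => (innov lam ω.1 t).2 :=
    hn.comp measurable_fst
  have hWω : Measurable fun ω : (ℕ → ℝ × ℝ) × (Fin T → ℝ) => ω.2 ⟨t, ht⟩ := by fun_prop
  have hswap : Measurable fun p : ((((Fin t → ℝ × ℝ) × (Fin t → ℝ)) × ℝ) × ℝ) × ℝ =>
    ((p.1.1, p.2), p.1.2) := by fun_prop
  have := Measure.isProbabilityMeasure_map (μ := μ) hAω.aemeasurable
  have e1 := map_step_jointDec lam varV varN κ ht hAm hfAm hfAA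
  have e2 := map_step_jointDec lam varV varN κ ht (f := fun p => (A p, (innov lam p.1 t).2))
    (hAm.prodMk (hn.comp measurable_fst)) (hfAm.comp measurable_fst) hfAA
  have e3 : μ.map (fun ω => (A (ω.1, histFin ω.2 ht.le), (innov lam ω.1 t).2))
      = (μ.map fun ω => A (ω.1, histFin ω.2 ht.le)) ⊗ₘ Kernel.const _ (gaussianReal 0 varN) := by
    have h := map_innov_jointBoth lam varV varN κ.pull ht.le
    rw [← hμ] at h
    have hB : Measurable fun ω : (ℕ → ℝ × ℝ) × (Fin T → ℝ) => (hist ω.1 t, histFin ω.2 ht.le) :=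
      ((measurable_hist t).comp measurable_fst).prodMk ((measurable_histFin _).comp measurable_snd)
    have hI : Measurable fun ω : (ℕ → ℝ × ℝ) × (Fin T → ℝ) => innov lam ω.1 t :=
      (measurable_innov lam t).comp measurable_fst
    have h1 : (fun ω : (ℕ → ℝ × ℝ) × (Fin T → ℝ) =>
          (A (ω.1, histFin ω.2 ht.le), (innov lam ω.1 t).2))
        = MeasurableEquiv.prodAssoc.symm ∘
          fun ω => ((hist ω.1 t, histFin ω.2 ht.le), innov lam ω.1 t) := rfl
    have h2 : (fun ω : (ℕ → ℝ × ℝ) × (Fin T → ℝ) => A (ω.1, histFin ω.2 ht.le))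
        = Prod.fst ∘ MeasurableEquiv.prodAssoc.symm ∘
          fun ω => ((hist ω.1 t, histFin ω.2 ht.le), innov lam ω.1 t) := rfl
    have := Measure.isProbabilityMeasure_map (μ := μ) hB.aemeasurable
    have h3 : (((μ.map fun ω => (hist ω.1 t, histFin ω.2 ht.le)).prod
          ((gaussianReal 0 varV).prod (gaussianReal 0 varN))).map MeasurableEquiv.prodAssoc.symm)
        = ((μ.map fun ω => (hist ω.1 t, histFin ω.2 ht.le)).prod
          (gaussianReal 0 varV)).prod (gaussianReal 0 varN) := by
      rw [← Measure.prodAssoc_prod, MeasurableEquiv.map_symm_map]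
    rw [h2, ← Measure.map_map measurable_fst (MeasurableEquiv.prodAssoc.symm.measurable.comp
      (hB.prodMk hI)), h1, ← Measure.map_map MeasurableEquiv.prodAssoc.symm.measurable
      (hB.prodMk hI), h, h3, Measure.compProd_const]
    simp
  have e4 : μ.map (fun ω => ((A (ω.1, histFin ω.2 ht.le), ω.2 ⟨t, ht⟩), (innov lam ω.1 t).2))
      = (μ.map fun ω => (A (ω.1, histFin ω.2 ht.le), ω.2 ⟨t, ht⟩)).prod (gaussianReal 0 varN) := by
    have h := compProd_prodMkRight_swap (μ.map fun ω => A (ω.1, histFin ω.2 ht.le))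
      (Kernel.const _ (gaussianReal 0 varN)) ((κ.step t).comap fA hfAm)
    rw [← e1, ← e3] at h
    have h5 : ((κ.step t).comap fA hfAm).prodMkRight ℝ
        = (κ.step t).comap _ (hfAm.comp measurable_fst) := rfl
    have h6 : (Kernel.const (((Fin t → ℝ × ℝ) × (Fin t → ℝ)) × ℝ)
        (gaussianReal 0 varN)).prodMkRight ℝ = Kernel.const _ (gaussianReal 0 varN) := rfl
    rw [h5, ← e2, h6, Measure.compProd_const,
      Measure.map_map hswap ((hAω.prodMk hnω).prodMk hWω)] at h
    exact h
  -- the variables of interest are functions of the past, the source and the transmitted sample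
  set F : (((Fin t → ℝ × ℝ) × (Fin t → ℝ)) × ℝ) × ℝ →
      (((Fin t → ℝ) × (Fin t → ℝ)) × ℝ) × ℝ := fun q =>
    (((q.1.1.2, fun i => (q.1.1.1 i).2), q.2), lam * lastX t (extendHist q.1.1.1) + q.1.2) with hF
  have hFm : Measurable F := by
    have h1 := (measurable_lastX t).comp (measurable_extendHist (S := ℝ × ℝ) t)
    exact Measurable.prodMk (by fun_prop)
      (((h1.comp (measurable_fst.comp (measurable_fst.comp measurable_fst))).const_mul lam).add
        (by fun_prop))
  have hFA : (F ∘ fun ω : (ℕ → ℝ × ℝ) × (Fin T → ℝ) =>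
      (A (ω.1, histFin ω.2 ht.le), ω.2 ⟨t, ht⟩))
      = fun ω => ((past ht.le ω, ω.2 ⟨t, ht⟩), (ω.1 t).1) := by
    funext ω
    simp only [hF, hA, Function.comp, lastX_extendHist, fst_eq_innov]
    rfl
  have hAW : Measurable fun ω : (ℕ → ℝ × ℝ) × (Fin T → ℝ) =>
      (A (ω.1, histFin ω.2 ht.le), ω.2 ⟨t, ht⟩) := hAω.prodMk (by fun_prop)
  have := Measure.isProbabilityMeasure_map (μ := μ) hAW.aemeasurable
  have h := congrArg (fun ν => ν.map (Prod.map F id)) e4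
  rw [Measure.map_map (hFm.prodMap measurable_id) (hAW.prodMk hnω),
    ← Measure.map_prod_map _ _ hFm measurable_id, Measure.map_id, Measure.map_map hFm hAW, hFA] at h
  rw [← h]
  congr 1
  funext ω
  have := congrFun hFA ω
  simp only [Function.comp] at this
  simp only [Function.comp, Prod.map, this]
  rfl

variable {varV varN}

/-- The error variances behind a scheme in which the side information is available at the decoder
only: the directed information pays, in addition, for the amounts `K t`, which bound how far
the filtered variances may be reduced. -/
theorem exists_forall_exists_variances_jointDec (hV : 0 < varV) (hN : 0 < varN) {δ : ℝ≥0}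
    (hδ : 0 < δ) : ∃ c : ℝ≥0, ∀ (κ : CausalKernel ℝ ℝ) (T : ℕ) (g : Reconstruction ℝ) {ε : ℝ≥0},
    0 < ε → ∃ (d : ℕ → ℝ≥0) (K : ℕ → ℝ≥0∞), d 0 = 0 ∧ (∀ t (ht : t < T), 0 < d (t + 1) ∧
        d (t + 1) ≤ filtVar lam varV varN (d t) ∧
        (d (t + 1) : ℝ≥0∞) ≤ stepDist (jointDec lam varV varN κ T) g ht + ε ∧
        (filtVar lam varV varN (d t) : ℝ≥0∞) ≤ d (t + 1) + δ + c * K t) ∧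
      ∑ t ∈ Finset.range T, (ENNReal.ofReal
        (1 / 2 * Real.log (filtVar lam varV varN (d t) / d (t + 1))) + K t)
        ≤ directedInfo (jointDec lam varV varN κ T) := by
  obtain ⟨c, hc⟩ := exists_forall_filtVar_le hN.ne' hδ
  refine ⟨c, fun κ T g ε hε => ?_⟩
  simp only [jointDec_eq_jointBoth_pull]
  set μ := jointBoth lam varV varN κ.pull T with hμ
  set J : ℕ → ℝ≥0∞ := fun t => if ht : t < T then condMutualInfo μ
    (fun ω => hist (srcX ω.1) (t + 1)) (fun ω => ω.2 ⟨t, ht⟩)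
    (fun ω => histFin ω.2 ht.le) else 0 with hJ
  obtain ⟨d, K, h0, h1, h2⟩ := exists_variances_of_step lam hV hN κ.pull T g hε J
    (fun t d K => ∀ ht : t < T, (filtVar lam varV varN d : ℝ≥0∞)
      ≤ stepDist μ g ht + δ + c * K) fun t ht d xh hxh hd => by
    have hW : Measurable fun ω : (ℕ → ℝ × ℝ) × (Fin T → ℝ) => ω.2 ⟨t, ht⟩ := by fun_prop
    have hY : Measurable fun ω : (ℕ → ℝ × ℝ) × (Fin T → ℝ) => (ω.1 t).2 := by fun_prop
    have hH := measurable_past (T := T) ht.le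
    have hX : Measurable fun ω : (ℕ → ℝ × ℝ) × (Fin T → ℝ) => hist (srcX ω.1) (t + 1) :=
      (measurable_hist _).comp (measurable_srcX.comp measurable_fst)
    have hl : Measurable fun ω : (ℕ → ℝ × ℝ) × (Fin T → ℝ) => lastX t ω.1 :=
      (measurable_lastX t).comp measurable_fst
    have hi : Measurable fun ω : (ℕ → ℝ × ℝ) × (Fin T → ℝ) => innov lam ω.1 t :=
      (measurable_innov lam t).comp measurable_fst
    refine ⟨condMutualInfo μ (fun ω => ω.2 ⟨t, ht⟩) (fun ω => (ω.1 t).2) (past ht.le),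
      fun _ => ?_, ?_⟩
    · rw [sideDiv, ← klDiv_compProd_prodMkRight_eq_add hW hY hH, gaussKernel_prodMkRight]
      have hHWX : Measurable fun ω : (ℕ → ℝ × ℝ) × (Fin T → ℝ) =>
        ((past ht.le ω, ω.2 ⟨t, ht⟩), (ω.1 t).1) := (hH.prodMk hW).prodMk (by fun_prop)
      have := Measure.isProbabilityMeasure_map (μ := μ) hHWX.aemeasurable
      set ρ := μ.map fun ω => ((past ht.le ω, ω.2 ⟨t, ht⟩), (ω.1 t).1) with hρ
      have hG : Measurable fun q : (((Fin t → ℝ) × (Fin t → ℝ)) × ℝ) × ℝ =>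
          g.est t (appendPast ((q.1.1, q.2), q.1.2)) :=
        (g.measurable_est t).comp (measurable_appendPast.comp (by fun_prop))
      have key := hc (((Fin t → ℝ) × (Fin t → ℝ)) × ℝ) ρ (fun q => lam * xh q.1)
        ((hxh.const_mul lam).comp measurable_fst) (predVar lam varV d)
        (fun q => g.est t (appendPast ((q.1.1, q.2), q.1.2))) (predVar_pos hV).ne' (by
          rw [hρ, lintegral_map (by fun_prop) hHWX]
          have := (lintegral_sq_kalman lam hV hN hH hl (measurable_fst.comp hi)
            (measurable_snd.comp hi) hxh (isNoiseStep_jointBoth lam varV varN κ.pull ht.le) hd).1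
          simp only [Function.comp, fst_eq_innov] at this
          exact this) hG
      have hN' : Measurable fun ω : (ℕ → ℝ × ℝ) × (Fin T → ℝ) => (innov lam ω.1 t).2 :=
        measurable_snd.comp hi
      have hGm : Measurable fun q : ((((Fin t → ℝ) × (Fin t → ℝ)) × ℝ) × ℝ) × ℝ =>
          ENNReal.ofReal ((q.1.2
            - g.est t (appendPast ((q.1.1.1, q.1.2 + q.2), q.1.1.2))) ^ 2) := by
        have := hG.comp (by fun_prop :
          Measurable fun q : ((((Fin t → ℝ) × (Fin t → ℝ)) × ℝ) × ℝ) × ℝ => (q.1.1, q.1.2 + q.2))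
        exact (((by fun_prop : Measurable
          fun q : ((((Fin t → ℝ) × (Fin t → ℝ)) × ℝ) × ℝ) × ℝ => q.1.2).sub this).pow_const
            2).ennreal_ofReal
      rw [hρ, ← map_noise_jointDec lam varV varN κ ht,
        Measure.map_map (by fun_prop) (hHWX.prodMk hN'), Measure.map_map (by fun_prop) hHWX,
        lintegral_map hGm (hHWX.prodMk hN')] at key
      simp only [Function.comp_def, snd_eq_innov, appendPast_past] at key
      exact key
    · simp only [hJ, ht, dif_pos]
      have := κ.markov t
      have hf : Measurable fun p : (ℕ → ℝ × ℝ) × (Fin t → ℝ) =>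
          (((p.2, hist (srcY p.1) t), (p.1 t).2), hist (srcX p.1) (t + 1)) :=
        ((measurable_snd.prodMk ((measurable_hist _).comp (measurable_srcY.comp
          measurable_fst))).prodMk (by fun_prop)).prodMk
          ((measurable_hist _).comp (measurable_srcX.comp measurable_fst))
      exact condMutualInfo_add_le_of_map_eq (π := Prod.fst) hX hW hY hH measurable_fst
        ((κ.step t).comap Prod.swap measurable_swap)
        (map_step_jointDec lam varV varN κ ht hf
          (h := fun q => (q.2, q.1.1.1)) (by fun_prop) fun p => rfl)
  refine ⟨d, K, h0, fun t ht => ⟨(h1 t ht).1, (h1 t ht).2.1, (h1 t ht).2.2.1, ?_⟩,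
    h2.trans (le_of_eq ?_)⟩
  -- the error variance is the filtered one, or it is at least the distortion
  · rcases (h1 t ht).2.2.2.1 with h | h
    · rw [h, add_assoc]; exact le_self_add
    · exact ((h1 t ht).2.2.2.2 ht).trans (by gcongr)
  rw [Finset.sum_range, directedInfo]
  exact Finset.sum_congr rfl fun t _ => dif_pos t.isLt

end ConverseSchemes

/-! ### Gaussian schemes with prescribed error variances -/

section Achievability

open InformationTheory

/-- The gain of the unit-noise Gaussian test channel that lowers the error variance from `s`
to `d`. -/
noncomputable def channelGain (s d : ℝ≥0) : ℝ := √(1 / d - 1 / s)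

theorem sq_channelGain {s d : ℝ≥0} (hd : 0 < d) (hds : d ≤ s) :
    channelGain s d ^ 2 = 1 / d - 1 / s := by
  rw [channelGain, Real.sq_sqrt]
  rw [sub_nonneg]
  exact one_div_le_one_div_of_le hd hds

/-- The information conveyed by, and the error variance after, a Gaussian test channel; `c` and `b`
are the offset and the scale of its output. -/
theorem testChannel_step {Ω E A : Type*} [MeasurableSpace Ω] [MeasurableSpace E]
    [MeasurableSpace A] [StandardBorelSpace A] [Nonempty A] {μ : Measure Ω}
    [IsProbabilityMeasure μ] {Z : Ω → E} {X : Ω → A} {W : Ω → ℝ} (hX : Measurable X)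
    (hW : Measurable W) (hZ : Measurable Z) {x : A → ℝ} (hx : Measurable x) {xf c : E → ℝ}
    (hxf : Measurable xf) (hc : Measurable c) (b : ℝ) {s d : ℝ≥0} (hd : 0 < d) (hds : d ≤ s)
    (hs : ∫⁻ ω, ENNReal.ofReal ((x (X ω) - xf (Z ω)) ^ 2) ∂μ = s)
    (hlaw : μ.map (fun ω => ((Z ω, X ω), W ω)) = μ.map (fun ω => (Z ω, X ω)) ⊗ₘ
      gaussKernel (fun p => c p.1 + b * (channelGain s d * (x p.2 - xf p.1))) (by fun_prop)
        (‖b‖₊ ^ 2))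
    {xh : E × ℝ → ℝ} (hxh : Measurable xh)
    (hxhc : ∀ z u, xh (z, c z + b * u) = xf z + channelGain s d * d * u) :
    condMutualInfo μ X W Z ≤ ENNReal.ofReal (1 / 2 * Real.log (s / d)) ∧
      ∫⁻ ω, ENNReal.ofReal ((x (X ω) - xh (Z ω, W ω)) ^ 2) ∂μ = d := by
  have hd' : (0 : ℝ) < d := hd
  have hs' : (0 : ℝ) < s := hd'.trans_le hds
  set a := channelGain s d with ha
  have ha2 : a ^ 2 = 1 / d - 1 / s := sq_channelGain hd hds
  have hm : Measurable fun p : E × A => a * (x p.2 - xf p.1) := by fun_prop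
  constructor
  · refine (condMutualInfo_le_of_gaussian (m := fun p : E × A => a * (x p.2 - xf p.1))
      (q := ‖a‖₊ ^ 2 * s) hX hW hZ hm hc b ?_ hlaw).trans (le_of_eq ?_)
    · simp_rw [mul_pow]
      have h (ω : Ω) : ENNReal.ofReal (a ^ 2 * (x (X ω) - xf (Z ω)) ^ 2)
          = ENNReal.ofReal (a ^ 2) * ENNReal.ofReal ((x (X ω) - xf (Z ω)) ^ 2) :=
        ENNReal.ofReal_mul (by positivity)
      simp_rw [h]
      rw [lintegral_const_mul _ (by fun_prop), hs, ← ENNReal.ofReal_coe_nnreal,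
        ← ENNReal.ofReal_mul (by positivity), ← ENNReal.ofReal_coe_nnreal]
      congr 1
      push_cast
      simp
    · congr 3
      push_cast
      rw [Real.norm_eq_abs, sq_abs, ha2]
      field_simp
      ring
  · have := Measure.isProbabilityMeasure_map (μ := μ) (hZ.prodMk hX).aemeasurable
    set ρ := μ.map fun ω => (Z ω, X ω) with hρ
    have hl : ρ ⊗ₘ gaussKernel (fun p => c p.1 + b * (a * (x p.2 - xf p.1))) (by fun_prop)
        (‖b‖₊ ^ 2) = (ρ ⊗ₘ gaussKernel (fun p => a * (x p.2 - xf p.1)) hm 1).map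
          (fun p => (p.1, c p.1.1 + b * p.2)) := by
      rw [map_affine_compProd_gaussKernel (c := fun p : E × A => c p.1) ρ hm
        (hc.comp measurable_fst)]
      congr 1
      ext1 p
      simp [gaussKernel_apply]
    have hf : Measurable fun q : (E × A) × ℝ =>
      ENNReal.ofReal ((x q.1.2 - xh (q.1.1, q.2)) ^ 2) := by fun_prop
    have hf' : Measurable fun q : (E × A) × ℝ =>
      ENNReal.ofReal ((x q.1.2 - xh (q.1.1, c q.1.1 + b * q.2)) ^ 2) := by fun_prop
    rw [← lintegral_map (f := fun q : (E × A) × ℝ =>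
      ENNReal.ofReal ((x q.1.2 - xh (q.1.1, q.2)) ^ 2)) (g := fun ω => ((Z ω, X ω), W ω)) hf
      ((hZ.prodMk hX).prodMk hW), hlaw, hl, lintegral_map hf (by fun_prop),
      Measure.lintegral_compProd hf']
    have h (p : E × A) : ∫⁻ u, ENNReal.ofReal ((x p.2 - xh (p.1, c p.1 + b * u)) ^ 2)
        ∂(gaussKernel (fun p : E × A => a * (x p.2 - xf p.1)) hm 1 p)
        = ENNReal.ofReal ((d / s) ^ 2) * ENNReal.ofReal ((x p.2 - xf p.1) ^ 2)
          + ENNReal.ofReal (a ^ 2 * d ^ 2) := by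
      simp_rw [hxhc, ← sub_sub]
      rw [gaussKernel_apply, lintegral_sq_gaussianReal, ← ENNReal.ofReal_mul (by positivity),
        ← ENNReal.ofReal_add (by positivity) (by positivity)]
      have h1 : x p.2 - xf p.1 - a * d * (a * (x p.2 - xf p.1))
          = (1 - a ^ 2 * d) * (x p.2 - xf p.1) := by ring
      have h2 : 1 - a ^ 2 * d = (d / s : ℝ) := by rw [ha2]; field_simp; ring
      rw [h1, h2]
      congr 1
      push_cast
      ring
    refine (lintegral_congr h).trans ?_
    rw [lintegral_add_right _ measurable_const, lintegral_const_mul _ (by fun_prop), hρ,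
      lintegral_map (f := fun p : E × A => ENNReal.ofReal ((x p.2 - xf p.1) ^ 2)) (by fun_prop)
        (hZ.prodMk hX), hs]
    simp only [lintegral_const, measure_univ, mul_one]
    rw [← ENNReal.ofReal_coe_nnreal, ← ENNReal.ofReal_mul (by positivity),
      ← ENNReal.ofReal_add (by positivity) (by positivity), ← ENNReal.ofReal_coe_nnreal, ha2]
    congr 1
    field_simp
    ring

variable (lam : ℝ) {varV varN : ℝ≥0}

/-- The Kalman estimate at time `t` from the estimator `xh` of the previous source sample. -/
noncomputable def filtEst (varV varN : ℝ≥0) (d : ℕ → ℝ≥0)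
    (xh : ∀ t : ℕ, (Fin t → ℝ) × (Fin t → ℝ) → ℝ) (t : ℕ)
    (z : (Fin t → ℝ) × (Fin (t + 1) → ℝ)) : ℝ :=
  filtMean lam (predVar lam varV (d t)) varN (xh t (z.1, fun i => z.2 i.castSucc))
    (z.2 (Fin.last t))

theorem measurable_filtEst {d : ℕ → ℝ≥0} {xh : ∀ t : ℕ, (Fin t → ℝ) × (Fin t → ℝ) → ℝ} {t : ℕ}
    (hxh : Measurable (xh t)) : Measurable (filtEst lam varV varN d xh t) :=
  measurable_filtMean _ _ _ (hxh.comp (by fun_prop)) (by fun_prop)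

/-- A scheme of Gaussian test channels, with recursive estimators `xh`, achieves the prescribed
error variances at the corresponding rates. -/
theorem gaussian_scheme (hV : 0 < varV) (hN : 0 < varN) {T : ℕ} {d : ℕ → ℝ≥0} (h0 : d 0 = 0)
    (hd : ∀ t < T, 0 < d (t + 1) ∧ d (t + 1) ≤ filtVar lam varV varN (d t))
    (κ : CausalKernel (ℝ × ℝ) ℝ) {xh : ∀ t : ℕ, (Fin t → ℝ) × (Fin t → ℝ) → ℝ}
    (hxh : ∀ t, Measurable (xh t)) (hxh0 : ∀ z, xh 0 z = 0)
    {c : ∀ t : ℕ, (Fin t → ℝ) × (Fin (t + 1) → ℝ) → ℝ} (hc : ∀ t, Measurable (c t)) (b : ℕ → ℝ)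
    (hκ : ∀ t p, κ.step t p = gaussianReal (c t (p.2, fun i => (p.1 i).2)
      + b t * (channelGain (filtVar lam varV varN (d t)) (d (t + 1)) * ((p.1 (Fin.last t)).1
        - filtEst lam varV varN d xh t (p.2, fun i => (p.1 i).2)))) (‖b t‖₊ ^ 2))
    (hxhc : ∀ t z u, xh (t + 1) (Fin.snoc z.1 (c t z + b t * u), z.2)
      = filtEst lam varV varN d xh t z
        + channelGain (filtVar lam varV varN (d t)) (d (t + 1)) * d (t + 1) * u) :
    (∀ t (ht : t < T), ∫⁻ ω, ENNReal.ofReal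
      (((ω.1 t).1 - xh (t + 1) (past (Nat.succ_le_of_lt ht) ω)) ^ 2)
        ∂(jointBoth lam varV varN κ T) = d (t + 1)) ∧
    condDirectedInfo (jointBoth lam varV varN κ T) ≤ ∑ t ∈ Finset.range T, ENNReal.ofReal
      (1 / 2 * Real.log (filtVar lam varV varN (d t) / d (t + 1))) := by
  set μ := jointBoth lam varV varN κ T with hμ
  have step : ∀ t (ht : t < T), ∫⁻ ω, ENNReal.ofReal ((lastX t ω.1 - xh t (past ht.le ω)) ^ 2) ∂μ
      = d t → condMutualInfo μ (fun ω => hist (srcX ω.1) (t + 1)) (fun ω => ω.2 ⟨t, ht⟩)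
        (fun ω => (histFin ω.2 ht.le, hist (srcY ω.1) (t + 1)))
          ≤ ENNReal.ofReal (1 / 2 * Real.log (filtVar lam varV varN (d t) / d (t + 1))) ∧
      ∫⁻ ω, ENNReal.ofReal (((ω.1 t).1 - xh (t + 1) (past (Nat.succ_le_of_lt ht) ω)) ^ 2) ∂μ
        = d (t + 1) := by
    intro t ht hdt
    have hl : Measurable fun ω : (ℕ → ℝ × ℝ) × (Fin T → ℝ) => lastX t ω.1 :=
      (measurable_lastX t).comp measurable_fst
    have hi : Measurable fun ω : (ℕ → ℝ × ℝ) × (Fin T → ℝ) => innov lam ω.1 t :=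
      (measurable_innov lam t).comp measurable_fst
    have hX : Measurable fun ω : (ℕ → ℝ × ℝ) × (Fin T → ℝ) => hist (srcX ω.1) (t + 1) :=
      (measurable_hist _).comp (measurable_srcX.comp measurable_fst)
    have hZ : Measurable fun ω : (ℕ → ℝ × ℝ) × (Fin T → ℝ) =>
        (histFin ω.2 ht.le, hist (srcY ω.1) (t + 1)) :=
      ((measurable_histFin ht.le).comp measurable_snd).prodMk
        ((measurable_hist _).comp (measurable_srcY.comp measurable_fst))
    have hs := (lintegral_sq_kalman lam hV hN (measurable_past ht.le) hl (measurable_fst.comp hi)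
        (measurable_snd.comp hi) (hxh t) (isNoiseStep_jointBoth lam varV varN κ ht.le) hdt).2
    simp only [Function.comp, fst_eq_innov, snd_eq_innov] at hs
    have hfe := measurable_filtEst lam (varV := varV) (varN := varN) (d := d) (hxh t)
    have hg : Measurable fun z : ((Fin t → ℝ) × (Fin (t + 1) → ℝ)) × ℝ =>
        ((Fin.snoc z.1.1 z.2 : Fin (t + 1) → ℝ), z.1.2) :=
      ((measurable_snoc t).comp (by fun_prop : Measurable fun
        z : ((Fin t → ℝ) × (Fin (t + 1) → ℝ)) × ℝ => (z.1.1, z.2))).prodMk (by fun_prop)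
    have hf : Measurable fun p : (ℕ → ℝ × ℝ) × (Fin t → ℝ) =>
        ((p.2, hist (srcY p.1) (t + 1)), hist (srcX p.1) (t + 1)) :=
      (measurable_snd.prodMk ((measurable_hist _).comp (measurable_srcY.comp
        measurable_fst))).prodMk ((measurable_hist _).comp (measurable_srcX.comp measurable_fst))
    have hm : Measurable fun ω : (ℕ → ℝ × ℝ) × (Fin T → ℝ) => (ω.1, histFin ω.2 ht.le) :=
      measurable_fst.prodMk ((measurable_histFin _).comp measurable_snd)
    have hct := hc t
    have key := testChannel_step (μ := μ) (W := fun ω => ω.2 ⟨t, ht⟩)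
      (x := fun x : Fin (t + 1) → ℝ => x (Fin.last t))
      (xh := fun z : ((Fin t → ℝ) × (Fin (t + 1) → ℝ)) × ℝ =>
        xh (t + 1) (Fin.snoc z.1.1 z.2, z.1.2)) hX (by fun_prop) hZ (by fun_prop) hfe
      (hc t) (b t) (hd t ht).1 (hd t ht).2 hs ?_ ((hxh (t + 1)).comp hg) (hxhc t)
    · refine ⟨key.1, ?_⟩
      have hp (ω : (ℕ → ℝ × ℝ) × (Fin T → ℝ)) :
          ((Fin.snoc (histFin ω.2 ht.le) (ω.2 ⟨t, ht⟩) : Fin (t + 1) → ℝ),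
            hist (srcY ω.1) (t + 1)) = past (Nat.succ_le_of_lt ht) ω := by
        rw [← appendPast_past ht]
        exact Prod.ext rfl (congrArg Prod.snd (appendPast_past ht ω)).symm
      have h2 := key.2
      simp only [hp] at h2
      exact h2
    · refine map_comp_compProd (X := fun ω : (ℕ → ℝ × ℝ) × (Fin T → ℝ) =>
        (ω.1, histFin ω.2 ht.le)) (Y := fun ω => ω.2 ⟨t, ht⟩) hm (by fun_prop) hf _ ?_
      rw [hμ, map_step_jointBoth lam varV varN κ ht]
      congr 1
      ext1 p
      rw [Kernel.comap_apply, Kernel.comap_apply, hκ]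
      rfl
  have herr : ∀ t (ht : t ≤ T), ∫⁻ ω, ENNReal.ofReal ((lastX t ω.1 - xh t (past ht ω)) ^ 2) ∂μ
      = d t := by
    intro t
    induction t with
    | zero => intro ht; simp [lastX, hxh0, h0]
    | succ t ih =>
      intro ht
      have := (step t ht (ih (Nat.le_of_succ_le ht))).2
      rw [← this]
      rfl
  refine ⟨fun t ht => (step t ht (herr t ht.le)).2, ?_⟩
  rw [condDirectedInfo, Finset.sum_range]
  exact Finset.sum_le_sum fun t _ => (step t t.isLt (herr t t.isLt.le)).1

/-- The recursive estimator of the scheme that transmits the source in unit Gaussian noise. -/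
noncomputable def recEst (varV varN : ℝ≥0) (d : ℕ → ℝ≥0) :
    ∀ t : ℕ, (Fin t → ℝ) × (Fin t → ℝ) → ℝ
  | 0, _ => 0
  | t + 1, h =>
    let xf := filtMean lam (predVar lam varV (d t)) varN
      (recEst varV varN d t (fun i => h.1 i.castSucc, fun i => h.2 i.castSucc)) (h.2 (Fin.last t))
    xf + channelGain (filtVar lam varV varN (d t)) (d (t + 1)) * d (t + 1)
      * (h.1 (Fin.last t) - channelGain (filtVar lam varV varN (d t)) (d (t + 1)) * xf)

theorem measurable_recEst (d : ℕ → ℝ≥0) (t : ℕ) :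
    Measurable (recEst lam varV varN d t) := by
  induction t with
  | zero => exact measurable_const
  | succ t ih =>
    have h : Measurable fun h : (Fin (t + 1) → ℝ) × (Fin (t + 1) → ℝ) =>
        filtMean lam (predVar lam varV (d t)) varN
          (recEst lam varV varN d t (fun i => h.1 i.castSucc, fun i => h.2 i.castSucc))
          (h.2 (Fin.last t)) :=
      measurable_filtMean _ _ _ (ih.comp (by fun_prop)) (by fun_prop)
    exact h.add (((by fun_prop : Measurable
      fun h : (Fin (t + 1) → ℝ) × (Fin (t + 1) → ℝ) => h.1 (Fin.last t)).sub
        (h.const_mul _)).const_mul _)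

/-- With decoder side information, the source is transmitted in Gaussian noise and estimated by a
Kalman filter that observes both the transmitted samples and the side information. -/
theorem exists_scheme_jointDec (hV : 0 < varV) (hN : 0 < varN) {T : ℕ} {d : ℕ → ℝ≥0}
    (h0 : d 0 = 0) (hd : ∀ t < T, 0 < d (t + 1) ∧ d (t + 1) ≤ filtVar lam varV varN (d t)) :
    ∃ (κ : CausalKernel ℝ ℝ) (g : Reconstruction ℝ),
      (∀ t (ht : t < T), stepDist (jointDec lam varV varN κ T) g ht = d (t + 1)) ∧
      condDirectedInfo (jointDec lam varV varN κ T) ≤ ∑ t ∈ Finset.range T, ENNReal.ofReal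
        (1 / 2 * Real.log (filtVar lam varV varN (d t) / d (t + 1))) := by
  set a : ℕ → ℝ := fun t => channelGain (filtVar lam varV varN (d t)) (d (t + 1)) with ha
  set κ : CausalKernel ℝ ℝ :=
    { step := fun t => gaussKernel (fun p => a t * p.1 (Fin.last t)) (by fun_prop) 1
      markov := fun t => inferInstance } with hκ
  refine ⟨κ, ⟨fun t => recEst lam varV varN d (t + 1), fun t => measurable_recEst lam d _⟩, ?_⟩
  simp only [jointDec_eq_jointBoth_pull]
  have hfe (t : ℕ) := measurable_filtEst lam (varV := varV) (varN := varN) (d := d)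
    (measurable_recEst lam (varV := varV) (varN := varN) d t)
  refine gaussian_scheme lam hV hN h0 hd κ.pull (measurable_recEst lam d) (fun _ => rfl)
    (c := fun t z => a t * filtEst lam varV varN d (recEst lam varV varN d) t z)
    (fun t => (hfe t).const_mul _) (fun _ => 1) (fun t p => ?_) fun t z u => ?_
  · change gaussianReal (a t * (p.1 (Fin.last t)).1) 1 = _
    simp only [nnnorm_one, one_pow, one_mul]
    congr 1
    simp only [ha]
    ring
  · simp only [recEst, Fin.snoc_last, Fin.snoc_castSucc, one_mul]
    have : filtMean lam (predVar lam varV (d t)) varN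
        (recEst lam varV varN d t (fun i => z.1 i, fun i => z.2 i.castSucc)) (z.2 (Fin.last t))
        = filtEst lam varV varN d (recEst lam varV varN d) t z := rfl
    rw [this]
    simp only [ha]
    ring

/-- With two-sided side information, the transmitted sample is itself the estimate: the Kalman
estimate from the previous samples, corrected by a noisy observation of its error. -/
theorem exists_scheme_jointBoth (hV : 0 < varV) (hN : 0 < varN) {T : ℕ} {d : ℕ → ℝ≥0}
    (h0 : d 0 = 0) (hd : ∀ t < T, 0 < d (t + 1) ∧ d (t + 1) ≤ filtVar lam varV varN (d t)) :
    ∃ κ : CausalKernel (ℝ × ℝ) ℝ,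
      (∀ t (ht : t < T), ∫⁻ ω, ENNReal.ofReal (((ω.1 t).1 - ω.2 ⟨t, ht⟩) ^ 2)
        ∂(jointBoth lam varV varN κ T) = d (t + 1)) ∧
      condDirectedInfo (jointBoth lam varV varN κ T) ≤ ∑ t ∈ Finset.range T, ENNReal.ofReal
        (1 / 2 * Real.log (filtVar lam varV varN (d t) / d (t + 1))) := by
  set a : ℕ → ℝ := fun t => channelGain (filtVar lam varV varN (d t)) (d (t + 1)) with ha
  -- the estimate of the previous sample is the previous reconstruction
  set xh : ∀ t : ℕ, (Fin t → ℝ) × (Fin t → ℝ) → ℝ := fun t =>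
    match t with
    | 0 => fun _ => 0
    | t + 1 => fun h => h.1 (Fin.last t) with hxh
  have hxhm : ∀ t, Measurable (xh t) := by
    intro t
    cases t with
    | zero => exact measurable_const
    | succ t => simp only [hxh]; fun_prop
  have hfe (t : ℕ) := measurable_filtEst lam (varV := varV) (varN := varN) (d := d) (hxhm t)
  have hstep (t : ℕ) : Measurable fun p : (Fin (t + 1) → ℝ × ℝ) × (Fin t → ℝ) =>
      filtEst lam varV varN d xh t (p.2, fun i => (p.1 i).2)
        + a t * d (t + 1) * (a t * ((p.1 (Fin.last t)).1
          - filtEst lam varV varN d xh t (p.2, fun i => (p.1 i).2))) := by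
    have := (hfe t).comp (by fun_prop : Measurable
      fun p : (Fin (t + 1) → ℝ × ℝ) × (Fin t → ℝ) => (p.2, fun i => (p.1 i).2))
    exact this.add ((((by fun_prop : Measurable
      fun p : (Fin (t + 1) → ℝ × ℝ) × (Fin t → ℝ) => (p.1 (Fin.last t)).1).sub
        this).const_mul _).const_mul _)
  set κ : CausalKernel (ℝ × ℝ) ℝ :=
    { step := fun t => gaussKernel _ (hstep t) (‖a t * d (t + 1)‖₊ ^ 2)
      markov := fun t => inferInstance } with hκ
  refine ⟨κ, gaussian_scheme lam hV hN h0 hd κ hxhm (fun _ => rfl)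
    (c := fun t => filtEst lam varV varN d xh t) hfe (fun t => a t * d (t + 1))
    (fun t p => rfl) fun t z u => ?_⟩
  simp only [hxh, Fin.snoc_last]
  rfl

end Achievability

/-! ### Sequences of error variances -/

section Variances

variable (lam : ℝ) {v n : ℝ≥0}

theorem coe_filtVar (d : ℝ≥0) : (filtVar lam v n d : ℝ)
    = (lam ^ 2 * d + v) * n / (lam ^ 2 * d + v + n) := by
  rw [filtVar]; push_cast; rw [coe_predVar]

theorem filtVar_mono (hv : 0 < v) {d d' : ℝ≥0} (h : d ≤ d') :
    filtVar lam v n d ≤ filtVar lam v n d' := by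
  rw [← NNReal.coe_le_coe, coe_filtVar, coe_filtVar]
  have hv' : (0 : ℝ) < v := hv
  have h' : lam ^ 2 * (d : ℝ) ≤ lam ^ 2 * d' :=
    mul_le_mul_of_nonneg_left (NNReal.coe_le_coe.2 h) (sq_nonneg _)
  have h0 : 0 ≤ lam ^ 2 * (d : ℝ) := by positivity
  have hn' := n.coe_nonneg
  rw [div_le_div_iff₀ (by positivity) (by positivity)]
  have := mul_le_mul_of_nonneg_right h' (mul_nonneg hn' hn')
  nlinarith

theorem filtVar_le (hv : 0 < v) (d : ℝ≥0) : filtVar lam v n d ≤ n := by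
  rw [← NNReal.coe_le_coe, coe_filtVar]
  have hv' : (0 : ℝ) < v := hv
  have h0 : 0 ≤ lam ^ 2 * (d : ℝ) := by positivity
  have hn' := n.coe_nonneg
  rw [div_le_iff₀ (by positivity)]
  nlinarith

/-- By concavity of the filtered variance, which is nonnegative at zero. -/
theorem mul_filtVar_le (hv : 0 < v) {θ : ℝ≥0} (hθ : θ ≤ 1) (d : ℝ≥0) :
    θ * filtVar lam v n d ≤ filtVar lam v n (θ * d) := by
  rw [← NNReal.coe_le_coe, NNReal.coe_mul, coe_filtVar, coe_filtVar, NNReal.coe_mul]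
  have hv' : (0 : ℝ) < v := hv
  have hθ' : (θ : ℝ) ≤ 1 := hθ
  have hθ0 := θ.coe_nonneg
  have hn' := n.coe_nonneg
  have h0 : 0 ≤ lam ^ 2 * (d : ℝ) := by positivity
  rw [← mul_div_assoc, div_le_div_iff₀ (by positivity) (by positivity)]
  set x : ℝ := lam ^ 2 * d with hx
  have e : lam ^ 2 * (θ * (d : ℝ)) = θ * x := by rw [hx]; ring
  rw [e]
  have h1 : 0 ≤ (1 - (θ : ℝ)) * n * (v * (x + v + n) + θ * x * (x + v)) :=
    mul_nonneg (mul_nonneg (sub_nonneg.2 hθ') hn') (by positivity)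
  have h2 : 0 ≤ (1 - (θ : ℝ)) * n * (θ * x * (x + v)) :=
    mul_nonneg (mul_nonneg (sub_nonneg.2 hθ') hn') (by positivity)
  nlinarith

theorem filtVar_sub_le (hv : 0 < v) {d d' : ℝ≥0} (h : d ≤ d') :
    (filtVar lam v n d' : ℝ) - filtVar lam v n d ≤ lam ^ 2 * (d' - d) := by
  rw [coe_filtVar, coe_filtVar]
  have hv' : (0 : ℝ) < v := hv
  have h' : lam ^ 2 * (d : ℝ) ≤ lam ^ 2 * d' :=
    mul_le_mul_of_nonneg_left (NNReal.coe_le_coe.2 h) (sq_nonneg _)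
  have h0 : 0 ≤ lam ^ 2 * (d : ℝ) := by positivity
  have hn' := n.coe_nonneg
  rw [mul_sub]
  set x : ℝ := lam ^ 2 * d
  set y : ℝ := lam ^ 2 * d'
  have h0' : 0 ≤ y := h0.trans h'
  rw [div_sub_div _ _ (by positivity) (by positivity), div_le_iff₀ (by positivity)]
  have h1 : 0 ≤ (y - x) * ((y + v) * (x + v) + n * (y + v) + n * (x + v)) :=
    mul_nonneg (sub_nonneg.2 h') (by positivity)
  nlinarith

/-- The sequences of error variances that a scheme of horizon `T` may have: the variance starts
from zero, stays positive, and never exceeds the filtered variance. -/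
def IsFeasible (v n : ℝ≥0) (T : ℕ) (d : ℕ → ℝ≥0) : Prop :=
  d 0 = 0 ∧ ∀ t < T, 0 < d (t + 1) ∧ d (t + 1) ≤ filtVar lam v n (d t)

/-- The rate spent at time `t` on reducing the filtered variance. -/
noncomputable def stepRate (v n : ℝ≥0) (d : ℕ → ℝ≥0) (t : ℕ) : ℝ :=
  1 / 2 * Real.log (filtVar lam v n (d t) / d (t + 1))

variable {lam}

theorem stepRate_nonneg {T : ℕ} {d : ℕ → ℝ≥0} (hd : IsFeasible lam v n T d) {t : ℕ} (ht : t < T) :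
    0 ≤ stepRate lam v n d t := by
  have h0 : (0 : ℝ) < d (t + 1) := (hd.2 t ht).1
  have : (1 : ℝ) ≤ filtVar lam v n (d t) / d (t + 1) :=
    (one_le_div h0).2 (NNReal.coe_le_coe.2 (hd.2 t ht).2)
  have := Real.log_nonneg this
  unfold stepRate
  positivity

/-- By concavity of the logarithm, a bounded average rate forces a positive average distortion. -/
theorem mul_exp_le_sum (hv : 0 < v) (hn : 0 < n) {T : ℕ} {d : ℕ → ℝ≥0}
    (hd : IsFeasible lam v n T d) {R : ℝ}
    (hR : ∑ t ∈ Finset.range T, stepRate lam v n d t ≤ T * R) :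
    T * (filtVar lam v n 0 * Real.exp (-(2 * R))) ≤ ∑ t ∈ Finset.range T, (d (t + 1) : ℝ) := by
  have hs : (0 : ℝ) < filtVar lam v n 0 := filtVar_pos hv hn
  set a : ℝ := filtVar lam v n 0 * Real.exp (-(2 * R)) with ha
  have hapos : 0 < a := by positivity
  have hla : Real.log a = Real.log (filtVar lam v n 0) - 2 * R := by
    rw [ha, Real.log_mul hs.ne' (Real.exp_pos _).ne', Real.log_exp]; ring
  have h : ∀ t ∈ Finset.range T,
      1 + Real.log (filtVar lam v n 0) - Real.log a - 2 * stepRate lam v n d t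
        ≤ d (t + 1) / a := by
    intro t ht
    obtain ⟨h1, -⟩ := hd.2 t (Finset.mem_range.1 ht)
    have h1' : (0 : ℝ) < d (t + 1) := h1
    have h2 : (0 : ℝ) < filtVar lam v n (d t) := filtVar_pos hv hn
    have h3 := Real.log_le_sub_one_of_pos (div_pos h1' hapos)
    rw [Real.log_div h1'.ne' hapos.ne'] at h3
    have h4 : Real.log (filtVar lam v n 0) ≤ Real.log (filtVar lam v n (d t)) :=
      Real.log_le_log hs (NNReal.coe_le_coe.2 (filtVar_mono lam hv (zero_le)))
    rw [stepRate, Real.log_div h2.ne' h1'.ne']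
    linarith
  have hsum := Finset.sum_le_sum h
  rw [Finset.sum_sub_distrib, ← Finset.mul_sum, ← Finset.sum_div, Finset.sum_const,
    Finset.card_range, nsmul_eq_mul, le_div_iff₀ hapos, hla] at hsum
  nlinarith

/-- The variances that need no transmission at all. -/
noncomputable def freeVar (lam : ℝ) (v n : ℝ≥0) : ℕ → ℝ≥0
  | 0 => 0
  | t + 1 => filtVar lam v n (freeVar lam v n t)

theorem isFeasible_freeVar (hv : 0 < v) (hn : 0 < n) (T : ℕ) :
    IsFeasible lam v n T (freeVar lam v n) :=
  ⟨rfl, fun _ _ => ⟨filtVar_pos hv hn, le_rfl⟩⟩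

theorem stepRate_freeVar (hv : 0 < v) (hn : 0 < n) (t : ℕ) :
    stepRate lam v n (freeVar lam v n) t = 0 := by
  have h : (0 : ℝ) < filtVar lam v n (freeVar lam v n t) := filtVar_pos hv hn
  rw [stepRate, freeVar, div_self h.ne', Real.log_one, mul_zero]

/-- A feasible sequence may be scaled down, at the expense of a fixed additional rate. -/
theorem exists_scaled (hv : 0 < v) (hn : 0 < n) {T : ℕ} {d : ℕ → ℝ≥0}
    (hd : IsFeasible lam v n T d) {η : ℝ} (hη : 0 ≤ η) :
    ∃ d', IsFeasible lam v n T d' ∧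
      ∑ t ∈ Finset.range T, stepRate lam v n d' t
        ≤ ∑ t ∈ Finset.range T, stepRate lam v n d t + T * (η / 2) ∧
      ∑ t ∈ Finset.range T, (d' (t + 1) : ℝ)
        = Real.exp (-η) * ∑ t ∈ Finset.range T, (d (t + 1) : ℝ) := by
  set θ : ℝ≥0 := ⟨Real.exp (-η), (Real.exp_pos _).le⟩ with hθ
  have hθc : (θ : ℝ) = Real.exp (-η) := rfl
  have hθ0 : 0 < θ := Real.exp_pos _
  have hθ1 : θ ≤ 1 := by
    rw [← NNReal.coe_le_coe, hθc, NNReal.coe_one, Real.exp_le_one_iff]; linarith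
  refine ⟨fun t => θ * d t, ⟨by simp [hd.1], fun t ht =>
    ⟨mul_pos hθ0 (hd.2 t ht).1, ?_⟩⟩, ?_, ?_⟩
  · exact (mul_le_mul_right (hd.2 t ht).2 _).trans (mul_filtVar_le lam hv hθ1 _)
  · have h : ∀ t ∈ Finset.range T, stepRate lam v n (fun t => θ * d t) t
        ≤ stepRate lam v n d t + η / 2 := by
      intro t ht
      have h1 : (0 : ℝ) < d (t + 1) := (hd.2 t (Finset.mem_range.1 ht)).1
      have h2 : (0 : ℝ) < filtVar lam v n (d t) := filtVar_pos hv hn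
      have h3 : (0 : ℝ) < filtVar lam v n (θ * d t) := filtVar_pos hv hn
      have h4 : Real.log (filtVar lam v n (θ * d t)) ≤ Real.log (filtVar lam v n (d t)) := by
        refine Real.log_le_log h3 (NNReal.coe_le_coe.2 (filtVar_mono lam hv ?_))
        exact mul_le_of_le_one_left' hθ1
      unfold stepRate
      rw [NNReal.coe_mul, Real.log_div h3.ne' (by positivity), Real.log_div h2.ne' h1.ne',
        Real.log_mul (by positivity) h1.ne', hθc, Real.log_exp]
      linarith
    refine (Finset.sum_le_sum h).trans (le_of_eq ?_)
    rw [Finset.sum_add_distrib, Finset.sum_const, Finset.card_range, nsmul_eq_mul]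
  · rw [Finset.mul_sum]
    exact Finset.sum_congr rfl fun t _ => by rw [NNReal.coe_mul, hθc]

/-- If the variances of a feasible sequence are hardly below the filtered ones, a fraction of the
latter is achieved at a fixed rate. -/
theorem exists_reduced (hv : 0 < v) (hn : 0 < n) {T : ℕ} {d : ℕ → ℝ≥0}
    (hd : IsFeasible lam v n T d) {C r : ℝ} (hC : 0 ≤ C)
    (hr : ∑ t ∈ Finset.range T, ((filtVar lam v n (d t) : ℝ) - d (t + 1)) ≤ T * r)
    (hrC : lam ^ 2 * r ≤ C * filtVar lam v n 0) :
    ∃ d', IsFeasible lam v n T d' ∧ ∑ t ∈ Finset.range T, stepRate lam v n d' t ≤ T * C ∧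
      ∑ t ∈ Finset.range T, (d' (t + 1) : ℝ)
        ≤ Real.exp (-C) * (∑ t ∈ Finset.range T, (d (t + 1) : ℝ) + T * r) := by
  set θ : ℝ≥0 := ⟨Real.exp (-C), (Real.exp_pos _).le⟩ with hθ
  have hθc : (θ : ℝ) = Real.exp (-C) := rfl
  have hθ0 : 0 < θ := Real.exp_pos _
  have hθ1 : θ ≤ 1 := by
    rw [← NNReal.coe_le_coe, hθc, NNReal.coe_one, Real.exp_le_one_iff]; linarith
  have hs0 : (0 : ℝ) < filtVar lam v n 0 := filtVar_pos hv hn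
  set d' : ℕ → ℝ≥0 := fun t => if t = 0 then 0 else θ * filtVar lam v n (d (t - 1)) with hd'
  have hd's (t : ℕ) : d' (t + 1) = θ * filtVar lam v n (d t) := by simp [hd']
  refine ⟨d', ⟨by simp [hd'], fun t ht => ⟨?_, ?_⟩⟩, ?_, ?_⟩
  · rw [hd's]; exact mul_pos hθ0 (filtVar_pos hv hn)
  · rw [hd's]
    cases t with
    | zero => simp only [hd', if_pos, hd.1]; exact mul_le_of_le_one_left' hθ1
    | succ t =>
      rw [hd's]
      have := filtVar_mono lam hv (n := n) (hd.2 t (by omega)).2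
      exact (mul_le_mul_right this _).trans (mul_filtVar_le lam hv hθ1 _)
  · -- the gap between the reduced sequence and the given one costs little
    set gap : ℕ → ℝ := fun t => (filtVar lam v n (d t) : ℝ) - d (t + 1) with hgap
    have hgap0 : ∀ t < T, 0 ≤ gap t := fun t ht =>
      sub_nonneg.2 (NNReal.coe_le_coe.2 (hd.2 t ht).2)
    set c : ℝ := lam ^ 2 / (2 * filtVar lam v n 0) with hc
    have hc0 : 0 ≤ c := by positivity
    have hlog (t : ℕ) : stepRate lam v n d' t = C / 2
        + 1 / 2 * Real.log (filtVar lam v n (d' t) / filtVar lam v n (d t)) := by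
      have h2 : (0 : ℝ) < filtVar lam v n (d t) := filtVar_pos hv hn
      have h3 : (0 : ℝ) < filtVar lam v n (d' t) := filtVar_pos hv hn
      unfold stepRate
      rw [hd's, NNReal.coe_mul, Real.log_div h3.ne' (by positivity),
        Real.log_mul (by positivity) h2.ne', hθc, Real.log_exp, Real.log_div h3.ne' h2.ne']
      ring
    have hstep : ∀ t, t + 1 < T → stepRate lam v n d' (t + 1) ≤ C / 2 + c * gap t := by
      intro t ht
      rw [hlog]
      have h2 : (0 : ℝ) < filtVar lam v n (d (t + 1)) := filtVar_pos hv hn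
      have h3 : (0 : ℝ) < filtVar lam v n (d' (t + 1)) := filtVar_pos hv hn
      have h4 := Real.log_le_sub_one_of_pos (div_pos h3 h2)
      have h5 : (filtVar lam v n (d' (t + 1)) : ℝ) - filtVar lam v n (d (t + 1))
          ≤ lam ^ 2 * gap t := by
        have e1 : d' (t + 1) ≤ filtVar lam v n (d t) := by
          rw [hd's]; exact mul_le_of_le_one_left' hθ1
        have e2 := filtVar_sub_le lam hv (n := n) (hd.2 t (by omega)).2
        have e3 := NNReal.coe_le_coe.2 (filtVar_mono lam hv (n := n) e1)
        linarith
      have h6 : (filtVar lam v n 0 : ℝ) ≤ filtVar lam v n (d (t + 1)) :=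
        NNReal.coe_le_coe.2 (filtVar_mono lam hv zero_le)
      have h7 : (filtVar lam v n (d' (t + 1)) : ℝ) / filtVar lam v n (d (t + 1)) - 1
          ≤ 2 * (c * gap t) := by
        rw [div_sub_one h2.ne', div_le_iff₀ h2]
        have h8 := mul_le_mul_of_nonneg_left h6 (mul_nonneg hc0 (hgap0 t (by omega)))
        have h9 : 2 * (c * filtVar lam v n 0) = lam ^ 2 := by rw [hc]; field_simp
        have h10 : lam ^ 2 * gap t = 2 * (c * gap t * filtVar lam v n 0) := by rw [← h9]; ring
        linarith
      linarith
    have hcr : c * r ≤ C / 2 := by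
      rw [hc, div_mul_eq_mul_div, div_le_iff₀ (by positivity)]
      linarith
    cases T with
    | zero => simp
    | succ m =>
      have hz : stepRate lam v n d' 0 = C / 2 := by
        have h3 : (0 : ℝ) < filtVar lam v n 0 := hs0
        rw [hlog, hd.1, show d' 0 = 0 from by simp [hd'], div_self h3.ne', Real.log_one]
        ring
      have h1 : ∑ t ∈ Finset.range m, stepRate lam v n d' (t + 1)
          ≤ ∑ t ∈ Finset.range m, (C / 2 + c * gap t) :=
        Finset.sum_le_sum fun t ht => hstep t (by simpa using ht)
      have h2 : ∑ t ∈ Finset.range m, gap t ≤ ∑ t ∈ Finset.range (m + 1), gap t := by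
        rw [Finset.sum_range_succ]
        exact le_add_of_nonneg_right (hgap0 m (Nat.lt_succ_self m))
      rw [Finset.sum_add_distrib, Finset.sum_const, Finset.card_range, nsmul_eq_mul,
        ← Finset.mul_sum] at h1
      rw [Finset.sum_range_succ', hz]
      have h3 := mul_le_mul_of_nonneg_left (h2.trans hr) hc0
      have h4 := mul_le_mul_of_nonneg_left hcr (Nat.cast_nonneg (α := ℝ) (m + 1))
      push_cast at h3 h4 ⊢
      nlinarith
  · have h : ∀ t ∈ Finset.range T, (d' (t + 1) : ℝ) = Real.exp (-C) * (d (t + 1)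
        + ((filtVar lam v n (d t) : ℝ) - d (t + 1))) := by
      intro t _
      rw [hd's, NNReal.coe_mul, hθc]; ring
    rw [Finset.sum_congr rfl h, ← Finset.mul_sum, Finset.sum_add_distrib]
    gcongr

/-- The improvement on the variances of a scheme whose encoder lacks the side information: if the
amounts `K t`, which bound the reduction of the filtered variances, are substantial, the rate spent
on them is saved; if not, the given variances are hardly better than free ones, and the whole
rate `C` is available. -/
theorem exists_contraction (hv : 0 < v) (hn : 0 < n) {C a : ℝ} (hC : 0 < C) (ha : 0 < a) :
    ∃ δ : ℝ≥0, 0 < δ ∧ ∀ c : ℝ≥0, ∃ η : ℝ, 0 < η ∧ ∃ θ : ℝ, 0 ≤ θ ∧ θ < 1 ∧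
      ∀ (T : ℕ) (d K : ℕ → ℝ≥0) (D : ℝ), a ≤ D → IsFeasible lam v n T d →
        (∀ t < T, (filtVar lam v n (d t) : ℝ) ≤ d (t + 1) + δ + c * K t) →
        ∑ t ∈ Finset.range T, (stepRate lam v n d t + K t) ≤ T * (C + η / 2) →
        ∑ t ∈ Finset.range T, (d (t + 1) : ℝ) ≤ T * D →
        ∃ d', IsFeasible lam v n T d' ∧ ∑ t ∈ Finset.range T, stepRate lam v n d' t ≤ T * C ∧
          ∑ t ∈ Finset.range T, (d' (t + 1) : ℝ) ≤ T * (θ * D) := by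
  have hs0 : (0 : ℝ) < filtVar lam v n 0 := filtVar_pos hv hn
  have hexp : 0 < Real.exp (C / 2) - 1 := by
    have := Real.add_one_lt_exp (x := C / 2) (by positivity)
    linarith
  -- `δ` is so small that variances within `2 δ` of the filtered ones can be reduced at the rate `C`
  -- and that the rate gains more than the additional distortion `2 δ`
  set δ : ℝ := min (C * filtVar lam v n 0 / (2 * (lam ^ 2 + 1))) ((Real.exp (C / 2) - 1) * a / 2)
    with hδ
  have hδ0 : 0 < δ := lt_min (by positivity) (by positivity)
  have hδ1 : lam ^ 2 * (2 * δ) ≤ C * filtVar lam v n 0 := by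
    have h1 : δ * (2 * (lam ^ 2 + 1)) ≤ C * filtVar lam v n 0 :=
      (le_div_iff₀ (by positivity)).1 (min_le_left _ _)
    nlinarith
  have hδ2 : 2 * δ ≤ (Real.exp (C / 2) - 1) * a := by
    have := min_le_right (C * filtVar lam v n 0 / (2 * (lam ^ 2 + 1)))
      ((Real.exp (C / 2) - 1) * a / 2)
    rw [← hδ] at this
    linarith
  refine ⟨⟨δ, hδ0.le⟩, hδ0, fun c => ?_⟩
  set η : ℝ := δ / (c + 1) with hη
  have hη0 : 0 < η := by positivity
  have hcη : c * η ≤ δ := by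
    have h : η * (c + 1) = δ := by rw [hη]; field_simp
    nlinarith
  refine ⟨η, hη0, max (Real.exp (-η)) (Real.exp (-(C / 2))), by positivity,
    max_lt (by rw [Real.exp_lt_one_iff]; linarith) (by rw [Real.exp_lt_one_iff]; linarith), ?_⟩
  intro T d K D hD hd hK hsum hav
  have hT : (0 : ℝ) ≤ T := Nat.cast_nonneg T
  rw [Finset.sum_add_distrib] at hsum
  rcases le_or_gt (T * η) (∑ t ∈ Finset.range T, (K t : ℝ)) with h | h
  · obtain ⟨d', h1, h2, h3⟩ := exists_scaled hv hn hd hη0.le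
    refine ⟨d', h1, by linarith, ?_⟩
    rw [h3]
    calc Real.exp (-η) * ∑ t ∈ Finset.range T, (d (t + 1) : ℝ)
        ≤ max (Real.exp (-η)) (Real.exp (-(C / 2))) * (T * D) :=
          mul_le_mul (le_max_left _ _) hav (Finset.sum_nonneg fun t _ => by positivity)
            (by positivity)
      _ = _ := by ring
  · have hr : ∑ t ∈ Finset.range T, ((filtVar lam v n (d t) : ℝ) - d (t + 1)) ≤ T * (2 * δ) := by
      calc ∑ t ∈ Finset.range T, ((filtVar lam v n (d t) : ℝ) - d (t + 1))
          ≤ ∑ t ∈ Finset.range T, (δ + c * K t) := by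
            refine Finset.sum_le_sum fun t ht => ?_
            have : (filtVar lam v n (d t) : ℝ) ≤ d (t + 1) + δ + c * K t :=
              hK t (Finset.mem_range.1 ht)
            linarith
        _ = T * δ + c * ∑ t ∈ Finset.range T, (K t : ℝ) := by
            rw [Finset.sum_add_distrib, Finset.sum_const, Finset.card_range, nsmul_eq_mul,
              ← Finset.mul_sum]
        _ ≤ T * δ + c * (T * η) := by gcongr
        _ ≤ T * (2 * δ) := by nlinarith
    obtain ⟨d', h1, h2, h3⟩ := exists_reduced hv hn hd hC.le (r := 2 * δ) hr hδ1
    refine ⟨d', h1, h2, h3.trans ?_⟩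
    have h4 : ∑ t ∈ Finset.range T, (d (t + 1) : ℝ) + T * (2 * δ)
        ≤ T * (Real.exp (C / 2) * D) := by
      have : 2 * δ ≤ (Real.exp (C / 2) - 1) * D :=
        hδ2.trans (mul_le_mul_of_nonneg_left hD hexp.le)
      have := mul_le_mul_of_nonneg_left this hT
      linarith
    have hD0 : 0 ≤ D := ha.le.trans hD
    calc Real.exp (-C) * (∑ t ∈ Finset.range T, (d (t + 1) : ℝ) + T * (2 * δ))
        ≤ Real.exp (-C) * (T * (Real.exp (C / 2) * D)) := by gcongr
      _ = T * (Real.exp (-(C / 2)) * D) := by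
          have : Real.exp (-(C / 2)) = Real.exp (-C) * Real.exp (C / 2) := by
            rw [← Real.exp_add]; congr 1; ring
          rw [this]; ring
      _ ≤ _ := by gcongr; exact le_max_right _ _

end Variances

/-! ### Comparison of the rate–distortion functions -/

section Rates

variable (lam : ℝ) (varV varN : ℝ≥0)

/-- The rate over the horizon `T` with decoder side information. -/
noncomputable def horizonDec (D : ℝ≥0∞) (T : ℕ) : ℝ≥0∞ :=
  ⨅ (κ : CausalKernel ℝ ℝ) (g : Reconstruction ℝ)
    (_ : distortion (jointDec lam varV varN κ T) g ≤ D),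
    directedInfo (jointDec lam varV varN κ T) / T

/-- The Kostina–Hassibi rate over the horizon `T`. -/
noncomputable def horizonKH (D : ℝ≥0∞) (T : ℕ) : ℝ≥0∞ :=
  ⨅ (κ : CausalKernel ℝ ℝ) (g : Reconstruction ℝ)
    (_ : distortion (jointDec lam varV varN κ T) g ≤ D),
    condDirectedInfo (jointDec lam varV varN κ T) / T

/-- The rate over the horizon `T` with two-sided side information. -/
noncomputable def horizonBoth (D : ℝ≥0∞) (T : ℕ) : ℝ≥0∞ :=
  ⨅ (κ : CausalKernel (ℝ × ℝ) ℝ) (_ : distortionSelf (jointBoth lam varV varN κ T) ≤ D),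
    condDirectedInfo (jointBoth lam varV varN κ T) / T

theorem Rdec_eq (D : ℝ≥0∞) :
    Rdec lam varV varN D = limsup (horizonDec lam varV varN D) atTop := rfl

theorem RKH_eq (D : ℝ≥0∞) :
    RKH lam varV varN D = limsup (horizonKH lam varV varN D) atTop := rfl

theorem distortion_eq_sum {T : ℕ} (μ : Measure ((ℕ → ℝ × ℝ) × (Fin T → ℝ)))
    (g : Reconstruction ℝ) : distortion μ g = (∑ t : Fin T, stepDist μ g t.isLt) / T := rfl

/-- The reconstruction rule that outputs the current sample. -/
def selfReconstruction : Reconstruction ℝ where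
  est k p := p.1 (Fin.last k)
  measurable_est k := by fun_prop

theorem distortion_selfReconstruction {T : ℕ} (μ : Measure ((ℕ → ℝ × ℝ) × (Fin T → ℝ))) :
    distortion μ selfReconstruction = distortionSelf μ := rfl

variable {varV varN}

theorem sum_div_le_distortion_add {T : ℕ} {μ : Measure ((ℕ → ℝ × ℝ) × (Fin T → ℝ))}
    {g : Reconstruction ℝ} {d : ℕ → ℝ≥0} {ε : ℝ≥0}
    (h : ∀ t (ht : t < T), (d (t + 1) : ℝ≥0∞) ≤ stepDist μ g ht + ε) :
    (∑ t ∈ Finset.range T, (d (t + 1) : ℝ≥0∞)) / T ≤ distortion μ g + ε := by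
  have h1 : ∑ t ∈ Finset.range T, (d (t + 1) : ℝ≥0∞)
      ≤ ∑ t : Fin T, stepDist μ g t.isLt + ε * T := by
    rw [← Fin.sum_univ_eq_sum_range (fun t => (d (t + 1) : ℝ≥0∞)) T]
    refine (Finset.sum_le_sum fun (t : Fin T) _ => h t t.isLt).trans_eq ?_
    rw [Finset.sum_add_distrib, Finset.sum_const, Finset.card_univ, Fintype.card_fin,
      nsmul_eq_mul, mul_comm]
  rw [distortion_eq_sum]
  calc (∑ t ∈ Finset.range T, (d (t + 1) : ℝ≥0∞)) / T
      ≤ (∑ t : Fin T, stepDist μ g t.isLt + ε * T) / T := ENNReal.div_le_div_right h1 _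
    _ ≤ _ := by
      rw [ENNReal.add_div]
      exact add_le_add le_rfl (ENNReal.div_le_of_le_mul le_rfl)

/-- Every feasible sequence of error variances is attained with decoder side information. -/
theorem horizonKH_le (hV : 0 < varV) (hN : 0 < varN) {T : ℕ} {d : ℕ → ℝ≥0}
    (hd : IsFeasible lam varV varN T d) {D : ℝ≥0∞}
    (hD : (∑ t ∈ Finset.range T, (d (t + 1) : ℝ≥0∞)) / T ≤ D) :
    horizonKH lam varV varN D T
      ≤ (∑ t ∈ Finset.range T, ENNReal.ofReal (stepRate lam varV varN d t)) / T := by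
  obtain ⟨κ, g, h1, h2⟩ := exists_scheme_jointDec lam hV hN hd.1 hd.2
  refine (iInf₂_le_of_le κ g (iInf_le _ ?_)).trans (ENNReal.div_le_div_right h2 _)
  rw [distortion_eq_sum]
  simp only [h1]
  rwa [Fin.sum_univ_eq_sum_range (fun t => (d (t + 1) : ℝ≥0∞)) T]

/-- Every feasible sequence of error variances is attained with two-sided side information. -/
theorem horizonBoth_le (hV : 0 < varV) (hN : 0 < varN) {T : ℕ} {d : ℕ → ℝ≥0}
    (hd : IsFeasible lam varV varN T d) {D : ℝ≥0∞}
    (hD : (∑ t ∈ Finset.range T, (d (t + 1) : ℝ≥0∞)) / T ≤ D) :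
    horizonBoth lam varV varN D T
      ≤ (∑ t ∈ Finset.range T, ENNReal.ofReal (stepRate lam varV varN d t)) / T := by
  obtain ⟨κ, h1, h2⟩ := exists_scheme_jointBoth lam hV hN hd.1 hd.2
  refine (iInf_le_of_le κ (iInf_le _ ?_)).trans (ENNReal.div_le_div_right h2 _)
  rw [distortionSelf]
  have h3 (t : Fin T) : ∫⁻ ω, ENNReal.ofReal ((srcX ω.1 t - ω.2 t) ^ 2)
      ∂(jointBoth lam varV varN κ T) = d (t + 1) := h1 t t.isLt
  simp only [h3]
  rwa [Fin.sum_univ_eq_sum_range (fun t => (d (t + 1) : ℝ≥0∞)) T]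

/-- Every scheme yields a feasible sequence of error variances of almost the same distortion. -/
theorem exists_isFeasible_jointBoth (hV : 0 < varV) (hN : 0 < varN)
    (κ : CausalKernel (ℝ × ℝ) ℝ) (T : ℕ) (g : Reconstruction ℝ) {ε : ℝ≥0} (hε : 0 < ε) :
    ∃ d, IsFeasible lam varV varN T d ∧
      (∑ t ∈ Finset.range T, (d (t + 1) : ℝ≥0∞)) / T
        ≤ distortion (jointBoth lam varV varN κ T) g + ε ∧
      (∑ t ∈ Finset.range T, ENNReal.ofReal (stepRate lam varV varN d t)) / T
        ≤ condDirectedInfo (jointBoth lam varV varN κ T) / T := by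
  obtain ⟨d, h0, h1, h2⟩ := exists_variances_jointBoth lam hV hN κ T g hε
  exact ⟨d, ⟨h0, fun t ht => ⟨(h1 t ht).1, (h1 t ht).2.1⟩⟩,
    sum_div_le_distortion_add fun t ht => (h1 t ht).2.2, ENNReal.div_le_div_right h2 _⟩

/-- The scheme with decoder side information is one with two-sided side information. -/
theorem horizonBoth_add_le_horizonKH (hV : 0 < varV) (hN : 0 < varN) (D : ℝ≥0∞) {ε : ℝ≥0}
    (hε : 0 < ε) (T : ℕ) :
    horizonBoth lam varV varN (D + ε) T ≤ horizonKH lam varV varN D T := by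
  refine le_iInf₂ fun κ g => le_iInf fun hD => ?_
  simp only [jointDec_eq_jointBoth_pull] at hD ⊢
  obtain ⟨d, h1, h2, h3⟩ := exists_isFeasible_jointBoth lam hV hN κ.pull T g hε
  exact (horizonBoth_le lam hV hN h1 (h2.trans (add_le_add_left hD _))).trans h3

theorem horizonKH_add_le_horizonBoth (hV : 0 < varV) (hN : 0 < varN) (D : ℝ≥0∞) {ε : ℝ≥0}
    (hε : 0 < ε) (T : ℕ) :
    horizonKH lam varV varN (D + ε) T ≤ horizonBoth lam varV varN D T := by
  refine le_iInf₂ fun κ hD => ?_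
  rw [← distortion_selfReconstruction] at hD
  obtain ⟨d, h1, h2, h3⟩ := exists_isFeasible_jointBoth lam hV hN κ T selfReconstruction hε
  exact (horizonKH_le lam hV hN h1 (h2.trans (add_le_add_left hD _))).trans h3

theorem rateInv_le_of_forall_add_le {R R' : ℝ≥0∞ → ℝ≥0∞}
    (h : ∀ (D : ℝ≥0∞) (ε : ℝ≥0), 0 < ε → R (D + ε) ≤ R' D) (C : ℝ≥0∞) :
    rateInv R C ≤ rateInv R' C :=
  le_sInf fun D hD => ENNReal.le_of_forall_pos_le_add fun ε hε _ =>
    sInf_le ((h D ε hε).trans hD)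

/-- Withholding the side information from the encoder does not raise the rate needed for a given
distortion, when the rate is measured conditionally on the side information. -/
theorem rateInv_RKH_eq_rateInv_Rboth (hV : 0 < varV) (hN : 0 < varN) (C : ℝ≥0∞) :
    rateInv (RKH lam varV varN) C = rateInv (Rboth lam varV varN) C :=
  le_antisymm
    (rateInv_le_of_forall_add_le (fun D _ hε => limsup_le_limsup (Eventually.of_forall
      (horizonKH_add_le_horizonBoth lam hV hN D hε))) C)
    (rateInv_le_of_forall_add_le (fun D _ hε => limsup_le_limsup (Eventually.of_forall
      (horizonBoth_add_le_horizonKH lam hV hN D hε))) C)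

/-- Filtering the side information alone already achieves the distortion `varN`. -/
theorem rateInv_RKH_le (hV : 0 < varV) (hN : 0 < varN) (C : ℝ≥0∞) :
    rateInv (RKH lam varV varN) C ≤ varN := by
  refine sInf_le ?_
  change RKH lam varV varN varN ≤ C
  rw [RKH_eq]
  refine limsup_le_of_le (h := Eventually.of_forall fun T => ?_)
  refine (horizonKH_le lam hV hN (isFeasible_freeVar hV hN T) (D := varN) ?_).trans ?_
  · refine ENNReal.div_le_of_le_mul ((Finset.sum_le_sum (g := fun _ => (varN : ℝ≥0∞))
      fun t _ => ENNReal.coe_le_coe.2 (filtVar_le lam hV _)).trans_eq ?_)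
    rw [Finset.sum_const, Finset.card_range, nsmul_eq_mul, mul_comm]
  · simp [stepRate_freeVar hV hN]

theorem sum_ofReal_div_le {T : ℕ} {f : ℕ → ℝ} (hf : ∀ t < T, 0 ≤ f t) {a : ℝ≥0}
    (h : ∑ t ∈ Finset.range T, f t ≤ T * a) :
    (∑ t ∈ Finset.range T, ENNReal.ofReal (f t)) / T ≤ a := by
  refine ENNReal.div_le_of_le_mul ?_
  rw [← ENNReal.ofReal_sum_of_nonneg fun t ht => hf t (Finset.mem_range.1 ht)]
  refine (ENNReal.ofReal_le_ofReal h).trans_eq ?_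
  rw [mul_comm, ENNReal.ofReal_mul a.coe_nonneg, ENNReal.ofReal_coe_nnreal,
    ENNReal.ofReal_natCast]

theorem sum_le_of_sum_ofReal_le {T : ℕ} {f : ℕ → ℝ} (hf : ∀ t < T, 0 ≤ f t) {a : ℝ≥0}
    (h : ∑ t ∈ Finset.range T, ENNReal.ofReal (f t) ≤ a * T) :
    ∑ t ∈ Finset.range T, f t ≤ T * a := by
  rw [← ENNReal.ofReal_sum_of_nonneg fun t ht => hf t (Finset.mem_range.1 ht)] at h
  refine (ENNReal.ofReal_le_ofReal_iff (by positivity)).1 (h.trans_eq ?_)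
  rw [mul_comm, ENNReal.ofReal_mul (Nat.cast_nonneg _), ENNReal.ofReal_coe_nnreal,
    ENNReal.ofReal_natCast]

/-- A distortion achieved with unconditioned directed information is improved by a fixed factor
when the rate is measured conditionally on the side information. -/
theorem exists_forall_RKH_le (hV : 0 < varV) (hN : 0 < varN) {C : ℝ≥0} (hC : 0 < C) :
    ∃ θ : ℝ≥0, θ < 1 ∧ ∃ a : ℝ≥0, 0 < a ∧ ∀ D : ℝ≥0, Rdec lam varV varN D ≤ C →
      ∀ ε : ℝ≥0, 0 < ε → a ≤ D + ε ∧ RKH lam varV varN (θ * (D + ε)) ≤ C := by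
  have hs0 : (0 : ℝ) < filtVar lam varV varN 0 := filtVar_pos hV hN
  obtain ⟨a, ha⟩ : ∃ a : ℝ≥0, (a : ℝ) = filtVar lam varV varN 0 * Real.exp (-(2 * (C + 1))) :=
    ⟨⟨_, by positivity⟩, rfl⟩
  have ha0 : 0 < a := by rw [← NNReal.coe_pos, ha]; positivity
  obtain ⟨δ, hδ, h⟩ := exists_contraction (lam := lam) hV hN (C := C) hC (a := a) ha0
  obtain ⟨c, hc⟩ := exists_forall_exists_variances_jointDec lam hV hN hδ
  obtain ⟨η, hη, θ, hθ0, hθ1, h⟩ := h c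
  lift θ to ℝ≥0 using hθ0
  lift η to ℝ≥0 using hη.le
  refine ⟨θ, hθ1, a, ha0, fun D hD ε hε => ?_⟩
  -- the excess rate `η'` is absorbed by the contraction and leaves the rate bounded by `C + 1`
  set η' : ℝ≥0 := min (η / 2) 1 with hη'
  have hη'0 : 0 < η' := lt_min (half_pos hη) one_pos
  have hev : ∀ᶠ T in atTop, a ≤ D + ε ∧ horizonKH lam varV varN (θ * (D + ε)) T ≤ C := by
    rw [Rdec_eq] at hD
    have hlt : limsup (horizonDec lam varV varN D) atTop < (C + η' : ℝ≥0) :=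
      hD.trans_lt (ENNReal.coe_lt_coe.2 (lt_add_of_pos_right C hη'0))
    filter_upwards [eventually_lt_of_limsup_lt hlt, eventually_gt_atTop 0] with T hT hT0
    have hT0' : (0 : ℝ) < T := Nat.cast_pos.2 hT0
    simp only [horizonDec, iInf_lt_iff] at hT
    obtain ⟨κ, g, hg, hI⟩ := hT
    obtain ⟨d, K, h0, h1, h2⟩ := hc κ T g hε
    have hd : IsFeasible lam varV varN T d := ⟨h0, fun t ht => ⟨(h1 t ht).1, (h1 t ht).2.1⟩⟩
    have hI' : directedInfo (jointDec lam varV varN κ T) ≤ (C + η' : ℝ≥0) * T :=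
      (ENNReal.div_le_iff (by exact_mod_cast hT0.ne') (ENNReal.natCast_ne_top T)).1 hI.le
    have hK (t : ℕ) (ht : t < T) : K t ≠ ∞ := by
      have : K t ≤ (C + η' : ℝ≥0) * T := by
        refine le_trans ?_ (h2.trans hI')
        exact le_add_self.trans (Finset.single_le_sum (f := fun t => ENNReal.ofReal
          (1 / 2 * Real.log (filtVar lam varV varN (d t) / d (t + 1))) + K t)
          (fun _ _ => zero_le) (Finset.mem_range.2 ht))
      exact ne_top_of_le_ne_top
        (ENNReal.mul_ne_top ENNReal.coe_ne_top (ENNReal.natCast_ne_top T)) this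
    have hsum : ∑ t ∈ Finset.range T, (stepRate lam varV varN d t + (K t).toNNReal)
        ≤ T * (C + η' : ℝ≥0) := by
      refine sum_le_of_sum_ofReal_le
        (fun t ht => add_nonneg (stepRate_nonneg hd ht) (NNReal.coe_nonneg _)) ?_
      refine le_trans (Finset.sum_le_sum fun t ht => ?_) (h2.trans hI')
      rw [ENNReal.ofReal_add (stepRate_nonneg hd (Finset.mem_range.1 ht)) (NNReal.coe_nonneg _),
        ENNReal.ofReal_coe_nnreal, ENNReal.coe_toNNReal (hK t (Finset.mem_range.1 ht))]
      rfl
    have hdist : ∑ t ∈ Finset.range T, (d (t + 1) : ℝ) ≤ T * (D + ε : ℝ≥0) := by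
      refine sum_le_of_sum_ofReal_le (fun _ _ => NNReal.coe_nonneg _) ?_
      simp only [ENNReal.ofReal_coe_nnreal]
      rw [← ENNReal.div_le_iff (by exact_mod_cast hT0.ne') (ENNReal.natCast_ne_top T)]
      refine (sum_div_le_distortion_add fun t ht => (h1 t ht).2.2.1).trans ?_
      push_cast
      exact add_le_add_left hg _
    have haD : a ≤ D + ε := by
      rw [← NNReal.coe_le_coe, ha]
      refine le_of_mul_le_mul_left ((mul_exp_le_sum hV hN hd (R := C + 1) ?_).trans hdist) hT0'
      refine (Finset.sum_le_sum fun t _ => ?_).trans (hsum.trans ?_)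
      · exact le_add_of_nonneg_right (NNReal.coe_nonneg _)
      · push_cast
        have : (η' : ℝ) ≤ 1 := NNReal.coe_le_coe.2 (min_le_right (η / 2) 1)
        gcongr
    refine ⟨haD, ?_⟩
    obtain ⟨d', h3, h4, h5⟩ := h T d (fun t => (K t).toNNReal) (D + ε : ℝ≥0) haD hd
      (fun t ht => by
        have := (h1 t ht).2.2.2
        rw [← ENNReal.coe_toNNReal (hK t ht)] at this
        exact_mod_cast this)
      (hsum.trans (by
        push_cast
        have : (η' : ℝ) ≤ η / 2 := NNReal.coe_le_coe.2 (min_le_left (η / 2) 1)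
        gcongr)) hdist
    refine (horizonKH_le lam hV hN h3 ?_).trans
      (sum_ofReal_div_le (fun t ht => stepRate_nonneg h3 ht) h4)
    have := sum_ofReal_div_le (f := fun t => (d' (t + 1) : ℝ)) (a := θ * (D + ε))
      (fun _ _ => NNReal.coe_nonneg _) h5
    simpa only [ENNReal.ofReal_coe_nnreal, ENNReal.coe_mul, ENNReal.coe_add] using this
  refine ⟨hev.exists.choose_spec.1, ?_⟩
  rw [RKH_eq]
  exact limsup_le_of_le (h := hev.mono fun _ h => h.2)

/-- The rate conditional on the side information allows a strictly smaller distortion. -/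
theorem rateInv_RKH_lt_rateInv_Rdec (hV : 0 < varV) (hN : 0 < varN) {C : ℝ≥0∞} (hC : 0 < C)
    (hC' : C < ∞) : rateInv (RKH lam varV varN) C < rateInv (Rdec lam varV varN) C := by
  lift C to ℝ≥0 using hC'.ne
  obtain ⟨θ, hθ, a, ha, h⟩ := exists_forall_RKH_le lam hV hN (ENNReal.coe_pos.1 hC)
  by_cases htop : rateInv (Rdec lam varV varN) C = ∞
  · rw [htop]
    exact (rateInv_RKH_le lam hV hN C).trans_lt ENNReal.coe_lt_top
  have hle : (a : ℝ≥0∞) ≤ rateInv (Rdec lam varV varN) C := by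
    refine le_sInf fun D hD => ?_
    by_cases hDt : D = ∞
    · simp [hDt]
    lift D to ℝ≥0 using hDt
    refine ENNReal.le_of_forall_pos_le_add fun ε hε _ => ?_
    exact_mod_cast (h D hD ε hε).1
  have hlt : rateInv (RKH lam varV varN) C ≤ θ * rateInv (Rdec lam varV varN) C := by
    refine ENNReal.le_of_forall_pos_le_add fun ε hε _ => ?_
    have hε2 : 0 < ε / 2 := half_pos hε
    have hlt : rateInv (Rdec lam varV varN) C
        < rateInv (Rdec lam varV varN) C + (ε / 2 : ℝ≥0) :=
      ENNReal.lt_add_right htop (ENNReal.coe_pos.2 hε2).ne'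
    obtain ⟨D, hD, hD'⟩ := sInf_lt_iff.1 hlt
    lift D to ℝ≥0 using (hD'.trans_le le_top).ne
    calc rateInv (RKH lam varV varN) C
        ≤ θ * (D + (ε / 2 : ℝ≥0)) := sInf_le (h D hD _ hε2).2
      _ ≤ θ * (rateInv (Rdec lam varV varN) C + (ε / 2 : ℝ≥0) + (ε / 2 : ℝ≥0)) := by
        gcongr
      _ = θ * rateInv (Rdec lam varV varN) C + θ * ε := by
        rw [add_assoc, ← ENNReal.coe_add, add_halves, mul_add]
      _ ≤ _ := by
        gcongr
        exact mul_le_of_le_one_left zero_le (ENNReal.coe_le_one_iff.2 hθ.le)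
  refine hlt.trans_lt ?_
  lift rateInv (Rdec lam varV varN) C to ℝ≥0 using htop with D0
  have hD0 : 0 < D0 := ha.trans_le (ENNReal.coe_le_coe.1 hle)
  exact_mod_cast mul_lt_of_lt_one_left hD0 hθ

end Rates

/-! ### Tracking over a memoryless channel -/

section Channel

variable (lam : ℝ) (varV varN : ℝ≥0) {A B B' : Type*} [MeasurableSpace A] [MeasurableSpace B]
  [MeasurableSpace B'] (F : Encoder A) (K : Kernel A B) [IsMarkovKernel K]

theorem lintegral_law_output_succ (T : ℕ) (s : ℕ → ℝ) {f : (Fin (T + 1) → B) → ℝ≥0∞}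
    (hf : Measurable f) :
    ∫⁻ w, f w ∂((F.output K).law (T + 1) s) = ∫⁻ w, ∫⁻ b, f (Fin.snoc w b)
      ∂(K (F.enc T (hist s (T + 1)))) ∂((F.output K).law T s) := by
  have := (F.output K).markov T
  rw [CausalKernel.law.eq_2, Kernel.lintegral_map _ (measurable_snoc T) _ hf]
  exact Kernel.lintegral_compProd _ _ _ (hf.comp (measurable_snoc T))

/-- Relabelling the channel outputs relabels the whole output sequence. -/
theorem law_output_map {e : B → B'} (he : Measurable e) [IsMarkovKernel (K.map e)] (T : ℕ)
    (s : ℕ → ℝ) :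
    (F.output (K.map e)).law T s = ((F.output K).law T s).map fun w => e ∘ w := by
  have hm (k : ℕ) : Measurable fun w : Fin k → B => e ∘ w := by
    refine measurable_pi_lambda _ fun i => ?_
    exact he.comp (measurable_pi_apply i)
  induction T with
  | zero =>
    unfold CausalKernel.law
    rw [Kernel.const_apply, Kernel.const_apply, Measure.map_dirac' (hm 0)]
    congr 1
    exact Subsingleton.elim _ _
  | succ T ih =>
    refine Measure.ext_of_lintegral _ fun f hf => ?_
    have hf' : Measurable fun w : Fin (T + 1) → B => f (e ∘ w) := hf.comp (hm _)
    have hfs : Measurable fun q : (Fin T → B') × B' => f (Fin.snoc q.1 q.2) :=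
      hf.comp (measurable_snoc T)
    have hg : Measurable fun w : Fin T → B' => ∫⁻ b, f (Fin.snoc w b)
        ∂((K.map e) (F.enc T (hist s (T + 1)))) := hfs.lintegral_prod_right'
    rw [lintegral_map hf (hm _), lintegral_law_output_succ F _ T s hf,
      lintegral_law_output_succ F _ T s hf', ih, lintegral_map hg (hm T)]
    refine lintegral_congr fun w => ?_
    simp only [Fin.comp_snoc]
    exact Kernel.lintegral_map K he _ (hfs.comp measurable_prodMk_left)

theorem jointDec_output_map {e : B → B'} (he : Measurable e) [IsMarkovKernel (K.map e)] (T : ℕ) :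
    jointDec lam varV varN (F.output (K.map e)) T
      = (jointDec lam varV varN (F.output K) T).map (Prod.map id fun w => e ∘ w) := by
  have hm : Measurable fun w : Fin T → B => e ∘ w := by
    refine measurable_pi_lambda _ fun i => ?_
    exact he.comp (measurable_pi_apply i)
  unfold jointDec
  rw [← Measure.compProd_map hm]
  congr 1
  ext1 s
  rw [Kernel.map_apply _ hm, Kernel.comap_apply, Kernel.comap_apply, law_output_map F K he]

/-- The reconstruction rule for relabelled channel outputs. -/
def Reconstruction.relabel (g : Reconstruction B) {i : B' → B} (hi : Measurable i) :
    Reconstruction B' where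
  est k p := g.est k (i ∘ p.1, p.2)
  measurable_est k := (g.measurable_est k).comp (Measurable.prodMk
    (measurable_pi_lambda _ fun j => hi.comp ((measurable_pi_apply j).comp measurable_fst))
    measurable_snd)

theorem distortion_relabel {e : B → B'} (he : Measurable e) [IsMarkovKernel (K.map e)] (T : ℕ)
    (g : Reconstruction B) {i : B' → B} (hi : Measurable i) (hie : Function.LeftInverse i e) :
    distortion (jointDec lam varV varN (F.output (K.map e)) T) (g.relabel hi)
      = distortion (jointDec lam varV varN (F.output K) T) g := by
  have hm : Measurable fun w : Fin T → B => e ∘ w := by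
    refine measurable_pi_lambda _ fun i => ?_
    exact he.comp (measurable_pi_apply i)
  unfold distortion
  congr 1
  refine Finset.sum_congr rfl fun t _ => ?_
  rw [jointDec_output_map lam varV varN F K he, lintegral_map _ (measurable_id.prodMap hm)]
  · refine lintegral_congr fun ω => ?_
    have h : i ∘ histFin (e ∘ ω.2) (Nat.succ_le_of_lt t.isLt)
        = histFin ω.2 (Nat.succ_le_of_lt t.isLt) := by
      funext j; exact hie _
    simp only [Reconstruction.relabel, Prod.map, id, h]
  · refine ENNReal.measurable_ofReal.comp (Measurable.pow_const (Measurable.sub ?_ ?_) 2)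
    · exact (measurable_pi_apply (t : ℕ)).comp (measurable_srcX.comp measurable_fst)
    · exact ((g.relabel hi).measurable_est t).comp
        (((measurable_histFin _).comp measurable_snd).prodMk
          ((measurable_hist _).comp (measurable_srcY.comp measurable_fst)))

variable {K} in
/-- The information conveyed by one channel use is at most the average divergence of the channel
from any fixed output law. -/
theorem condMutualInfo_output_le {K : Kernel A ℝ} [IsMarkovKernel K] {T : ℕ} (t : Fin T)
    (ν : Measure ℝ) [IsProbabilityMeasure ν] :
    condMutualInfo (jointDec lam varV varN (F.output K) T)
        (fun ω => hist (srcX ω.1) (t + 1)) (fun ω => ω.2 t) (fun ω => histFin ω.2 t.isLt.le)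
      ≤ ∫⁻ s, InformationTheory.klDiv (K (F.enc t (hist (srcX s) (t + 1)))) ν
        ∂(sourceLaw lam varV varN) := by
  set μ := jointDec lam varV varN (F.output K) T with hμ
  have hx : Measurable fun s : ℕ → ℝ × ℝ => hist (srcX s) (t + 1) :=
    (measurable_hist _).comp measurable_srcX
  have hX : Measurable fun ω : (ℕ → ℝ × ℝ) × (Fin T → ℝ) => hist (srcX ω.1) (t + 1) :=
    hx.comp measurable_fst
  have hZ : Measurable fun ω : (ℕ → ℝ × ℝ) × (Fin T → ℝ) => histFin ω.2 t.isLt.le :=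
    (measurable_histFin _).comp measurable_snd
  have henc := F.measurable_enc t
  have := (F.output K).markov t
  refine (condMutualInfo_le_klDiv hX (by fun_prop) hZ (Kernel.const _ ν)).trans_eq ?_
  have hstep : μ.map (fun ω => ((histFin ω.2 t.isLt.le, hist (srcX ω.1) (t + 1)), ω.2 t))
      = μ.map (fun ω => (histFin ω.2 t.isLt.le, hist (srcX ω.1) (t + 1)))
        ⊗ₘ ((F.output K).step t).comap Prod.swap measurable_swap := by
    rw [hμ, jointDec_eq_jointBoth_pull]
    exact map_step_jointDec lam varV varN (F.output K) t.isLt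
      (f := fun p => (p.2, hist (srcX p.1) (t + 1)))
      (measurable_snd.prodMk (hx.comp measurable_fst)) measurable_swap fun _ => rfl
  rw [hstep, klDiv_compProd_right_eq_lintegral, lintegral_map _ (hZ.prodMk hX)]
  · have hfst : μ.fst = sourceLaw lam varV varN := by rw [hμ, jointDec, Measure.fst_compProd]
    rw [← hfst, Measure.fst, lintegral_map _ measurable_fst]
    · rfl
    · exact (measurable_klDiv_kernel K (Kernel.const _ ν)).comp (henc.comp hx)
  · exact measurable_klDiv_kernel _ _

variable {F K} in
/-- The information conveyed by `T` uses of a memoryless channel is at most `T` times its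
capacity, at the average of the input laws. -/
theorem directedInfo_output_map_le [StandardBorelSpace B] {cost : A → ℝ≥0∞}
    (hcost : Measurable cost) {Γ : ℝ≥0∞} {T : ℕ} (hT : T ≠ 0)
    (hF : F.avgCost cost lam varV varN T ≤ Γ) {e : B → ℝ} (he : Measurable e)
    [IsMarkovKernel (K.map e)] :
    directedInfo (jointDec lam varV varN (F.output (K.map e)) T) / T ≤ capacity K cost Γ := by
  have hT' : (T : ℝ≥0∞) ≠ 0 := by exact_mod_cast hT
  have ha (t : ℕ) : Measurable fun s : ℕ → ℝ × ℝ => F.enc t (hist (srcX s) (t + 1)) :=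
    (F.measurable_enc t).comp ((measurable_hist _).comp measurable_srcX)
  set P : Measure A := (T : ℝ≥0∞)⁻¹ • ∑ t : Fin T,
    (sourceLaw lam varV varN).map fun s => F.enc t (hist (srcX s) (t + 1)) with hP
  have hPint {φ : A → ℝ≥0∞} (hφ : Measurable φ) : ∫⁻ a, φ a ∂P = (∑ t : Fin T,
      ∫⁻ s, φ (F.enc t (hist (srcX s) (t + 1))) ∂(sourceLaw lam varV varN)) / T := by
    rw [hP, lintegral_smul_measure, lintegral_finsetSum_measure, smul_eq_mul, mul_comm,
      div_eq_mul_inv]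
    simp only [lintegral_map hφ (ha _)]
  have hPp : IsProbabilityMeasure P := by
    refine ⟨?_⟩
    rw [← lintegral_one, hPint measurable_const]
    simp [ENNReal.div_self hT' (ENNReal.natCast_ne_top T)]
  set φ : A → ℝ≥0∞ := fun a => InformationTheory.klDiv (K a) (K ∘ₘ P) with hφ
  have hφm : Measurable φ := measurable_klDiv_kernel K (Kernel.const _ (K ∘ₘ P))
  have := Measure.isProbabilityMeasure_map (μ := K ∘ₘ P) he.aemeasurable
  calc directedInfo (jointDec lam varV varN (F.output (K.map e)) T) / T
      ≤ (∑ t : Fin T, ∫⁻ s, φ (F.enc t (hist (srcX s) (t + 1)))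
          ∂(sourceLaw lam varV varN)) / T := by
        refine ENNReal.div_le_div_right (Finset.sum_le_sum fun t _ => ?_) _
        refine (condMutualInfo_output_le lam varV varN F t ((K ∘ₘ P).map e)).trans ?_
        refine lintegral_mono fun s => ?_
        rw [Kernel.map_apply _ he]
        exact InformationTheory.klDiv_map_le _ _ he
    _ = ∫⁻ a, φ a ∂P := (hPint hφm).symm
    _ = InformationTheory.klDiv (P ⊗ₘ K) (P.prod (K ∘ₘ P)) := by
        rw [← Measure.compProd_const, klDiv_compProd_right_eq_lintegral]
        rfl
    _ ≤ capacity K cost Γ := by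
        refine le_iSup₂_of_le P hPp (le_iSup_of_le ?_ le_rfl)
        rw [hPint hcost]
        exact hF

variable {K} in
/-- The converse for tracking over a memoryless channel. -/
theorem rateInv_Rdec_capacity_le_Dop [StandardBorelSpace B] {cost : A → ℝ≥0∞}
    (hcost : Measurable cost) (Γ : ℝ≥0∞) :
    rateInv (Rdec lam varV varN) (capacity K cost Γ) ≤ Dop lam varV varN K cost Γ := by
  refine le_of_forall_gt fun D hD => ?_
  obtain ⟨D', hD', hD'D⟩ := exists_between hD
  refine lt_of_le_of_lt (sInf_le ?_) hD'D
  change Rdec lam varV varN D' ≤ _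
  rw [Rdec_eq]
  refine limsup_le_of_le (h := ?_)
  filter_upwards [eventually_lt_of_limsup_lt hD', eventually_ne_atTop 0] with T hT hT0
  simp only [iInf_lt_iff] at hT
  obtain ⟨F, G, hF, hG⟩ := hT
  have : Nonempty B := nonempty_of_isProbabilityMeasure (K (F.enc 0 fun _ => 0))
  have he := measurableEmbedding_embeddingReal B
  have : IsMarkovKernel (K.map (embeddingReal B)) := Kernel.IsMarkovKernel.map K he.measurable
  refine (iInf₂_le_of_le (F.output (K.map (embeddingReal B)))
    (G.relabel he.measurable_invFun) (iInf_le _ ?_)).trans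
    (directedInfo_output_map_le lam varV varN hcost hT0 hF he.measurable)
  rw [distortion_relabel lam varV varN F K he.measurable T G _ he.leftInverse_invFun]
  exact hG.le

end Channel

end CausalTracking

theorem mainTheorem4 (lam : ℝ) (varV varN : ℝ≥0) (hV : 0 < varV) (hN : 0 < varN)
    {A B : Type*} [MeasurableSpace A] [StandardBorelSpace A]
    [MeasurableSpace B] [StandardBorelSpace B]
    (K : Kernel A B) [IsMarkovKernel K]
    (cost : A → ℝ≥0∞) (hcost : Measurable cost) (Γ : ℝ≥0∞)
    (C : ℝ≥0∞) (hC : CausalTracking.capacity K cost Γ = C) :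
    CausalTracking.rateInv (CausalTracking.Rdec lam varV varN) C
        ≤ CausalTracking.Dop lam varV varN K cost Γ ∧
      (0 < C → C < ∞ →
        CausalTracking.rateInv (CausalTracking.RKH lam varV varN) C
          < CausalTracking.rateInv (CausalTracking.Rdec lam varV varN) C) ∧
      CausalTracking.rateInv (CausalTracking.RKH lam varV varN) C
        = CausalTracking.rateInv (CausalTracking.Rboth lam varV varN) C := by
  refine ⟨?_, CausalTracking.rateInv_RKH_lt_rateInv_Rdec lam hV hN,
    CausalTracking.rateInv_RKH_eq_rateInv_Rboth lam hV hN C⟩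
  rw [← hC]
  exact CausalTracking.rateInv_Rdec_capacity_le_Dop lam varV varN hcost Γ
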